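/- Let $n\ge 4$ and let $J=\mathbb R\oplus\mathbb R^{n-1}$ be the Jordan algebra with product $(s,x)(t,y)=(st+x\cdot y,\,sy+tx)$ and determinant $\det(s,x)=s^2-|x|^2$; the latter is extended to $\mathbb C^n$ by $\det z=z_0^2-z_1^2-\dots-z_{n-1}^2$. Let $\Omega=\{(s,x): s^2-|x|^2>0,\ s>0\}$ and $T_\Omega=\{z\in\mathbb C^n:\operatorname{Im} z\in\Omega\}$. Put $c_1=(\frac12,\frac12,0,\dots,0)$, $c_2=(\frac12,-\frac12,0,\dots,0)$, and let $T_{\Omega(\mathbf c)}=\{w_1c_1+w_2c_2:\ w_1,w_2\in\mathcal H\}\subset T_\Omega$, which is identified with $\mathcal H\times\mathcal H$, where $\mathcal H$ is the upper half-plane. Write $\operatorname{res}$ for the restriction of functions from $T_\Omega$ to $T_{\Omega(\mathbf c)}$. Let $G$ be the neutral component of the group of biholomorphic automorphisms of $T_\Omega$ (with the compact-open topology), and let $G(\mathbf c)$ be the neutral component of $\{g\in G: g(T_{\Omega(\mathbf c)})\subset T_{\Omega(\mathbf c)}\}$. Let $\widetilde G$ be the group of pairs $(g,\psi_g)$ with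 $g\in G$ and $\psi_g:T_\Omega\to\mathbb C$ holomorphic such that $\det(Dg(z)x)=\psi_g(z)^2\det x$ for all $z\in T_\Omega$, $x\in\mathbb C^n$, with the product $(g,\psi_g)(h,\psi_h)=(gh,(\psi_g\circ h)\psi_h)$, and let $\widetilde G(\mathbf c)$ be the inverse image of $G(\mathbf c)$ in $\widetilde G$. For $k\in\mathbb N$ put $\pi_k(g)F(z)=\psi_{g^{-1}}(z)^k\,F(g^{-1}z)$. In the same way let $\widetilde G_1=\widetilde G_2$ be the group of pairs $(g,\psi_g)$, where $g$ lies in the neutral component of the automorphism group of $\mathcal H$ and $\psi_g$ is holomorphic on $\mathcal H$ with $\psi_g^2=g'$, and define $\pi_k(g)$ on functions on $\mathcal H$ by the same formula. An element $(g_1,g_2)\in\widetilde G_1\times\widetilde G_2$ is called a restriction of $g\in\widetilde G(\mathbf c)$ to $T_{\Omega(\mathbf c)}$ if for all $w_1,w_2\in\mathcal H$ $$g(w_1c_1+w_2c_2)=g_1(w_1)c_1+g_2(w_2)c_2,\qquad \psi_g(w_1c_1+w_2c_2)=\psi_{g_1}(w_1)\psi_{g_2}(w_2).$$ Let $E$ be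 a finite-dimensional real module over the Clifford algebra $Cl(n-1)$ generated by $\mathbb R^{n-1}$ with the relations $vw+wv=2\,v\cdot w$. Assume that the corresponding representation $\Phi(s,x)\xi=s\xi+x\xi$ of $J$ is regular, that is, there is $\xi\in E$ such that $\Phi(x)\xi=0$ with $x\in J$ implies $x=0$. Assume that $\dim E=4m$ with $m\in\mathbb N$. Let $p\in\mathbb N$ and $$D=\sum_{j=0}^p a_j^{n,m,p}\Big(\frac{\partial^2}{\partial z_0^2}-\frac{\partial^2}{\partial z_1^2}\Big)^{p-j}\Delta_{n-2}^j,\qquad \Delta_{n-2}=\sum_{k=2}^{n-1}\frac{\partial^2}{\partial z_k^2},$$ $$a_j^{n,m,p}=(-1)^j\binom pj\,\frac{(m+p-1)(m+p)\cdots(m+p-1+(j-1))}{\frac{n-2}2\big(\frac{n-2}2+1\big)\cdots\big(\frac{n-2}2+(j-1)\big)}.$$ Then every $g\in\widetilde G(\mathbf c)$ has a restriction $(g_1,g_2)\in\widetilde G_1\times\widetilde G_2$, and for every such restriction and every holomorphic function $F$ on $T_\Omega$, $$(\operatorname{res}\circ D)\big(\pi_m(g)F\big)=\big(\pi_{m+2p}(g_1)\otimes\pi_{m+2p}(g_2)\big)\,(\operatorname{res}\circ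 D)F .$$ -/

import Mathlib

open Set TopologicalSpace

noncomputable section

/-! ### Biholomorphic automorphisms and the double covering -/

namespace SBDO

variable {V : Type*} [NormedAddCommGroup V] [NormedSpace ℂ V]

/-- Extension by zero of a function given on a domain `T`. -/
def ext {W : Type*} [Zero W] {T : Opens V} (f : T → W) : V → W :=
  Function.extend Subtype.val f 0

/-- Holomorphic functions (with values in a complex normed space) on the domain `T`. -/
def Hol {W : Type*} [NormedAddCommGroup W] [NormedSpace ℂ W] {T : Opens V} (f : T → W) : Prop :=
  DifferentiableOn ℂ (ext f) T

/-- The complex derivative at `z` of a map `T → W`. -/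
def der {W : Type*} [NormedAddCommGroup W] [NormedSpace ℂ W] {T : Opens V} (f : T → W) (z : T) :
    V →L[ℂ] W :=
  fderiv ℂ (ext f) z

/-- A self-map of `T` seen as a `V`-valued map. -/
def val {T : Opens V} (g : T → T) : T → V := fun z => (g z : V)

section basic

variable {W : Type*} [NormedAddCommGroup W] [NormedSpace ℂ W] {T : Opens V}

theorem ext_apply (f : T → W) (z : T) : ext f (z : V) = f z :=
  Subtype.val_injective.extend_apply f 0 z

theorem Hol.hasFDerivAt {f : T → W} (hf : Hol f) (z : T) : HasFDerivAt (ext f) (der f z) (z : V) :=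
  ((hf z z.2).differentiableAt (T.isOpen.mem_nhds z.2)).hasFDerivAt

theorem hasFDerivAt_comp {f : T → W} {g : T → T} (hf : Hol f) (hg : Hol (val g)) (z : T) :
    HasFDerivAt (ext (f ∘ g)) ((der f (g z)).comp (der (val g) z)) (z : V) := by
  have h1 := hg.hasFDerivAt z
  have h2 := hf.hasFDerivAt (g z)
  have e : ext (val g) (z : V) = (g z : V) := ext_apply (val g) z
  rw [← e] at h2
  refine (h2.comp (z : V) h1).congr_of_eventuallyEq ?_
  filter_upwards [T.isOpen.mem_nhds z.2] with x hx
  have e1 := ext_apply (f ∘ g) ⟨x, hx⟩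
  have e2 := ext_apply (val g) ⟨x, hx⟩
  have e3 := ext_apply f (g ⟨x, hx⟩)
  simp only [Function.comp_apply] at e1 ⊢
  rw [e1, e2]
  exact e3.symm

theorem Hol.comp {f : T → W} {g : T → T} (hf : Hol f) (hg : Hol (val g)) : Hol (f ∘ g) :=
  fun z hz => (hasFDerivAt_comp hf hg ⟨z, hz⟩).differentiableAt.differentiableWithinAt

theorem der_comp {f : T → W} {g : T → T} (hf : Hol f) (hg : Hol (val g)) (z : T) :
    der (f ∘ g) z = (der f (g z)).comp (der (val g) z) :=
  (hasFDerivAt_comp hf hg z).fderiv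

theorem hasFDerivAt_id (z : T) :
    HasFDerivAt (ext (val (id : T → T))) (ContinuousLinearMap.id ℂ V) (z : V) := by
  refine (_root_.hasFDerivAt_id (z : V)).congr_of_eventuallyEq ?_
  filter_upwards [T.isOpen.mem_nhds z.2] with x hx
  exact ext_apply (val (id : T → T)) ⟨x, hx⟩

theorem hol_id : Hol (val (id : T → T)) :=
  fun z hz => (hasFDerivAt_id ⟨z, hz⟩).differentiableAt.differentiableWithinAt

theorem der_id (z : T) : der (val (id : T → T)) z = ContinuousLinearMap.id ℂ V :=
  (hasFDerivAt_id z).fderiv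

theorem hol_congr {f : T → ℂ} {F : V → ℂ} (hF : DifferentiableOn ℂ F T)
    (h : ∀ z : T, f z = F z) : Hol f :=
  hF.congr fun z hz => (ext_apply f ⟨z, hz⟩).trans (h ⟨z, hz⟩)

end basic

/-- The group `Aut(T)` of biholomorphic automorphisms of the domain `T`. -/
def Aut (T : Opens V) : Subgroup (T ≃ₜ T) where
  carrier := {g | Hol (val g) ∧ Hol (val g.symm)}
  mul_mem' hg hh := ⟨hg.1.comp hh.1, hh.2.comp hg.2⟩
  one_mem' := ⟨hol_id, hol_id⟩
  inv_mem' hg := ⟨hg.2, hg.1⟩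

/-- `Aut(T)` carries the compact-open topology. -/
instance (T : Opens V) : TopologicalSpace (Aut T) :=
  TopologicalSpace.induced (fun g => (⟨g.1, g.1.continuous⟩ : C(T, T))) inferInstance

/-- The neutral component of `Aut(T)`. -/
def autNeutral (T : Opens V) : Set (Aut T) := connectedComponent 1

/-- The pairs `(g, ψ)` with `g` in `Aut(T)` and `ψ` a holomorphic square root of the cocycle
`z ↦ χ(Dg(z))`. Here `δ` is the determinant of the Jordan algebra and `χ(ℓ)` is the scalar
characterized by `δ (ℓ x) = χ(ℓ) δ x` for all `x`. -/
@[ext]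
structure Cover (T : Opens V) (δ : V → ℂ) where
  /-- The underlying automorphism. -/
  toAut : Aut T
  /-- The chosen square root. -/
  ψ : T → ℂ
  hol : Hol ψ
  sq : ∀ (z : T) (x : V), δ (der (val toAut.1) z x) = ψ z ^ 2 * δ x
  /-- (Automatic in all cases of interest, as `Dg(z)` is invertible and `δ ≠ 0`.) -/
  ne_zero : ∀ z : T, ψ z ≠ 0

namespace Cover

variable {T : Opens V} {δ : V → ℂ}

/-- `(g, ψ_g) (h, ψ_h) = (g h, (ψ_g ∘ h) ψ_h)`. -/
instance : Mul (Cover T δ) where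
  mul a b :=
    { toAut := a.toAut * b.toAut
      ψ := fun z => a.ψ (b.toAut.1 z) * b.ψ z
      hol := by
        have h := (a.hol.comp b.toAut.2.1).mul b.hol
        refine hol_congr h fun z => ?_
        simp only [Pi.mul_apply, ext_apply, Function.comp_apply]
      sq := fun z x => by
        have h := der_comp a.toAut.2.1 b.toAut.2.1 z
        have h' : der (val (a.toAut * b.toAut).1) z
            = (der (val a.toAut.1) (b.toAut.1 z)).comp (der (val b.toAut.1) z) := h
        rw [h', ContinuousLinearMap.comp_apply, a.sq, b.sq]
        ring
      ne_zero := fun z => mul_ne_zero (a.ne_zero _) (b.ne_zero _) }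

instance : One (Cover T δ) where
  one :=
    { toAut := 1
      ψ := fun _ => 1
      hol := hol_congr (differentiableOn_const (1 : ℂ)) fun _ => rfl
      sq := fun z x => by
        have h : der (val (1 : Aut T).1) z = ContinuousLinearMap.id ℂ V := der_id z
        rw [h]
        simp
      ne_zero := fun _ => one_ne_zero }

/-- `(g, ψ_g)⁻¹ = (g⁻¹, 1 / (ψ_g ∘ g⁻¹))`. -/
instance : Inv (Cover T δ) where
  inv a :=
    { toAut := a.toAut⁻¹
      ψ := fun z => (a.ψ (a.toAut.1.symm z))⁻¹
      hol := by
        have h := a.hol.comp a.toAut.2.2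
        refine hol_congr (h.inv fun z hz => ?_) fun z => ?_
        · have := ext_apply (a.ψ ∘ a.toAut.1.symm) ⟨z, hz⟩
          rw [show ext (a.ψ ∘ a.toAut.1.symm) z = _ from this]
          exact a.ne_zero _
        · simp only [Pi.inv_apply, ext_apply, Function.comp_apply]
      sq := fun z x => by
        have h := der_comp a.toAut.2.1 a.toAut.2.2 z
        have e : val a.toAut.1 ∘ a.toAut.1.symm = val (id : T → T) := by
          funext w
          simp [val]
        rw [e, der_id] at h
        have h2 := a.sq (a.toAut.1.symm z) (der (val a.toAut.1.symm) z x)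
        rw [← ContinuousLinearMap.comp_apply, ← h, ContinuousLinearMap.id_apply] at h2
        have h3 := a.ne_zero (a.toAut.1.symm z)
        change δ (der (val a.toAut.1.symm) z x) = _
        rw [h2]
        field_simp
      ne_zero := fun z => inv_ne_zero (a.ne_zero _) }

instance : Group (Cover T δ) :=
  Group.ofLeftAxioms
    (fun a b c => Cover.ext (mul_assoc _ _ _) (funext fun z => mul_assoc _ _ _))
    (fun a => Cover.ext (one_mul _) (funext fun z => one_mul _))
    (fun a => Cover.ext (inv_mul_cancel a.toAut) (funext fun z => by
      change (a.ψ (a.toAut.1.symm (a.toAut.1 z)))⁻¹ * a.ψ z = 1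
      rw [Homeomorph.symm_apply_apply, inv_mul_cancel₀ (a.ne_zero z)]))

end Cover

/-- `(π_m(g) F)(z) = ψ(g⁻¹, z)^m F(g⁻¹ z)`. -/
def rep {T : Opens V} {δ : V → ℂ} (m : ℕ) (g : Cover T δ) (F : T → ℂ) : T → ℂ :=
  fun z => (g⁻¹).ψ z ^ m * F ((g⁻¹).toAut.1 z)

/-- The outer tensor product `π_{m₁}(g₁) ⊗ π_{m₂}(g₂)`, acting on functions on `T₁ × T₂`. -/
def repTensor {V₁ V₂ : Type*} [NormedAddCommGroup V₁] [NormedSpace ℂ V₁] [NormedAddCommGroup V₂]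
    [NormedSpace ℂ V₂] {T₁ : Opens V₁} {T₂ : Opens V₂} {δ₁ : V₁ → ℂ} {δ₂ : V₂ → ℂ} (m₁ m₂ : ℕ)
    (g₁ : Cover T₁ δ₁) (g₂ : Cover T₂ δ₂) (F : T₁ × T₂ → ℂ) : T₁ × T₂ → ℂ :=
  fun w => (g₁⁻¹).ψ w.1 ^ m₁ * (g₂⁻¹).ψ w.2 ^ m₂ *
    F ((g₁⁻¹).toAut.1 w.1, (g₂⁻¹).toAut.1 w.2)

/-! ### The Jordan algebra of rank two and dimension `n = d + 2`

`J = ℝ ⊕ ℝ^(d+1)` with coordinates `(x 0, x 1, …, x (d+1))`. -/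

/-- The underlying space `J = ℝ ⊕ ℝ^(n-1)`. -/
abbrev J (d : ℕ) : Type := Fin (d + 2) → ℝ

/-- The complexification of `J`. -/
abbrev JC (d : ℕ) : Type := Fin (d + 2) → ℂ

/-- The Jordan product `(s, x) (t, y) = (s t + x.y, s y + t x)`. -/
def jmul {d : ℕ} (a b : J d) : J d :=
  Fin.cons (a 0 * b 0 + ∑ j : Fin (d + 1), a j.succ * b j.succ)
    (fun j => a 0 * b j.succ + b 0 * a j.succ)

/-- The determinant of `J`: `det (s, x) = s² - |x|²`. -/
def jdet {d : ℕ} (x : J d) : ℝ := x 0 ^ 2 - ∑ j : Fin (d + 1), x j.succ ^ 2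

/-- The determinant of the complexification. -/
def jdetC {d : ℕ} (z : JC d) : ℂ := z 0 ^ 2 - ∑ j : Fin (d + 1), z j.succ ^ 2

/-- The forward light cone. -/
def cone (d : ℕ) : Set (J d) := {x | 0 < jdet x ∧ 0 < x 0}

/-- The tube `T_Ω = J + i Ω` over the light cone. -/
def tube (d : ℕ) : Opens (JC d) where
  carrier := {z | (fun j => (z j).im) ∈ cone d}
  is_open' := by
    have h1 : Continuous fun z : JC d => jdet (fun j => (z j).im) := by
      unfold jdet
      fun_prop
    have h2 : Continuous fun z : JC d => (z 0).im := by fun_prop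
    exact (isOpen_lt continuous_const h1).inter (isOpen_lt continuous_const h2)

/-- The upper half-plane in `ℂ`. For the one-dimensional Jordan algebras `ℝ c₁` and `ℝ c₂`, the
complexification is identified with `ℂ` through `w ↦ w c_j`; the determinant is then `w ↦ w` and
the tube is the upper half-plane. -/
def H : Opens ℂ where
  carrier := {w | 0 < w.im}
  is_open' := isOpen_lt continuous_const Complex.continuous_im

/-- `w₁ c₁ + w₂ c₂`, where `c₁ = (1/2, 1/2, 0, …, 0)` and `c₂ = (1/2, -1/2, 0, …, 0)`. -/
def emb (d : ℕ) (w₁ w₂ : ℂ) : JC d :=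
  Fin.cons ((w₁ + w₂) / 2) (Fin.cons ((w₁ - w₂) / 2) 0)

theorem emb_mem {d : ℕ} {w₁ w₂ : ℂ} (h₁ : w₁ ∈ H) (h₂ : w₂ ∈ H) : emb d w₁ w₂ ∈ tube d := by
  have h₁' : 0 < w₁.im := h₁
  have h₂' : 0 < w₂.im := h₂
  change 0 < jdet (fun j => (emb d w₁ w₂ j).im) ∧ 0 < (emb d w₁ w₂ 0).im
  have e0 : (emb d w₁ w₂ 0).im = (w₁.im + w₂.im) / 2 := by simp [emb]
  have e1 : (emb d w₁ w₂ (Fin.succ 0)).im = (w₁.im - w₂.im) / 2 := by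
    simp only [emb, Fin.cons_succ, Fin.cons_zero]
    simp
  have e2 : ∀ j : Fin d, (emb d w₁ w₂ j.succ.succ).im = 0 := fun j => by
    simp only [emb, Fin.cons_succ]
    simp
  refine ⟨?_, by rw [e0]; linarith⟩
  unfold jdet
  rw [Fin.sum_univ_succ]
  simp only [e0, e1, e2]
  have := mul_pos h₁' h₂'
  simp
  nlinarith

/-- The inclusion of the product of two half-planes `T_{Ω(c)}` into the tube `T_Ω`. -/
def embT (d : ℕ) (w : H × H) : tube d := ⟨emb d w.1 w.2, emb_mem w.1.2 w.2.2⟩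

/-- Restriction of functions from `T_Ω` to `T_{Ω(c)}`. -/
def res {d : ℕ} (F : tube d → ℂ) : H × H → ℂ := fun w => F (embT d w)

/-- The group `G(c)`: the neutral component of the set of elements `g` of the neutral component
of `Aut(T_Ω)` such that `g(T_{Ω(c)}) ⊆ T_{Ω(c)}`. -/
def Gc (d : ℕ) : Set (Aut (tube d)) :=
  connectedComponentIn
    {g | g ∈ autNeutral (tube d) ∧ MapsTo g.1 (range (embT d)) (range (embT d))} 1

/-- The double covering of `G(c)`. -/
def GcCover (d : ℕ) : Set (Cover (tube d) jdetC) := {g | g.toAut ∈ Gc d}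

/-- The double covering of the neutral component of the automorphism group of `H`. -/
def GH : Set (Cover H (id : ℂ → ℂ)) := {g | g.toAut ∈ autNeutral H}

/-- `(g₁, g₂)` is the restriction of `g` to `T_{Ω(c)}`, at the level of the double coverings:
`g (w₁ c₁ + w₂ c₂) = g₁(w₁) c₁ + g₂(w₂) c₂` and `ψ(g, w₁ c₁ + w₂ c₂) = ψ(g₁, w₁) ψ(g₂, w₂)`. -/
def IsRestriction {d : ℕ} (g : Cover (tube d) jdetC) (g₁ g₂ : Cover H (id : ℂ → ℂ)) : Prop :=
  ∀ w₁ w₂ : H, g.toAut.1 (embT d (w₁, w₂)) = embT d (g₁.toAut.1 w₁, g₂.toAut.1 w₂) ∧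
    g.ψ (embT d (w₁, w₂)) = g₁.ψ w₁ * g₂.ψ w₂

/-! ### The differential operator -/

/-- The complex partial derivative `∂/∂z_j`. -/
def pd {d : ℕ} (j : Fin (d + 2)) (F : JC d → ℂ) : JC d → ℂ :=
  fun z => fderiv ℂ F z (Pi.single j 1)

/-- `∂²/∂z₀² - ∂²/∂z₁²`. -/
def box {d : ℕ} (F : JC d → ℂ) : JC d → ℂ := fun z => pd 0 (pd 0 F) z - pd 1 (pd 1 F) z

/-- `Δ_{n-2} = ∂²/∂z₂² + ⋯ + ∂²/∂z_{n-1}²`. -/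
def lap {d : ℕ} (F : JC d → ℂ) : JC d → ℂ :=
  fun z => ∑ j : Fin d, pd j.succ.succ (pd j.succ.succ F) z

/-- The coefficient `(-1)^j (p choose j) (m+p-1)_j / ((n-2)/2)_j`, where `n = d + 2`. -/
def coeff (d m p j : ℕ) : ℂ :=
  (-1) ^ j * (p.choose j : ℂ) *
    ((∏ i ∈ Finset.range j, ((m : ℂ) + p - 1 + i)) / ∏ i ∈ Finset.range j, ((d : ℂ) / 2 + i))

/-- The operator `D = ∑_{j=0}^p a_j (∂²/∂z₀² - ∂²/∂z₁²)^(p-j) Δ_{n-2}^j` on functions on `T_Ω`. -/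
def D (d m p : ℕ) (F : tube d → ℂ) : tube d → ℂ :=
  fun z => ∑ j ∈ Finset.range (p + 1), coeff d m p j * (box^[p - j] (lap^[j] (ext F))) z

/-! ### Clifford modules -/

/-- The quadratic form `v ↦ v.v` on `ℝ^(n-1)`. In `CliffordAlgebra (quad d)`, which is `Cl(n-1)`,
one has `v w + w v = 2 v.w`. -/
def quad (d : ℕ) : QuadraticForm ℝ (Fin (d + 1) → ℝ) :=
  QuadraticMap.weightedSumSquares ℝ (fun _ => (1 : ℝ))

variable {d : ℕ} {E : Type*} [AddCommGroup E] [Module ℝ E] [Module (CliffordAlgebra (quad d)) E]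
  [IsScalarTower ℝ (CliffordAlgebra (quad d)) E]

/-- The representation `Φ(s, x) ξ = s ξ + x ξ` of `J` on a Clifford module. -/
def Phi (x : J d) : E →ₗ[ℝ] E :=
  x 0 • LinearMap.id +
    Algebra.lsmul ℝ ℝ E (CliffordAlgebra.ι (quad d) (fun j : Fin (d + 1) => x j.succ))

theorem Phi_jmul (x y : J d) :
    (Phi (jmul x y) : E →ₗ[ℝ] E) = (1 / 2 : ℝ) • (Phi x ∘ₗ Phi y + Phi y ∘ₗ Phi x) := by
  set v : Fin (d + 1) → ℝ := fun j => x j.succ with hv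
  set w : Fin (d + 1) → ℝ := fun j => y j.succ with hw
  have h1 : (fun j : Fin (d + 1) => jmul x y j.succ) = x 0 • w + y 0 • v := by
    funext j
    simp [jmul, hv, hw]
  have h0 : jmul x y 0 = x 0 * y 0 + ∑ j, v j * w j := by simp [jmul, hv, hw]
  have hp : QuadraticMap.polar (quad d) v w = 2 * ∑ j, v j * w j := by
    simp only [QuadraticMap.polar, quad, QuadraticMap.weightedSumSquares_apply, Pi.add_apply,
      one_smul]
    rw [← Finset.sum_sub_distrib, ← Finset.sum_sub_distrib, Finset.mul_sum]
    exact Finset.sum_congr rfl fun j _ => by ring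
  have hc := CliffordAlgebra.ι_mul_ι_add_swap (Q := quad d) v w
  rw [hp] at hc
  ext ξ
  have hcξ := congrArg (fun a => a • ξ) hc
  simp only [add_smul, mul_smul, algebraMap_smul] at hcξ
  simp only [Phi, h1, h0, map_add, map_smul, ← hv, ← hw, LinearMap.add_apply,
    LinearMap.smul_apply, LinearMap.id_apply, LinearMap.comp_apply, Algebra.lsmul_coe, smul_add]
  have e : (∑ j, v j * w j) • ξ = (1 / 2 : ℝ) • (CliffordAlgebra.ι (quad d) v •
      CliffordAlgebra.ι (quad d) w • ξ + CliffordAlgebra.ι (quad d) w •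
      CliffordAlgebra.ι (quad d) v • ξ) := by
    rw [hcξ, smul_smul, smul_smul]
    congr 1
    ring
  rw [add_smul, e]
  generalize CliffordAlgebra.ι (quad d) v • CliffordAlgebra.ι (quad d) w • ξ = a
  generalize CliffordAlgebra.ι (quad d) w • CliffordAlgebra.ι (quad d) v • ξ = b
  generalize CliffordAlgebra.ι (quad d) v • ξ = a'
  generalize CliffordAlgebra.ι (quad d) w • ξ = b'
  module

variable (d E) in
/-- The representation of `J` on `E` is regular: there is a regular `ξ`, that is a `ξ` such that
`Φ(x) ξ = 0` only for `x = 0`. -/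
def IsRegular : Prop := ∃ ξ : E, ∀ x : J d, Phi x ξ = 0 → x = 0

end SBDO

end

/-! On `T_Ω(c)` an element of `G(c)` acts as a product of two Möbius maps, and on the whole tube it
is a composite of two elementary conformal maps, one for each factor. The intertwining property is
checked for elementary maps by algebra in a differential ring.

Let u = z₀ + z₁, v = z₀ − z₁ and let x be the normal coordinates. An elementary map is (u, v, x) ↦
((αu + β)/A, v − γ|x|²/A, Mx/A) with A = γu + δ, αδ − βγ = 1 and M complex orthogonal. Write U, V, S
for ∂_u, ∂_v and the normal Laplacian, so that ∂₀² − ∂₁² = 4UV; let φ be the pullback, B = 1/A, and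
let ≡ mean equality on x = 0. Then S does not commute with φ, and `Elem.s_pow_φ` expands S^j φ f
into terms B^k φ(V^i S^(j−i) f). Powers of U do not commute with the weight B^M either; `Elem.bol`
says which combination of the U^(N−i)(B^(M+i) φ f) collapses to B^(M+2N) φ(U^N f). The coefficients
a_j are the ones that match the two expansions: after regrouping by b = j − i, `coeff_add` turns the
sum over i into an instance of `Elem.bol` with N = p − b and M = m + 2b. This is `Elem.op_φ`.

That g is such a composite is a form of Liouville's theorem. With ρ = 1/ψ_g, Koszul's formula shows
that ρ and the functions ρ·g_j have Hessians vanishing on orthogonal pairs with a common nonnull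
orthogonal vector (`Conf.hessZero_ρ`, `Conf.hessZero_ρH`). As n ≥ 4, this forces them to be
combinations of 1, the coordinates and the determinant (`HessZero.exists_eq`). Since g preserves the
plane x = 0, the tangential part is determined by the restriction to the plane
(`Conf.Restricts.explicit`) and the normal part is an orthogonal matrix
(`Conf.Restricts.exists_matrix`). `Conf.Restricts.op_eq` factors the resulting formula and applies
the elementary case twice, with the roles of u and v exchanged the second time.

A restriction exists because Schwarz–Pick, applied to both g and g⁻¹, makes the Jacobian along the
plane monomial (`jac_monomial`). Connectedness of H × H makes the pattern of zeros constant for each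
g, and connectedness of `G(c)`, which contains the identity, excludes the interchange of factors.
Finally ψ_g² is on the plane the product of the derivatives of the two factors, so ψ_g splits as a
product of square roots (`exists_restriction`). -/

noncomputable section

namespace SBDO

open Filter Metric Topology ComplexConjugate

/-! ### Holomorphy and symmetry of derivatives in several variables -/

section Osgood

variable {V : Type*} [NormedAddCommGroup V] [NormedSpace ℂ V]

/-- Uniform quadratic estimate for the difference quotients of a bounded holomorphic function. -/
theorem norm_slope_sub_fderiv_le {f : V → ℂ} {z : V} {R : ℝ}
    (hf : DifferentiableOn ℂ f (ball z R)) (hb : MapsTo f (ball z R) (closedBall (f z) 2))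
    {t : ℂ} (ht : t ≠ 0) {a : V} (hta : ‖t • a‖ < R) :
    ‖t⁻¹ * (f (z + t • a) - f z) - fderiv ℂ f z a‖ ≤ 4 * (‖a‖ / R) ^ 2 * ‖t‖ := by
  have hR : 0 < R := (norm_nonneg _).trans_lt hta
  have hD : ‖fderiv ℂ f z‖ ≤ 2 / R := Complex.norm_fderiv_le_div_of_mapsTo_ball hf hb hR
  have hfz : HasFDerivAt f (fderiv ℂ f z) z :=
    ((hf z (mem_ball_self hR)).differentiableAt (ball_mem_nhds _ hR)).hasFDerivAt
  -- Removing the linear part makes Q − Q(z) vanish to second order at z, so the higher-order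
  -- Schwarz lemma gains the square of ‖t • a‖ / R. The bound 4 is 2 for f plus 2 for the linear
  -- part, by the Cauchy estimate.
  set Q : V → ℂ := fun w => f w - fderiv ℂ f z (w - z) with hQ
  have hQz : Q z = f z := by simp [hQ]
  have hQd : DifferentiableOn ℂ Q (ball z R) := hf.sub (by fun_prop)
  have hQm : MapsTo Q (ball z R) (closedBall (Q z) 4) := by
    intro w hw
    have h1 := hb hw
    rw [mem_closedBall, dist_eq_norm] at h1 ⊢
    rw [mem_ball, dist_eq_norm] at hw
    have h2 : ‖fderiv ℂ f z (w - z)‖ ≤ 2 / R * R :=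
      ((fderiv ℂ f z).le_opNorm _).trans (by gcongr)
    rw [div_mul_cancel₀ _ hR.ne'] at h2
    calc ‖Q w - Q z‖ = ‖(f w - f z) - fderiv ℂ f z (w - z)‖ := by
          rw [hQz]; simp only [hQ]; congr 1; ring
      _ ≤ 2 + 2 := (norm_sub_le _ _).trans (add_le_add h1 h2)
      _ = 4 := by norm_num
  have hQo : (fun w => Q w - Q z) =o[𝓝 z] fun w => ‖w - z‖ ^ 1 := by
    have := hfz.isLittleO
    simp only [pow_one]
    refine (this.congr_left fun w => ?_).norm_right
    simp only [hQ, sub_self, map_zero]; ring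
  have hw : z + t • a ∈ ball z R := by simpa [mem_ball, dist_eq_norm] using hta
  have key := Complex.dist_le_mul_div_pow_of_mapsTo_ball_of_isLittleO hQd hQm hQo hw
  rw [dist_eq_norm, dist_eq_norm] at key
  have e1 : Q (z + t • a) - Q z = t * (t⁻¹ * (f (z + t • a) - f z) - fderiv ℂ f z a) := by
    rw [hQz]; simp only [hQ, add_sub_cancel_left, map_smul, smul_eq_mul]
    field_simp
    ring
  rw [e1, add_sub_cancel_left, norm_mul, norm_smul] at key
  have ht' : 0 < ‖t‖ := norm_pos_iff.2 ht
  refine le_of_mul_le_mul_left (key.trans_eq ?_) ht'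
  ring

/-- A directional derivative of a holomorphic function is holomorphic. -/
theorem _root_.DifferentiableOn.fderiv_apply_of_isOpen {f : V → ℂ} {O : Set V} (hO : IsOpen O)
    (hf : DifferentiableOn ℂ f O) (a : V) :
    DifferentiableOn ℂ (fun z => fderiv ℂ f z a) O := by
  intro z₀ hz₀
  obtain ⟨R', hR', hR'O⟩ := Metric.isOpen_iff.1 hO z₀ hz₀
  obtain ⟨R'', hR'', hbd⟩ := Metric.continuousAt_iff.1
    (hf.continuousOn.continuousAt (hO.mem_nhds hz₀)) 1 one_pos
  set R := min R' R'' / 4 with hRdef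
  have hR : 0 < R := by positivity
  have hR4 : 4 * R ≤ min R' R'' := by rw [hRdef]; linarith
  have hO4 : ball z₀ (4 * R) ⊆ O := (ball_subset_ball (hR4.trans (min_le_left _ _))).trans hR'O
  have hb4 : ∀ w ∈ ball z₀ (4 * R), ‖f w - f z₀‖ ≤ 1 := fun w hw => by
    rw [← dist_eq_norm]
    exact (hbd ((mem_ball.1 hw).trans_le (hR4.trans (min_le_right _ _)))).le
  have hsub : ∀ z ∈ ball z₀ (2 * R), ball z (2 * R) ⊆ ball z₀ (4 * R) := fun z hz w hw => by
    rw [mem_ball] at *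
    linarith [dist_triangle w z z₀]
  set K := 4 * (‖a‖ / (2 * R)) ^ 2 with hK
  -- The shift by N in t n = 1/(n + N) keeps every increment ‖t n • a‖ below 2R.
  obtain ⟨N, hN⟩ := exists_nat_gt (‖a‖ / (2 * R))
  have hN0 : (0 : ℝ) < N := lt_of_le_of_lt (by positivity) hN
  set t : ℕ → ℝ := fun n => 1 / ((n : ℝ) + N) with ht
  have htpos : ∀ n, 0 < t n := fun n => by simp only [ht]; positivity
  have hta : ∀ n, ‖((t n : ℝ) : ℂ) • a‖ < 2 * R := fun n => by
    rw [norm_smul, Complex.norm_real, Real.norm_of_nonneg (htpos n).le]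
    simp only [ht]
    rw [div_lt_iff₀ (by positivity)] at hN
    rw [one_div, inv_mul_lt_iff₀ (by positivity)]
    nlinarith [n.cast_nonneg (α := ℝ)]
  have htlim : Tendsto t atTop (𝓝 0) := by
    simp only [ht]
    exact tendsto_const_nhds.div_atTop
      (tendsto_atTop_add_const_right _ _ tendsto_natCast_atTop_atTop)
  set F : ℕ → V → ℂ := fun n z => ((t n : ℝ) : ℂ)⁻¹ * (f (z + ((t n : ℝ) : ℂ) • a) - f z) with hF
  have hFa : ∀ n, ∀ z ∈ ball z₀ (2 * R), ‖F n z - fderiv ℂ f z a‖ ≤ K * t n := by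
    intro n z hz
    have h1 := norm_slope_sub_fderiv_le (hf.mono ((hsub z hz).trans hO4)) (fun w hw => ?_)
      (t := ((t n : ℝ) : ℂ)) (by exact_mod_cast (htpos n).ne') (hta n)
    · rwa [Complex.norm_real, Real.norm_of_nonneg (htpos n).le] at h1
    · rw [mem_closedBall, dist_eq_norm]
      have h2 := hb4 w (hsub z hz hw)
      have h3 := hb4 z (hsub z hz (mem_ball_self (by positivity)))
      calc ‖f w - f z‖ = ‖(f w - f z₀) - (f z - f z₀)‖ := by congr 1; ring
        _ ≤ 2 := (norm_sub_le _ _).trans (by linarith)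
  have hFd : ∀ n, DifferentiableOn ℂ (F n) (ball z₀ (2 * R)) := by
    intro n z hz
    have h1 : DifferentiableAt ℂ f z :=
      (hf z (hO4 (hsub z hz (mem_ball_self (by positivity))))).differentiableAt
        (hO.mem_nhds (hO4 (hsub z hz (mem_ball_self (by positivity)))))
    have hmem : z + ((t n : ℝ) : ℂ) • a ∈ O := by
      refine hO4 (hsub z hz ?_)
      simpa [mem_ball, dist_eq_norm] using hta n
    have h2 : DifferentiableAt ℂ f (z + ((t n : ℝ) : ℂ) • a) :=
      (hf _ hmem).differentiableAt (hO.mem_nhds hmem)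
    have h3 : DifferentiableAt ℂ (fun z => f (z + ((t n : ℝ) : ℂ) • a)) z :=
      h2.comp z (f := fun z => z + ((t n : ℝ) : ℂ) • a) (by fun_prop)
    exact ((h3.sub h1).const_mul _).differentiableWithinAt
  have hsubR : ∀ x ∈ ball z₀ R, ball x R ⊆ ball z₀ (2 * R) := fun x hx w hw => by
    rw [mem_ball] at *
    linarith [dist_triangle w x z₀]
  -- The Cauchy estimate turns uniform closeness of the difference quotients into uniform closeness
  -- of their derivatives, at the price of halving the radius. The limit of the quotients can then
  -- be differentiated.
  have hderiv : ∀ n m, ∀ x ∈ ball z₀ R,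
      ‖fderiv ℂ (F n) x - fderiv ℂ (F m) x‖ ≤ 2 * (K * t n + K * t m) / R := by
    intro n m x hx
    have hmem : x ∈ ball z₀ (2 * R) := hsubR x hx (mem_ball_self hR)
    have hdn := (hFd n x hmem).differentiableAt (isOpen_ball.mem_nhds hmem)
    have hdm := (hFd m x hmem).differentiableAt (isOpen_ball.mem_nhds hmem)
    rw [← fderiv_sub hdn hdm]
    refine Complex.norm_fderiv_le_div_of_mapsTo_ball
      (((hFd n).sub (hFd m)).mono (hsubR x hx)) (fun w hw => ?_) hR
    have hbnd : ∀ y ∈ ball z₀ (2 * R), ‖F n y - F m y‖ ≤ K * t n + K * t m := fun y hy => by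
      calc ‖F n y - F m y‖ = ‖(F n y - fderiv ℂ f y a) - (F m y - fderiv ℂ f y a)‖ := by
            congr 1; ring
        _ ≤ _ := (norm_sub_le _ _).trans (add_le_add (hFa n y hy) (hFa m y hy))
    rw [mem_closedBall, dist_eq_norm]
    have h1 := hbnd w (hsubR x hx hw)
    have h2 := hbnd x hmem
    exact (norm_sub_le _ _).trans (by simp only [Pi.sub_apply]; linarith)
  have hcau : UniformCauchySeqOn (fun n => fderiv ℂ (F n)) atTop (ball z₀ R) := by
    rw [Metric.uniformCauchySeqOn_iff]
    intro ε hε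
    have hlim : Tendsto (fun n => 4 * (K * t n) / R) atTop (𝓝 0) := by
      have := ((htlim.const_mul K).const_mul 4).div_const R
      simpa using this
    obtain ⟨M, hM⟩ := eventually_atTop.1 (hlim.eventually (gt_mem_nhds hε))
    refine ⟨M, fun m hm n hn x hx => ?_⟩
    rw [dist_eq_norm]
    refine (hderiv m n x hx).trans_lt ?_
    have h1 := hM m hm
    have h2 := hM n hn
    have : 2 * (K * t m + K * t n) / R = (4 * (K * t m) / R + 4 * (K * t n) / R) / 2 := by ring
    linarith
  have hlimex : ∀ x ∈ ball z₀ R, ∃ L, Tendsto (fun n => fderiv ℂ (F n) x) atTop (𝓝 L) :=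
    fun x hx => cauchySeq_tendsto_of_complete (hcau.cauchySeq hx)
  choose! G hG using hlimex
  have hunif := hcau.tendstoUniformlyOn_of_tendsto hG
  have hz₀R : z₀ ∈ ball z₀ R := mem_ball_self hR
  refine (hasFDerivAt_of_tendstoUniformlyOn isOpen_ball hunif (fun n x hx => ?_) (fun x hx => ?_)
    hz₀R (f := F) (g := fun z => fderiv ℂ f z a)).differentiableAt.differentiableWithinAt
  · have hmem : x ∈ ball z₀ (2 * R) := hsubR x hx (mem_ball_self hR)
    exact ((hFd n x hmem).differentiableAt (isOpen_ball.mem_nhds hmem)).hasFDerivAt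
  · have hmem : x ∈ ball z₀ (2 * R) := hsubR x hx (mem_ball_self hR)
    rw [tendsto_iff_norm_sub_tendsto_zero]
    refine squeeze_zero (fun _ => norm_nonneg _) (fun n => hFa n x hmem) ?_
    simpa using htlim.const_mul K

/-- The derivative of a holomorphic function on a finite-dimensional space is holomorphic. -/
theorem _root_.DifferentiableOn.fderiv_of_isOpen [FiniteDimensional ℂ V] {f : V → ℂ} {O : Set V}
    (hO : IsOpen O) (hf : DifferentiableOn ℂ f O) : DifferentiableOn ℂ (fderiv ℂ f) O := by
  classical
  set b := Module.finBasis ℂ V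
  have h : fderiv ℂ f = fun z => ∑ i, fderiv ℂ f z (b i) •
      (LinearMap.toContinuousLinearMap (b.coord i)) := by
    funext z
    ext v
    conv_lhs => rw [← b.sum_repr v, map_sum]
    simp [mul_comm]
  rw [h]
  exact DifferentiableOn.fun_sum fun i _ => (hf.fderiv_apply_of_isOpen hO _).smul_const _

theorem fderiv_fderiv_comm [FiniteDimensional ℂ V] {f : V → ℂ} {O : Set V} (hO : IsOpen O)
    (hf : DifferentiableOn ℂ f O) (a b : V) {z : V} (hz : z ∈ O) :
    fderiv ℂ (fun w => fderiv ℂ f w b) z a = fderiv ℂ (fun w => fderiv ℂ f w a) z b := by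
  have h2 : HasFDerivAt (fderiv ℂ f) (fderiv ℂ (fderiv ℂ f) z) z :=
    ((hf.fderiv_of_isOpen hO z hz).differentiableAt (hO.mem_nhds hz)).hasFDerivAt
  have h1 : ∀ᶠ y in 𝓝 z, HasFDerivAt f (fderiv ℂ f y) y := by
    filter_upwards [hO.mem_nhds hz] with y hy
    exact ((hf y hy).differentiableAt (hO.mem_nhds hy)).hasFDerivAt
  have e : ∀ c : V, fderiv ℂ (fun w => fderiv ℂ f w c) z
      = (ContinuousLinearMap.apply ℂ ℂ c).comp (fderiv ℂ (fderiv ℂ f) z) := fun c =>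
    ((ContinuousLinearMap.apply ℂ ℂ c).hasFDerivAt.comp z h2).fderiv
  rw [e, e]
  exact second_derivative_symmetric_of_eventually h1 h2 a b

end Osgood

/-! ### The differential ring of holomorphic functions on a domain -/

section Ring

variable {V : Type*} [NormedAddCommGroup V] [NormedSpace ℂ V] {T T' : Opens V}

theorem ext_eventuallyEq {f : T → ℂ} {F : V → ℂ} (h : ∀ z : T, f z = F z) (z : T) :
    ext f =ᶠ[𝓝 (z : V)] F := by
  filter_upwards [T.isOpen.mem_nhds z.2] with x hx
  exact (ext_apply f ⟨x, hx⟩).trans (h ⟨x, hx⟩)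

/-- The ring of holomorphic functions on `T`. -/
def holRing (T : Opens V) : Subalgebra ℂ (T → ℂ) where
  carrier := {f | Hol f}
  mul_mem' {f g} hf hg := hol_congr (hf.mul hg) fun z => by simp [ext_apply]
  add_mem' {f g} hf hg := hol_congr (hf.add hg) fun z => by simp [ext_apply]
  algebraMap_mem' c := hol_congr (differentiableOn_const c) fun _ => rfl

instance : CoeFun (holRing T) fun _ => T → ℂ := ⟨Subtype.val⟩

@[ext]
theorem holRing_ext {f g : holRing T} (h : ∀ z, f z = g z) : f = g := Subtype.ext (funext h)

@[simp] theorem holRing_add (f g : holRing T) (z : T) : (f + g) z = f z + g z := rfl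
@[simp] theorem holRing_sub (f g : holRing T) (z : T) : (f - g) z = f z - g z := rfl
@[simp] theorem holRing_neg (f : holRing T) (z : T) : (-f) z = -f z := rfl
@[simp] theorem holRing_mul (f g : holRing T) (z : T) : (f * g) z = f z * g z := rfl
@[simp] theorem holRing_pow (f : holRing T) (n : ℕ) (z : T) : (f ^ n) z = f z ^ n := rfl
@[simp] theorem holRing_smul (c : ℂ) (f : holRing T) (z : T) : (c • f) z = c * f z := rfl
@[simp] theorem holRing_zero (z : T) : (0 : holRing T) z = 0 := rfl
@[simp] theorem holRing_one (z : T) : (1 : holRing T) z = 1 := rfl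
@[simp] theorem holRing_algebraMap (c : ℂ) (z : T) : (algebraMap ℂ (holRing T) c) z = c := rfl

/-- Evaluation at a point. -/
def holEval (z : T) : holRing T →ₐ[ℂ] ℂ := (Pi.evalAlgHom ℂ (fun _ : T => ℂ) z).comp (holRing T).val

@[simp] theorem holEval_apply (z : T) (f : holRing T) : holEval z f = f z := rfl

@[simp] theorem holRing_sum {ι : Type*} (s : Finset ι) (f : ι → holRing T) (z : T) :
    (∑ i ∈ s, f i) z = ∑ i ∈ s, f i z := map_sum (holEval z) f s

/-- The directional derivative `∂_a`, as a derivation. -/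
def dd (a : V) : Derivation ℂ (holRing T) (holRing T) :=
  Derivation.mk'
    { toFun := fun f => ⟨fun z => der f.1 z a,
        hol_congr (DifferentiableOn.fderiv_apply_of_isOpen T.isOpen f.2 a) fun _ => rfl⟩
      map_add' := fun f g => by
        ext z
        have h := ((f.2.hasFDerivAt z).add (g.2.hasFDerivAt z)).congr_of_eventuallyEq
          (ext_eventuallyEq (f := (f + g).1) (fun w => by simp [ext_apply]) z)
        exact congrArg (fun L : V →L[ℂ] ℂ => L a) h.fderiv
      map_smul' := fun c f => by
        ext z
        have h := ((f.2.hasFDerivAt z).const_smul c).congr_of_eventuallyEq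
          (ext_eventuallyEq (f := (c • f).1) (fun w => by simp [ext_apply]) z)
        exact congrArg (fun L : V →L[ℂ] ℂ => L a) h.fderiv }
    fun f g => by
      ext z
      have h := ((f.2.hasFDerivAt z).mul (g.2.hasFDerivAt z)).congr_of_eventuallyEq
        (ext_eventuallyEq (f := (f * g).1) (fun w => by simp [ext_apply]) z)
      rw [ext_apply, ext_apply] at h
      exact congrArg (fun L : V →L[ℂ] ℂ => L a) h.fderiv

theorem dd_apply (a : V) (f : holRing T) (z : T) : dd a f z = der f.1 z a := rfl

theorem dd_apply_eq {a : V} {f : holRing T} {z : T} {F : V → ℂ} {L : V →L[ℂ] ℂ}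
    (h : ∀ z : T, f z = F z) (hF : HasFDerivAt F L (z : V)) : dd a f z = L a :=
  congrArg (fun L : V →L[ℂ] ℂ => L a)
    (hF.congr_of_eventuallyEq (ext_eventuallyEq h z)).fderiv

theorem dd_add (a b : V) : (dd (a + b) : Derivation ℂ (holRing T) (holRing T)) = dd a + dd b := by
  ext f z
  simp [dd_apply]

theorem dd_smul (c : ℂ) (a : V) :
    (dd (c • a) : Derivation ℂ (holRing T) (holRing T)) =
      c • (dd a : Derivation ℂ (holRing T) (holRing T)) := by
  ext f z
  simp [dd_apply]

theorem dd_comm [FiniteDimensional ℂ V] (a b : V) (f : holRing T) :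
    dd a (dd b f) = dd b (dd a f) := by
  ext z
  have e : ∀ c d : V, dd c (dd d f) z = fderiv ℂ (fun w => fderiv ℂ (ext f.1) w d) z c :=
    fun c d => congrArg (fun L : V →L[ℂ] ℂ => L c)
      (ext_eventuallyEq (f := (dd d f).1) (fun _ => rfl) z).fderiv_eq
  rw [e, e]
  exact fderiv_fderiv_comm T.isOpen f.2 a b z.2

/-- The restriction to `T` of a continuous linear function. -/
def holLin (ℓ : V →L[ℂ] ℂ) : holRing T :=
  ⟨fun z => ℓ z, hol_congr ℓ.differentiable.differentiableOn fun _ => rfl⟩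

@[simp] theorem holLin_apply (ℓ : V →L[ℂ] ℂ) (z : T) : holLin ℓ z = ℓ z := rfl

@[simp] theorem dd_holLin (ℓ : V →L[ℂ] ℂ) (a : V) :
    dd a (holLin ℓ : holRing T) = algebraMap ℂ _ (ℓ a) := by
  ext z
  exact dd_apply_eq (fun _ => rfl) ℓ.hasFDerivAt

/-- Functions with vanishing derivatives on a connected domain are constant. -/
theorem holRing_const_of_dd_eq_zero (hT : IsPreconnected (T : Set V)) {f : holRing T}
    (hf : ∀ a, dd a f = 0) (z w : T) : f z = f w := by
  have h := T.isOpen.is_const_of_fderiv_eq_zero (𝕜 := ℂ) hT f.2 (fun x hx => ?_) z.2 w.2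
  · rwa [ext_apply, ext_apply] at h
  · ext a
    exact congrArg (fun f : holRing T => f ⟨x, hx⟩) (hf a)

/-- Pullback of holomorphic functions along a holomorphic map. -/
def holPull (h : T → T') (hh : Hol (fun z => (h z : V))) : holRing T' →ₐ[ℂ] holRing T where
  toFun f := ⟨f.1 ∘ h, fun z hz => by
    have h1 := hh.hasFDerivAt ⟨z, hz⟩
    have h2 := f.2.hasFDerivAt (h ⟨z, hz⟩)
    have e : ext (fun z => (h z : V)) z = h ⟨z, hz⟩ := ext_apply _ (⟨z, hz⟩ : T)
    rw [← e] at h2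
    refine ((h2.comp z h1).congr_of_eventuallyEq ?_).differentiableAt.differentiableWithinAt
    refine ext_eventuallyEq (fun w => ?_) ⟨z, hz⟩
    rw [Function.comp_apply, Function.comp_apply, ext_apply, ext_apply]⟩
  map_one' := rfl
  map_mul' _ _ := rfl
  map_zero' := rfl
  map_add' _ _ := rfl
  commutes' _ := rfl

@[simp] theorem holPull_apply (h : T → T') (hh : Hol (fun z => (h z : V))) (f : holRing T')
    (z : T) : holPull h hh f z = f (h z) := rfl

/-- The chain rule. -/
theorem dd_holPull_apply (h : T → T') (hh : Hol (fun z => (h z : V))) (f : holRing T') (a : V)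
    (z : T) : dd a (holPull h hh f) z = dd (der (fun z => (h z : V)) z a) f (h z) := by
  have h1 := hh.hasFDerivAt z
  have h2 := f.2.hasFDerivAt (h z)
  have e : ext (fun z => (h z : V)) z = h z := ext_apply _ z
  rw [← e] at h2
  refine dd_apply_eq (fun w => ?_) (h2.comp (z : V) h1)
  rw [Function.comp_apply, ext_apply, ext_apply]
  rfl

end Ring

/-! ### Light-cone frames -/

section Frames

/-- A differential ring with commuting derivations `U = ∂_u`, `V = ∂_v`, `X k = ∂_{x_k}`, normal
coordinates `x k`, and an ideal `I` of functions vanishing on the plane `x = 0`. -/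
structure Frame (R : Type*) [CommRing R] [Algebra ℂ R] (d : ℕ) where
  U : Derivation ℂ R R
  V : Derivation ℂ R R
  X : Fin d → Derivation ℂ R R
  x : Fin d → R
  I : Ideal R
  UV : ∀ f, U (V f) = V (U f)
  VX : ∀ k f, V (X k f) = X k (V f)
  XX : ∀ k l f, X k (X l f) = X l (X k f)
  Vx : ∀ k, V (x k) = 0
  Xx : ∀ k l, X k (x l) = if k = l then 1 else 0
  memI : ∀ k, x k ∈ I
  UI : ∀ f ∈ I, U f ∈ I
  VI : ∀ f ∈ I, V f ∈ I

variable {R R' : Type*} [CommRing R] [Algebra ℂ R] [CommRing R'] [Algebra ℂ R'] {d : ℕ}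

namespace Frame

variable (F : Frame R d)

/-- The Laplacian in the normal directions. -/
def S : R →ₗ[ℂ] R := ∑ k, (F.X k : R →ₗ[ℂ] R) ∘ₗ (F.X k : R →ₗ[ℂ] R)

/-- The Euler operator in the normal directions. -/
def E (f : R) : R := ∑ k, F.x k * F.X k f

/-- The squared distance to the plane `x = 0`. -/
def r : R := ∑ k, F.x k ^ 2

/-- `∂_u` as an endomorphism. -/
def u : Module.End ℂ R := (F.U : R →ₗ[ℂ] R)

/-- `∂_v` as an endomorphism. -/
def v : Module.End ℂ R := (F.V : R →ₗ[ℂ] R)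

/-- The normal Laplacian as an endomorphism. -/
def s : Module.End ℂ R := F.S

/-- The operator `D`, with `∂²/∂z₀² - ∂²/∂z₁² = 4 ∂_u ∂_v`. -/
def op (m p : ℕ) : R →ₗ[ℂ] R :=
  ∑ j ∈ Finset.range (p + 1),
    (coeff d m p j * 4 ^ (p - j)) • (F.u ^ (p - j) * F.v ^ (p - j) * F.s ^ j)

theorem S_apply (f : R) : F.S f = ∑ k, F.X k (F.X k f) := by simp [S]

theorem u_apply (f : R) : F.u f = F.U f := rfl
theorem v_apply (f : R) : F.v f = F.V f := rfl
theorem s_apply (f : R) : F.s f = F.S f := rfl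

theorem S_mul {g : R} (hg : ∀ k, F.X k g = 0) (f : R) : F.S (g * f) = g * F.S f := by
  simp [S_apply, hg, Finset.mul_sum]

theorem s_pow_mul {g : R} (hg : ∀ k, F.X k g = 0) (j : ℕ) (f : R) :
    (F.s ^ j) (g * f) = g * (F.s ^ j) f := by
  induction j with
  | zero => simp
  | succ j ih => rw [pow_succ', Module.End.mul_apply, Module.End.mul_apply, ih, s_apply, S_mul _ hg,
      s_apply]

theorem v_pow_mul {g : R} (hg : F.V g = 0) (j : ℕ) (f : R) :
    (F.v ^ j) (g * f) = g * (F.v ^ j) f := by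
  induction j with
  | zero => simp
  | succ j ih =>
    rw [pow_succ', Module.End.mul_apply, Module.End.mul_apply, ih, v_apply, v_apply,
      Derivation.leibniz, hg]
    simp

theorem X_r (k : Fin d) : F.X k F.r = 2 * F.x k := by
  simp only [r, map_sum, Derivation.leibniz_pow, F.Xx]
  simp

/-- Together with `S_E` this is the sl₂ relation between the Laplacian, the squared distance and the
Euler operator. Iterating it gives the commutators of S^j with r and E, in which every E and every
undifferentiated r dies on the plane. -/
theorem S_r_mul (f : R) :
    F.S (F.r * f) = F.r * F.S f + 4 * F.E f + (2 * d : ℂ) • f := by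
  have h : ∀ k, F.X k (F.X k (F.r * f)) =
      F.r * F.X k (F.X k f) + 4 * (F.x k * F.X k f) + (2 : ℂ) • f := by
    intro k
    have h2 : F.X k (2 : R) = 0 := by
      simpa using (F.X k).map_natCast 2
    simp only [Derivation.leibniz, X_r, map_add, smul_eq_mul, F.Xx, h2, if_true]
    rw [ofNat_smul_eq_nsmul]
    ring
  simp only [S_apply, h, Finset.sum_add_distrib, Finset.mul_sum, E, Finset.sum_const,
    Finset.card_univ, Fintype.card_fin]
  rw [← Nat.cast_smul_eq_nsmul ℂ, smul_smul, mul_comm (d : ℂ)]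

theorem S_E (f : R) : F.S (F.E f) = F.E (F.S f) + 2 * F.S f := by
  have h : ∀ k l, F.X k (F.X k (F.x l * F.X l f)) =
      F.x l * F.X l (F.X k (F.X k f)) + if k = l then 2 * F.X k (F.X k f) else 0 := by
    intro k l
    simp only [Derivation.leibniz, map_add, smul_eq_mul, F.Xx]
    rw [F.XX k l f, F.XX k l (F.X k f)]
    split_ifs with hkl
    · subst hkl
      simp
      ring
    · simp
  simp only [E, S_apply, map_sum, h, Finset.sum_add_distrib, Finset.mul_sum]
  congr 1
  simp

/-- `S^j E = E S^j + 2 j S^j`. -/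
theorem s_pow_E (j : ℕ) (f : R) :
    (F.s ^ j) (F.E f) = F.E ((F.s ^ j) f) + (2 * j : ℂ) • (F.s ^ j) f := by
  induction j with
  | zero => simp
  | succ j ih =>
    rw [pow_succ', Module.End.mul_apply, ih, map_add, map_smul, Module.End.mul_apply]
    simp only [s_apply, S_E]
    push_cast
    rw [show (2 : R) * F.S ((F.s ^ j) f) = (2 : ℂ) • F.S ((F.s ^ j) f) by
      rw [ofNat_smul_eq_nsmul]; simp]
    module

/-- `S^j r = r S^j + 4 j E S^(j-1) + 2 j (d + 2 j - 2) S^(j-1)`. -/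
theorem s_pow_r_mul (j : ℕ) (f : R) :
    (F.s ^ (j + 1)) (F.r * f) = F.r * (F.s ^ (j + 1)) f + (4 * (j + 1) : ℂ) • F.E ((F.s ^ j) f)
      + (4 * (j + 1) * (d / 2 + j) : ℂ) • (F.s ^ j) f := by
  induction j with
  | zero =>
    simp only [zero_add, pow_one, s_apply, S_r_mul, pow_zero, Module.End.one_apply]
    rw [show (4 : R) * F.E f = (4 : ℂ) • F.E f by rw [ofNat_smul_eq_nsmul]; simp]
    push_cast
    module
  | succ j ih =>
    rw [pow_succ', Module.End.mul_apply, ih, map_add, map_add, map_smul, map_smul, s_apply, s_apply,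
      S_r_mul, S_E,
      show F.S ((F.s ^ j) f) = (F.s ^ (j + 1)) f by rw [pow_succ', Module.End.mul_apply, s_apply],
      show F.s ((F.s ^ j) f) = (F.s ^ (j + 1)) f by rw [pow_succ', Module.End.mul_apply],
      show F.S ((F.s ^ (j + 1)) f) = (F.s * F.s ^ (j + 1)) f by rw [Module.End.mul_apply, s_apply]]
    rw [show (4 : R) * F.E ((F.s ^ (j + 1)) f) = (4 : ℂ) • F.E ((F.s ^ (j + 1)) f) by
        rw [ofNat_smul_eq_nsmul]; simp,
      show (2 : R) * ((F.s ^ (j + 1)) f) = (2 : ℂ) • ((F.s ^ (j + 1)) f) by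
        rw [ofNat_smul_eq_nsmul]; simp]
    push_cast
    module

theorem E_mem (f : R) : F.E f ∈ F.I :=
  F.I.sum_mem fun k _ => F.I.mul_mem_right _ (F.memI k)

theorem r_mem : F.r ∈ F.I :=
  F.I.sum_mem fun k _ => F.I.pow_mem_of_mem (F.memI k) 2 two_pos

/-- Congruence modulo the functions vanishing on the plane `x = 0`. -/
def Eqv (f g : R) : Prop := f - g ∈ F.I

variable {F}

theorem Eqv.refl (f : R) : F.Eqv f f := by simp [Eqv]

theorem Eqv.of_eq {f g : R} (h : f = g) : F.Eqv f g := h ▸ Eqv.refl f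

theorem Eqv.trans {f g h : R} (h₁ : F.Eqv f g) (h₂ : F.Eqv g h) : F.Eqv f h := by
  have := F.I.add_mem h₁ h₂
  rwa [sub_add_sub_cancel] at this

theorem Eqv.add {f g f' g' : R} (h₁ : F.Eqv f g) (h₂ : F.Eqv f' g') : F.Eqv (f + f') (g + g') := by
  have := F.I.add_mem h₁ h₂
  rwa [sub_add_sub_comm] at this

theorem Eqv.mul_left {f g : R} (a : R) (h : F.Eqv f g) : F.Eqv (a * f) (a * g) := by
  have := F.I.mul_mem_left a h
  rwa [mul_sub] at this

theorem Eqv.smul {f g : R} (a : ℂ) (h : F.Eqv f g) : F.Eqv (a • f) (a • g) := by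
  rw [Algebra.smul_def, Algebra.smul_def]
  exact h.mul_left _

theorem Eqv.sum {ι : Type*} {s : Finset ι} {f g : ι → R} (h : ∀ i ∈ s, F.Eqv (f i) (g i)) :
    F.Eqv (∑ i ∈ s, f i) (∑ i ∈ s, g i) := by
  have := F.I.sum_mem h
  rwa [Finset.sum_sub_distrib] at this

theorem Eqv.u_pow {f g : R} (h : F.Eqv f g) (k : ℕ) : F.Eqv ((F.u ^ k) f) ((F.u ^ k) g) := by
  induction k with
  | zero => simpa
  | succ k ih =>
    have := F.UI _ ih
    rw [map_sub] at this
    rw [pow_succ', Module.End.mul_apply, Module.End.mul_apply]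
    exact this

theorem Eqv.v_pow {f g : R} (h : F.Eqv f g) (k : ℕ) : F.Eqv ((F.v ^ k) f) ((F.v ^ k) g) := by
  induction k with
  | zero => simpa
  | succ k ih =>
    have := F.VI _ ih
    rw [map_sub] at this
    rw [pow_succ', Module.End.mul_apply, Module.End.mul_apply]
    exact this

theorem eqv_s_pow_E (j : ℕ) (f : R) : F.Eqv ((F.s ^ j) (F.E f)) ((2 * j : ℂ) • (F.s ^ j) f) := by
  rw [s_pow_E, Eqv, add_sub_cancel_right]
  exact F.E_mem _

/-- For j = 0 the truncated exponent j − 1 is harmless, as the coefficient contains the factor j. -/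
theorem eqv_s_pow_r_mul (j : ℕ) (f : R) :
    F.Eqv ((F.s ^ j) (F.r * f)) ((4 * j * (d / 2 + j - 1) : ℂ) • (F.s ^ (j - 1)) f) := by
  cases j with
  | zero =>
    simpa [Eqv] using F.I.mul_mem_right f F.r_mem
  | succ j =>
    rw [s_pow_r_mul, Eqv, Nat.add_sub_cancel]
    push_cast
    rw [show ((d : ℂ) / 2 + (j + 1) - 1) = d / 2 + j by ring, add_sub_cancel_right]
    refine F.I.add_mem (F.I.mul_mem_right _ F.r_mem) ?_
    rw [Algebra.smul_def]
    exact F.I.mul_mem_left _ (F.E_mem _)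

theorem s_v_comm : Commute F.s F.v := by
  ext f
  simp only [Module.End.mul_apply, s_apply, v_apply, S_apply, map_sum]
  exact Finset.sum_congr rfl fun k _ => by rw [F.VX, F.VX]

theorem u_v_comm : Commute F.u F.v := by
  ext f
  exact F.UV f

end Frame
end Frames

/-! ### Intertwining for elementary conformal maps -/

section Intertwining

/-- The Pochhammer symbol `c (c + 1) ⋯ (c + i - 1)`. -/
def poch (c : ℂ) (i : ℕ) : ℂ := ∏ t ∈ Finset.range i, (c + t)

@[simp] theorem poch_zero (c : ℂ) : poch c 0 = 1 := by simp [poch]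

theorem poch_succ (c : ℂ) (i : ℕ) : poch c (i + 1) = poch c i * (c + i) :=
  Finset.prod_range_succ _ _

theorem poch_succ' (c : ℂ) (i : ℕ) : poch c (i + 1) = c * poch (c + 1) i := by
  rw [poch, Finset.prod_range_succ', mul_comm]
  simp only [Nat.cast_zero, add_zero, poch]
  congr 1
  exact Finset.prod_congr rfl fun t _ => by push_cast; ring

theorem poch_add (c : ℂ) (b i : ℕ) : poch c (b + i) = poch c b * poch (c + b) i := by
  rw [poch, Finset.prod_range_add]
  simp only [poch, Nat.cast_add, add_assoc]

theorem poch_ne_zero {c : ℝ} (hc : 0 < c) (i : ℕ) : poch (c : ℂ) i ≠ 0 := by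
  refine Finset.prod_ne_zero_iff.2 fun t _ => ?_
  have : (0 : ℝ) < c + t := by positivity
  exact_mod_cast this.ne'

theorem choose_succ_mul (j i : ℕ) (h : i ≤ j) :
    (j.choose (i + 1) : ℂ) * (i + 1) = j.choose i * (j - i) := by
  have := Nat.choose_succ_right_eq j i
  rw [← Nat.cast_sub h]
  exact_mod_cast this

theorem coeff_eq (d m p j : ℕ) :
    coeff d m p j = (-1) ^ j * (p.choose j : ℂ) * (poch (m + p - 1) j / poch (d / 2) j) := rfl

/-- This identity is the reason for the shape of a_j. The left factor collects what `Elem.s_pow_φ`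
produces at j = b + i, the right one is what `Elem.bol` requires for N = p − b and M = m + 2b, where
M + N − 1 = m + p − 1 + b. It holds since binomials and Pochhammer symbols split multiplicatively; d
> 0 keeps the denominators nonzero. -/
theorem coeff_add {d : ℕ} (hd : 0 < d) (m p b i : ℕ) :
    coeff d m p (b + i) * ((b + i).choose b : ℂ) * poch (d / 2 + b) i * (-1) ^ i =
      coeff d m p b * ((p - b).choose i * poch (m + p - 1 + b) i) := by
  have hh : ((d : ℂ) / 2) = ((d / 2 : ℝ) : ℂ) := by push_cast; rfl
  have h1 : poch (d / 2) b ≠ 0 := by rw [hh]; exact poch_ne_zero (by positivity) _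
  have h2 : poch (d / 2 + b) i ≠ 0 := by
    rw [hh, show ((d / 2 : ℝ) : ℂ) + b = ((d / 2 + b : ℝ) : ℂ) by push_cast; rfl]
    exact poch_ne_zero (by positivity) _
  have h3 : (p.choose (b + i) : ℂ) * (b + i).choose b = p.choose b * (p - b).choose i := by
    have := Nat.choose_mul (n := p) (k := b + i) (s := b) (Nat.le_add_right b i)
    rw [Nat.add_sub_cancel_left] at this
    exact_mod_cast this
  rw [coeff_eq, coeff_eq, poch_add, poch_add, pow_add]
  have h4 : ((-1 : ℂ) ^ i) * (-1) ^ i = 1 := by rw [← mul_pow]; simp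
  calc _ = (-1) ^ b * ((p.choose (b + i) : ℂ) * (b + i).choose b) * (((-1 : ℂ) ^ i) * (-1) ^ i) *
        (poch (m + p - 1) b * poch (m + p - 1 + b) i / poch (d / 2) b) *
          (poch (d / 2 + b) i / poch (d / 2 + b) i) := by ring
    _ = _ := by rw [h3, h4, div_self h2]; ring

variable {R R' : Type*} [CommRing R] [Algebra ℂ R] [CommRing R'] [Algebra ℂ R'] {d : ℕ}

/-- An elementary conformal map in terms of light-cone frames: in coordinates it is
`(u, v, x) ↦ ((α u + β) / A, v - γ |x|² / A, x / A)` with `A = γ u + δ` and `B = 1 / A`. -/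
structure Elem (F : Frame R d) (F' : Frame R' d) where
  φ : R' →ₐ[ℂ] R
  B : R
  γ : ℂ
  UB : F.U B = -γ • B ^ 2
  VB : F.V B = 0
  XB : ∀ k, F.X k B = 0
  φI : ∀ f ∈ F'.I, φ f ∈ F.I
  Uφ : ∀ f, F.Eqv (F.U (φ f)) (B ^ 2 * φ (F'.U f))
  Vφ : ∀ f, F.V (φ f) = φ (F'.V f)
  Sφ : ∀ f, F.S (φ f) = B ^ 2 * φ (F'.S f) + (-4 * γ) • (B * φ (F'.E (F'.V f))) +
    (-2 * d * γ) • (B * φ (F'.V f)) + (4 * γ ^ 2) • φ (F'.r * F'.V (F'.V f))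

namespace Elem

variable {F : Frame R d} {F' : Frame R' d} (e : Elem F F')

theorem U_pow (M : ℕ) : F.U (e.B ^ M) = (-(M * e.γ)) • e.B ^ (M + 1) := by
  rw [Derivation.leibniz_pow, e.UB]
  cases M with
  | zero => simp
  | succ M =>
    rw [Nat.add_sub_cancel, smul_eq_mul, mul_smul_comm, ← Nat.cast_smul_eq_nsmul ℂ, smul_smul]
    congr 1
    · push_cast; ring
    · ring

theorem φ_eqv {f g : R'} (h : F'.Eqv f g) : F.Eqv (e.φ f) (e.φ g) := by
  have := e.φI _ h
  rwa [map_sub] at this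

/-- A generalization of Bol's lemma. -/
theorem bol (N : ℕ) : ∀ (M : ℕ) (f : R'),
    F.Eqv (∑ i ∈ Finset.range (N + 1), (N.choose i * poch (M + N - 1) i * e.γ ^ i) •
      (F.u ^ (N - i)) (e.B ^ (M + i) * e.φ f)) (e.B ^ (M + 2 * N) * e.φ ((F'.u ^ N) f)) := by
  induction N with
  | zero => intro M f; simp [Frame.Eqv]
  | succ N ih =>
    intro M f
    -- The basic relation is U(B^M φ f) + Mγ B^(M+1) φ f ≡ B^(M+2) φ(U f), so one derivative raises
    -- the weight by 2 and the induction runs over all weights. Formally, M = 1 − N leaves only the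
    -- term i = 0, which is the classical lemma.
    have h0 := ih (M + 2) (F'.u f)
    rw [show M + 2 + 2 * N = M + 2 * (N + 1) by ring,
      show (F'.u ^ N) (F'.u f) = (F'.u ^ (N + 1)) f by rw [pow_succ, Module.End.mul_apply]] at h0
    refine Frame.Eqv.trans ?_ h0
    set τ : ℕ → R := fun i => e.γ ^ i • (F.u ^ (N + 1 - i)) (e.B ^ (M + i) * e.φ f) with hτ
    have hterm : ∀ i ∈ Finset.range (N + 1),
        F.Eqv ((N.choose i * poch (M + N + 1) i) • τ i +
          (N.choose i * poch (M + N + 1) i * (M + i)) • τ (i + 1))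
        ((N.choose i * poch ((M + 2 : ℕ) + N - 1) i * e.γ ^ i) •
          (F.u ^ (N - i)) (e.B ^ (M + 2 + i) * e.φ (F'.u f))) := by
      intro i hi
      have hi' : i ≤ N := Nat.lt_succ_iff.1 (Finset.mem_range.1 hi)
      have h1 : F.Eqv (F.u (e.B ^ (M + i) * e.φ f) +
          ((M + i) * e.γ) • (e.B ^ (M + (i + 1)) * e.φ f))
          (e.B ^ (M + 2 + i) * e.φ (F'.u f)) := by
        rw [Frame.u_apply, Derivation.leibniz, e.U_pow]
        have h2 := (e.Uφ f).mul_left (e.B ^ (M + i))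
        rw [← mul_assoc, ← pow_add, show M + i + 2 = M + 2 + i by ring] at h2
        refine Frame.Eqv.trans (Frame.Eqv.of_eq ?_) h2
        rw [smul_eq_mul, smul_eq_mul, mul_smul_comm, mul_comm (e.φ f), add_assoc, ← add_assoc M]
        push_cast
        module
      have h3 := (h1.u_pow (N - i)).smul (N.choose i * poch ((M + 2 : ℕ) + N - 1) i * e.γ ^ i)
      refine Frame.Eqv.trans (Frame.Eqv.of_eq ?_) h3
      have h4 : N + 1 - i = (N - i) + 1 := by omega
      have h5 : N + 1 - (i + 1) = N - i := by omega
      simp only [hτ, h4, h5, map_add, map_smul]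
      rw [pow_succ F.u (N - i), Module.End.mul_apply,
        show ((M + 2 : ℕ) : ℂ) + N - 1 = M + N + 1 by push_cast; ring, pow_succ e.γ i]
      module
    refine Frame.Eqv.trans (Frame.Eqv.of_eq ?_) (Frame.Eqv.sum hterm)
    have hL : ∀ i, (((N + 1).choose i : ℂ) * poch (M + (N + 1 : ℕ) - 1) i * e.γ ^ i) •
        (F.u ^ (N + 1 - i)) (e.B ^ (M + i) * e.φ f) =
        ((N + 1).choose i * poch (M + N) i : ℂ) • τ i := by
      intro i
      simp only [hτ, smul_smul]
      congr 2
      push_cast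
      congr 2
      ring
    simp only [hL]
    rw [Finset.sum_add_distrib]
    have hsum : ∑ i ∈ Finset.range (N + 1), ((N.choose i : ℂ) * poch (M + N + 1) i) • τ i =
        ∑ i ∈ Finset.range (N + 1 + 1), ((N.choose i : ℂ) * poch (M + N + 1) i) • τ i := by
      rw [Finset.sum_range_succ _ (N + 1), Nat.choose_succ_self]
      simp
    rw [hsum, Finset.sum_range_succ', Finset.sum_range_succ' _ (N + 1), add_right_comm,
      ← Finset.sum_add_distrib]
    congr 1
    -- The coefficient of τ (i + 1) receives one contribution from each of two consecutive terms;
    -- Pascal's rule and the two recursions of the Pochhammer symbol add them up.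
    · refine Finset.sum_congr rfl fun i hi => ?_
      have hi' : i ≤ N := Nat.lt_succ_iff.1 (Finset.mem_range.1 hi)
      rw [← add_smul]
      congr 1
      have h6 := choose_succ_mul N i hi'
      rw [poch_succ', poch_succ, Nat.choose_succ_succ]
      push_cast
      linear_combination (-poch (M + N + 1) i) * h6
    · simp

/-- Induction on j, writing S^(j+1) φ f = S^j (S φ f). The formula for S φ has four terms; in those
containing E V f and r V² f the operators E and r are absorbed on the plane by `eqv_s_pow_E` and
`eqv_s_pow_r_mul`, leaving only V^i S^(j−i). -/
theorem s_pow_φ (j : ℕ) : ∀ f : R',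
    F.Eqv ((F.s ^ j) (e.φ f)) (∑ i ∈ Finset.range (j + 1),
      (j.choose i * poch (d / 2 + j - i) i * (-4 * e.γ) ^ i) •
        (e.B ^ (2 * (j - i) + i) * e.φ ((F'.v ^ i) ((F'.s ^ (j - i)) f)))) := by
  induction j with
  | zero => intro f; simp [Frame.Eqv]
  | succ j ih =>
    intro f
    set τ : ℕ → R := fun i => (-4 * e.γ) ^ i •
      (e.B ^ (2 * (j + 1 - i) + i) * e.φ ((F'.v ^ i) ((F'.s ^ (j + 1 - i)) f))) with hτ
    have h0 : (F.s ^ (j + 1)) (e.φ f) =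
        e.B ^ 2 * (F.s ^ j) (e.φ (F'.S f)) +
        (-4 * e.γ) • (e.B * (F.s ^ j) (e.φ (F'.E (F'.V f)))) +
        (-2 * d * e.γ) • (e.B * (F.s ^ j) (e.φ (F'.V f))) +
        (4 * e.γ ^ 2) • (F.s ^ j) (e.φ (F'.r * F'.V (F'.V f))) := by
      have hX2 : ∀ k, F.X k (e.B ^ 2) = 0 := fun k => by
        rw [Derivation.leibniz_pow, e.XB]; simp
      rw [pow_succ, Module.End.mul_apply, Frame.s_apply, e.Sφ]
      simp only [map_add, map_smul, F.s_pow_mul hX2, F.s_pow_mul e.XB]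
    have hterm : ∀ g : R', ∀ b : R, ∀ T : ℕ → R,
        (∀ i ∈ Finset.range (j + 1), F.Eqv (b * (e.B ^ (2 * (j - i) + i) *
            e.φ ((F'.v ^ i) ((F'.s ^ (j - i)) g)))) (T i)) →
        F.Eqv (b * (F.s ^ j) (e.φ g)) (∑ i ∈ Finset.range (j + 1),
          (j.choose i * poch (d / 2 + j - i) i * (-4 * e.γ) ^ i) • T i) := by
      intro g b T hT
      refine ((ih g).mul_left b).trans ?_
      rw [Finset.mul_sum]
      refine Frame.Eqv.sum fun i hi => ?_
      rw [mul_smul_comm]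
      exact (hT i hi).smul _
    have hvs : ∀ i b (g : R'), (F'.v ^ i) ((F'.s ^ b) (F'.V g)) =
        (F'.v ^ (i + 1)) ((F'.s ^ b) g) := by
      intro i b g
      have h2 := (Frame.s_v_comm (F := F')).pow_left b
      have h3 := congrArg (fun A : Module.End ℂ R' => A g) h2.eq
      simp only [Module.End.mul_apply, Frame.v_apply F' g] at h3
      rw [h3, pow_succ, Module.End.mul_apply]
    have hss : ∀ b (g : R'), (F'.s ^ b) (F'.S g) = (F'.s ^ (b + 1)) g := by
      intro b g
      rw [pow_succ, Module.End.mul_apply, Frame.s_apply]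
    have e1 := hterm (F'.S f) (e.B ^ 2) (fun i => e.B ^ (2 * (j + 1 - i) + i) *
      e.φ ((F'.v ^ i) ((F'.s ^ (j + 1 - i)) f))) fun i hi => by
        have hi' : i ≤ j := Nat.lt_succ_iff.1 (Finset.mem_range.1 hi)
        refine Frame.Eqv.of_eq ?_
        rw [hss, show j + 1 - i = j - i + 1 by omega, ← mul_assoc, ← pow_add]
        congr 2
        ring
    have e2 := hterm (F'.E (F'.V f)) e.B (fun i => (2 * (j - i) : ℂ) •
      (e.B ^ (2 * (j - i) + (i + 1)) * e.φ ((F'.v ^ (i + 1)) ((F'.s ^ (j - i)) f)))) fun i hi => by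
        have hi' : i ≤ j := Nat.lt_succ_iff.1 (Finset.mem_range.1 hi)
        have h1 := e.φ_eqv ((Frame.eqv_s_pow_E (j - i) (F'.V f)).v_pow i)
        refine ((h1.mul_left _).mul_left _).trans (Frame.Eqv.of_eq ?_)
        rw [map_smul, map_smul, hvs, Nat.cast_sub hi', mul_smul_comm, mul_smul_comm]
        congr 1
        ring
    have e3 := hterm (F'.V f) e.B (fun i =>
      (e.B ^ (2 * (j - i) + (i + 1)) * e.φ ((F'.v ^ (i + 1)) ((F'.s ^ (j - i)) f)))) fun i hi => by
        refine Frame.Eqv.of_eq ?_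
        rw [hvs]
        ring
    have e4 := hterm (F'.r * F'.V (F'.V f)) 1 (fun i => (4 * (j - i) * (d / 2 + j - i - 1) : ℂ) •
      (e.B ^ (2 * (j - i) + i) * e.φ ((F'.v ^ (i + 2)) ((F'.s ^ (j - i - 1)) f)))) fun i hi => by
        have hi' : i ≤ j := Nat.lt_succ_iff.1 (Finset.mem_range.1 hi)
        have h1 := e.φ_eqv ((Frame.eqv_s_pow_r_mul (j - i) (F'.V (F'.V f))).v_pow i)
        refine ((h1.mul_left _).mul_left _).trans (Frame.Eqv.of_eq ?_)
        rw [map_smul, map_smul, hvs, hvs, Nat.cast_sub hi', mul_smul_comm, mul_smul_comm, one_mul]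
        congr 1
        ring
    rw [one_mul] at e4
    rw [h0]
    refine ((((e1.add (e2.smul _)).add (e3.smul _)).add (e4.smul _))).trans (Frame.Eqv.of_eq ?_)
    have hL : ∀ i, (((j + 1).choose i : ℂ) * poch (d / 2 + (j + 1 : ℕ) - i) i * (-4 * e.γ) ^ i) •
        (e.B ^ (2 * (j + 1 - i) + i) * e.φ ((F'.v ^ i) ((F'.s ^ (j + 1 - i)) f))) =
        ((j + 1).choose i * poch (d / 2 + (j + 1 : ℕ) - i) i : ℂ) • τ i := fun i => by
      simp only [hτ, smul_smul]
    simp only [hL]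
    set c : ℕ → ℂ := fun i => j.choose i * poch (d / 2 + j - i) i with hc
    have hrw : ∀ i ∈ Finset.range (j + 1),
        (c i * (-4 * e.γ) ^ i) • (e.B ^ (2 * (j + 1 - i) + i) *
            e.φ ((F'.v ^ i) ((F'.s ^ (j + 1 - i)) f))) +
          (-4 * e.γ) • (c i * (-4 * e.γ) ^ i) • (2 * (j - i) : ℂ) •
            (e.B ^ (2 * (j - i) + (i + 1)) * e.φ ((F'.v ^ (i + 1)) ((F'.s ^ (j - i)) f))) +
          (-2 * d * e.γ) • (c i * (-4 * e.γ) ^ i) •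
            (e.B ^ (2 * (j - i) + (i + 1)) * e.φ ((F'.v ^ (i + 1)) ((F'.s ^ (j - i)) f))) +
          (4 * e.γ ^ 2) • (c i * (-4 * e.γ) ^ i) • (4 * (j - i) * (d / 2 + j - i - 1) : ℂ) •
            (e.B ^ (2 * (j - i) + i) * e.φ ((F'.v ^ (i + 2)) ((F'.s ^ (j - i - 1)) f))) =
        c i • τ i + (c i * (2 * (j - i) + d / 2)) • τ (i + 1) +
          (c i * ((j - i) * (d / 2 + j - i - 1))) • τ (i + 2) := by
      intro i hi
      have hi' : i ≤ j := Nat.lt_succ_iff.1 (Finset.mem_range.1 hi)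
      have h1 : j + 1 - (i + 1) = j - i := by omega
      have h2 : j + 1 - (i + 2) = j - i - 1 := by omega
      -- At i = j the terms with the factor j − i vanish, so the truncated exponent j − i − 1 plays
      -- no role there.
      rcases hi'.eq_or_lt with rfl | hlt
      · simp only [hτ, h1, h2, sub_self, mul_zero, zero_mul, zero_smul, smul_zero, add_zero,
          pow_succ (-4 * e.γ) i]
        module
      · have h3 : 2 * (j - i - 1) + (i + 2) = 2 * (j - i) + i := by omega
        simp only [hτ, h1, h2, h3, pow_succ (-4 * e.γ)]
        module
    rw [Finset.smul_sum, Finset.smul_sum, Finset.smul_sum, ← Finset.sum_add_distrib,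
      ← Finset.sum_add_distrib, ← Finset.sum_add_distrib, Finset.sum_congr rfl hrw,
      Finset.sum_add_distrib, Finset.sum_add_distrib]
    have hs1 : ∑ i ∈ Finset.range (j + 1), c i • τ i = ∑ i ∈ Finset.range (j + 2), c i • τ i := by
      rw [Finset.sum_range_succ _ (j + 1)]
      simp [hc, Nat.choose_succ_self]
    rw [hs1, Finset.sum_range_succ' _ (j + 1), Finset.sum_range_succ' _ j,
      Finset.sum_range_succ' _ j, Finset.sum_range_succ _ j,
      Finset.sum_range_succ' _ (j + 1), Finset.sum_range_succ' _ j]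
    simp only [sub_self, zero_mul, mul_zero, zero_smul, add_zero]
    -- The index i + 2 collects three contributions: directly from S, from E V together with V, and
    -- from r V². The lowest two indices, where fewer contributions occur, are treated separately.
    have hmain : ∀ i ∈ Finset.range j,
        (((j + 1).choose (i + 1 + 1) : ℂ) *
          poch (d / 2 + (j + 1 : ℕ) - (i + 1 + 1 : ℕ)) (i + 1 + 1)) • τ (i + 1 + 1) =
        c (i + 1 + 1) • τ (i + 1 + 1) +
        (c (i + 1) * (2 * (j - (i + 1 : ℕ)) + d / 2)) • τ (i + 1 + 1) +
        (c i * ((j - i) * (d / 2 + j - i - 1))) • τ (i + 2) := by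
      intro i hi
      have hi' : i < j := Finset.mem_range.1 hi
      rw [show i + 2 = i + 1 + 1 from rfl, ← add_smul, ← add_smul]
      congr 1
      simp only [hc]
      have h1 := choose_succ_mul j i hi'.le
      have h2 := choose_succ_mul j (i + 1) hi'
      have p1 := poch_succ (d / 2 + j - i - 1) (i + 1)
      have p2 := poch_succ' (d / 2 + j - i - 1) i
      have p3 := poch_succ' (d / 2 + j - i - 2) (i + 1)
      rw [show (d : ℂ) / 2 + j - i - 1 + 1 = d / 2 + j - i by ring] at p2
      rw [show (d : ℂ) / 2 + j - i - 2 + 1 = d / 2 + j - i - 1 by ring] at p3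
      rw [Nat.choose_succ_succ]
      push_cast at *
      rw [show (d : ℂ) / 2 + (j + 1) - (i + 1 + 1) = d / 2 + j - i - 1 by ring,
        show (d : ℂ) / 2 + j - (i + 1 + 1) = d / 2 + j - i - 2 by ring,
        show (d : ℂ) / 2 + j - (i + 1) = d / 2 + j - i - 1 by ring, p1, p3, p2]
      linear_combination (d / 2 + j - i - 1 : ℂ) * poch (d / 2 + j - i) i * (h2 + h1)
    rw [Finset.sum_congr rfl hmain, Finset.sum_add_distrib, Finset.sum_add_distrib]
    have h01 : c (0 + 1) + c 0 * (2 * (j - (0 : ℕ)) + d / 2) =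
        ((j + 1).choose (0 + 1) : ℂ) * poch (d / 2 + (j + 1 : ℕ) - (0 + 1 : ℕ)) (0 + 1) := by
      simp only [hc, poch_succ]
      simp
      ring
    rw [← h01, add_smul]
    have h00 : c 0 = ((j + 1).choose 0 : ℂ) * poch (d / 2 + (j + 1 : ℕ) - (0 : ℕ)) 0 := by
      simp [hc]
    rw [← h00]
    abel

/-- Since V commutes with φ and kills B, only S and U interact with the weight. Inserting the
expansion of S^j and exchanging the sums groups the terms by the surviving power b of S, and each
group collapses by `bol`. -/
theorem op_φ (hd : 0 < d) (m p : ℕ) (f : R') :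
    F.Eqv (F.op m p (e.B ^ m * e.φ f)) (e.B ^ (m + 2 * p) * e.φ (F'.op m p f)) := by
  have hXm : ∀ k, F.X k (e.B ^ m) = 0 := fun k => by rw [Derivation.leibniz_pow, e.XB]; simp
  have hVn : ∀ n, F.V (e.B ^ n) = 0 := fun n => by rw [Derivation.leibniz_pow, e.VB]; simp
  have hvφ : ∀ k (g : R'), (F.v ^ k) (e.φ g) = e.φ ((F'.v ^ k) g) := by
    intro k g
    induction k with
    | zero => simp
    | succ k ih =>
      rw [pow_succ', Module.End.mul_apply, ih, F.v_apply, e.Vφ, pow_succ', Module.End.mul_apply,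
        F'.v_apply]
  -- With b the power of S left on f and i = j − b, all of V^(p−j) V^i = V^(p−b) passes through φ,
  -- and the weight becomes m + 2b + i.
  set G : ℕ → ℕ → R := fun b i =>
    (F.u ^ (p - b - i)) (e.B ^ (m + 2 * b + i) * e.φ ((F'.v ^ (p - b)) ((F'.s ^ b) f))) with hG
  have hj : ∀ j ∈ Finset.range (p + 1),
      F.Eqv ((coeff d m p j * 4 ^ (p - j)) • (F.u ^ (p - j) * F.v ^ (p - j) * F.s ^ j)
          (e.B ^ m * e.φ f))
        (∑ b ∈ Finset.range (j + 1), (coeff d m p j * 4 ^ (p - j) * (j.choose b *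
          poch (d / 2 + b) (j - b) * (-4 * e.γ) ^ (j - b))) • G b (j - b)) := by
    intro j hj
    have hj' : j ≤ p := Nat.lt_succ_iff.1 (Finset.mem_range.1 hj)
    have h1 := ((((e.s_pow_φ j f).mul_left (e.B ^ m)).v_pow (p - j)).u_pow (p - j)).smul
      (coeff d m p j * 4 ^ (p - j))
    rw [← F.s_pow_mul hXm] at h1
    refine h1.trans (Frame.Eqv.of_eq ?_)
    rw [← Finset.sum_range_reflect, Finset.mul_sum, map_sum, map_sum, Finset.smul_sum]
    refine Finset.sum_congr rfl fun b hb => ?_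
    have hb' : b ≤ j := Nat.lt_succ_iff.1 (Finset.mem_range.1 hb)
    rw [show j + 1 - 1 - b = j - b by omega, show j - (j - b) = b by omega, Nat.choose_symm hb',
      Nat.cast_sub hb', mul_smul_comm, map_smul, map_smul, smul_smul,
      show (d : ℂ) / 2 + j - (j - b) = d / 2 + b by ring]
    congr 1
    simp only [hG]
    rw [← mul_assoc, ← pow_add, F.v_pow_mul (hVn _), hvφ, ← Module.End.mul_apply, ← pow_add,
      show p - b - (j - b) = p - j by omega, show p - j + (j - b) = p - b by omega, add_assoc]
  have hb : ∀ b ∈ Finset.range (p + 1),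
      F.Eqv (∑ i ∈ Finset.range (p - b + 1), (coeff d m p (b + i) * 4 ^ (p - (b + i)) *
          ((b + i).choose b * poch (d / 2 + b) i * (-4 * e.γ) ^ i)) • G b i)
        ((coeff d m p b * 4 ^ (p - b)) •
          (e.B ^ (m + 2 * p) * e.φ ((F'.u ^ (p - b)) ((F'.v ^ (p - b)) ((F'.s ^ b) f))))) := by
    intro b hb
    have hb' : b ≤ p := Nat.lt_succ_iff.1 (Finset.mem_range.1 hb)
    have h1 := (e.bol (p - b) (m + 2 * b) ((F'.v ^ (p - b)) ((F'.s ^ b) f))).smul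
      (coeff d m p b * 4 ^ (p - b))
    rw [show m + 2 * b + 2 * (p - b) = m + 2 * p by omega] at h1
    refine (Frame.Eqv.of_eq ?_).trans h1
    rw [Finset.smul_sum]
    refine Finset.sum_congr rfl fun i hi => ?_
    have hi' : i ≤ p - b := Nat.lt_succ_iff.1 (Finset.mem_range.1 hi)
    have h2 := coeff_add hd m p b i
    have h3 : (4 : ℂ) ^ (p - b) = 4 ^ (p - (b + i)) * 4 ^ i := by
      rw [← pow_add]; congr 1; omega
    rw [smul_smul]
    congr 1
    rw [h3, show ((m + 2 * b : ℕ) : ℂ) + (p - b : ℕ) - 1 = m + p - 1 + b by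
      rw [Nat.cast_sub hb']; push_cast; ring, show -4 * e.γ = (-1) * (4 * e.γ) by ring, mul_pow,
      mul_pow]
    linear_combination (4 ^ (p - (b + i)) * 4 ^ i * e.γ ^ i) * h2
  rw [Frame.op, Frame.op, LinearMap.sum_apply, LinearMap.sum_apply]
  simp only [LinearMap.smul_apply]
  refine (Frame.Eqv.sum hj).trans ?_
  rw [Finset.sum_comm' (t' := Finset.range (p + 1)) (s' := fun b => Finset.Ico b (p + 1))
    (fun j b => by simp only [Finset.mem_range, Finset.mem_Ico]; omega)]
  rw [map_sum, Finset.mul_sum]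
  refine Frame.Eqv.sum fun b hbm => ?_
  have hb' : b ≤ p := Nat.lt_succ_iff.1 (Finset.mem_range.1 hbm)
  rw [Finset.sum_Ico_eq_sum_range, show p + 1 - b = p - b + 1 by omega, map_smul, mul_smul_comm]
  simp only [Nat.add_sub_cancel_left]
  exact hb b hbm

end Elem
end Intertwining

/-! ### Elementary conformal maps from their coordinate expression -/

section ElemOfChain

variable {R R' : Type*} [CommRing R] [Algebra ℂ R] [CommRing R'] [Algebra ℂ R'] {d : ℕ}

theorem derivation_inv (D : Derivation ℂ R R) {A B : R} (hAB : A * B = 1) :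
    D B = -(D A * B ^ 2) := by
  have h := congrArg D hAB
  rw [Derivation.leibniz, Derivation.map_one_eq_zero, smul_eq_mul, smul_eq_mul] at h
  linear_combination B * h - D B * hAB

/-- An elementary conformal map from its coordinate expression and the chain rule. The matrix `M`
is orthogonal. -/
def Elem.ofChain (F : Frame R d) (F' : Frame R' d) (φ : R' →ₐ[ℂ] R) (u v : R)
    (hUu : F.U u = 1) (hVu : F.V u = 0) (hXu : ∀ k, F.X k u = 0)
    (hUv : F.U v = 0) (hVv : F.V v = 1) (hXv : ∀ k, F.X k v = 0)
    (pu pv : R)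
    (chU : ∀ f, F.U (φ f) = F.U pu * φ (F'.U f) + F.U pv * φ (F'.V f) +
      ∑ l, F.U (φ (F'.x l)) * φ (F'.X l f))
    (chV : ∀ f, F.V (φ f) = F.V pu * φ (F'.U f) + F.V pv * φ (F'.V f) +
      ∑ l, F.V (φ (F'.x l)) * φ (F'.X l f))
    (chX : ∀ k f, F.X k (φ f) = F.X k pu * φ (F'.U f) + F.X k pv * φ (F'.V f) +
      ∑ l, F.X k (φ (F'.x l)) * φ (F'.X l f))
    (φI : ∀ f ∈ F'.I, φ f ∈ F.I)
    (α β γ δ : ℂ) (hdet : α * δ - β * γ = 1) (M : Matrix (Fin d) (Fin d) ℂ)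
    (hM : M.transpose * M = 1) (B : R) (hB : (γ • u + algebraMap ℂ R δ) * B = 1)
    (hpu : pu = (α • u + algebraMap ℂ R β) * B) (hpv : pv = v - γ • (F.r * B))
    (hpx : ∀ l, φ (F'.x l) = ∑ k, M l k • (F.x k * B)) : Elem F F' :=
  have hUB : F.U B = -γ • B ^ 2 := by
    rw [derivation_inv F.U hB, map_add, Derivation.map_smul, hUu, Derivation.map_algebraMap, add_zero,
      smul_mul_assoc, one_mul, neg_smul]
  have hVB : F.V B = 0 := by
    rw [derivation_inv F.V hB, map_add, Derivation.map_smul, hVu, Derivation.map_algebraMap]; simp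
  have hXB : ∀ k, F.X k B = 0 := fun k => by
    rw [derivation_inv (F.X k) hB, map_add, Derivation.map_smul, hXu, Derivation.map_algebraMap]; simp
  have hXX : ∀ k f, F.X k (φ f) = (-2 * γ) • (F.x k * B * φ (F'.V f)) +
      B * ∑ l, M l k • φ (F'.X l f) := fun k f => by
    have h1 : F.X k pu = 0 := by
      rw [hpu, Derivation.leibniz, hXB, map_add, Derivation.map_smul, hXu, Derivation.map_algebraMap]; simp
    have h2 : F.X k pv = (-2 * γ) • (F.x k * B) := by
      rw [hpv, map_sub, hXv, Derivation.map_smul, Derivation.leibniz, hXB, F.X_r, zero_sub, smul_zero,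
        zero_add, smul_eq_mul, neg_mul, neg_smul, mul_smul, ofNat_smul_eq_nsmul, smul_comm]
      congr 2
      rw [nsmul_eq_mul]
      push_cast
      ring
    have h3 : ∀ l, F.X k (φ (F'.x l)) = M l k • B := fun l => by
      rw [hpx, map_sum]
      simp [hXB, F.Xx]
    rw [chX, h1, h2]
    simp only [h3, smul_mul_assoc, mul_smul_comm, Finset.mul_sum]
    simp
  { φ := φ
    B := B
    γ := γ
    UB := hUB
    VB := hVB
    XB := hXB
    φI := φI
    Uφ := fun f => by
      have h1 : F.U pu = B ^ 2 := by
        rw [hpu, Derivation.leibniz, hUB, map_add, Derivation.map_smul, hUu, Derivation.map_algebraMap,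
          add_zero, smul_eq_mul, smul_eq_mul, Algebra.smul_def, Algebra.smul_def, Algebra.smul_def,
          mul_one]
        have h4 := congrArg (algebraMap ℂ R) hdet
        simp only [map_sub, map_mul, map_one] at h4
        rw [Algebra.smul_def] at hB
        rw [map_neg]
        linear_combination (B ^ 2) * h4 - (algebraMap ℂ R α * B) * hB
      -- The u-derivatives of the images of v and x do not vanish identically, but they still
      -- contain a factor x; hence U intertwines only modulo the ideal, whereas the formulas for V
      -- and S are exact.
      have h2 : F.U pv ∈ F.I := by
        rw [hpv, map_sub, hUv, zero_sub]
        refine F.I.neg_mem (F.UI _ ?_)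
        rw [Algebra.smul_def]
        exact F.I.mul_mem_left _ (F.I.mul_mem_right _ F.r_mem)
      have h3 : ∀ l, F.U (φ (F'.x l)) ∈ F.I := fun l => by
        rw [hpx]
        refine F.UI _ (F.I.sum_mem fun k _ => ?_)
        rw [Algebra.smul_def]
        exact F.I.mul_mem_left _ (F.I.mul_mem_right _ (F.memI k))
      rw [chU, h1, Frame.Eqv, add_assoc, add_sub_cancel_left]
      exact F.I.add_mem (F.I.mul_mem_right _ h2)
        (F.I.sum_mem fun l _ => F.I.mul_mem_right _ (h3 l))
    Vφ := fun f => by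
      have h1 : F.V pu = 0 := by
        rw [hpu, Derivation.leibniz, hVB, map_add, Derivation.map_smul, hVu, Derivation.map_algebraMap]; simp
      have hVr : F.V F.r = 0 := by
        rw [Frame.r, map_sum]
        exact Finset.sum_eq_zero fun k _ => by rw [Derivation.leibniz_pow, F.Vx]; simp
      have h2 : F.V pv = 1 := by
        rw [hpv, map_sub, hVv, Derivation.map_smul, Derivation.leibniz, hVB, hVr]; simp
      have h3 : ∀ l, F.V (φ (F'.x l)) = 0 := fun l => by
        rw [hpx, map_sum]
        simp [hVB, F.Vx]
      rw [chV, h1, h2]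
      simp [h3]
    Sφ := fun f => by
      -- Orthonormal columns give φ(r) = B² r; orthonormal rows, which follow because M is square,
      -- make the Laplacian reappear.
      have hMM : ∀ k l, ∑ i, M i k * M i l = if k = l then 1 else 0 := fun k l => by
        have := congrFun (congrFun hM k) l
        simpa [Matrix.mul_apply, Matrix.one_apply] using this
      have hMM' : ∀ k l, ∑ i, M k i * M l i = if k = l then 1 else 0 := fun k l => by
        have := congrFun (congrFun (show M * M.transpose = 1 from mul_eq_one_comm.1 hM) k) l
        simpa [Matrix.mul_apply, Matrix.one_apply] using this
      have hr : φ F'.r = B ^ 2 * F.r := by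
        simp only [Frame.r, map_sum, map_pow, hpx, Finset.mul_sum]
        have h1 : ∀ l, (∑ k, M l k • (F.x k * B)) ^ 2 =
            ∑ k, ∑ k', (M l k * M l k') • (F.x k * B * (F.x k' * B)) := fun l => by
          rw [sq, Finset.sum_mul_sum]
          refine Finset.sum_congr rfl fun k _ => Finset.sum_congr rfl fun k' _ => ?_
          rw [smul_mul_smul_comm]
        simp only [h1]
        rw [Finset.sum_comm]
        refine Finset.sum_congr rfl fun k _ => ?_
        rw [Finset.sum_comm]
        simp only [← Finset.sum_smul, hMM, ite_smul, one_smul, zero_smul]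
        simp
        ring
      have hk : ∀ k, F.X k (F.X k (φ f)) = (-2 * γ) • (B * φ (F'.V f)) +
          (4 * γ ^ 2) • (F.x k ^ 2 * B ^ 2 * φ (F'.V (F'.V f))) +
          (-4 * γ) • (B * ∑ l, (M l k • (F.x k * B)) * φ (F'.X l (F'.V f))) +
          B ^ 2 * ∑ l, ∑ l', (M l k * M l' k) • φ (F'.X l' (F'.X l f)) := by
        intro k
        rw [hXX k f, map_add, Derivation.map_smul, Derivation.leibniz, Derivation.leibniz, Derivation.leibniz,
          hXB, F.Xx, if_pos rfl, hXX, map_sum]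
        simp only [Derivation.map_smul, hXX, F'.VX, smul_eq_mul, mul_one]
        have e1 : ∑ l, M l k • ((-2 * γ) • (F.x k * B * φ (F'.X l (F'.V f))) +
            B * ∑ l', M l' k • φ (F'.X l' (F'.X l f))) =
            (-2 * γ) • (F.x k * B * ∑ l, M l k • φ (F'.X l (F'.V f))) +
            B * ∑ l, ∑ l', (M l k * M l' k) • φ (F'.X l' (F'.X l f)) := by
          simp only [smul_add, Finset.sum_add_distrib, Finset.mul_sum, Finset.smul_sum,
            mul_smul_comm, smul_smul]
          congr 1
          exact Finset.sum_congr rfl fun l _ => by rw [mul_comm]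
        have e2 : ∑ l, (M l k • (F.x k * B)) * φ (F'.X l (F'.V f)) =
            F.x k * B * ∑ l, M l k • φ (F'.X l (F'.V f)) := by
          simp only [Finset.mul_sum, mul_smul_comm, smul_mul_assoc]
        rw [e1, e2]
        simp only [Algebra.smul_def, map_mul, map_neg, map_pow, map_ofNat]
        ring
      rw [Frame.S_apply]
      simp only [hk, Finset.sum_add_distrib, ← Finset.smul_sum, ← Finset.mul_sum]
      have e3 : ∑ k, ∑ l, (M l k • (F.x k * B)) * φ (F'.X l (F'.V f)) =
          φ (F'.E (F'.V f)) := by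
        rw [Finset.sum_comm, Frame.E, map_sum]
        refine Finset.sum_congr rfl fun l _ => ?_
        rw [map_mul, hpx, Finset.sum_mul]
      have e4 : ∑ k, ∑ l, ∑ l', (M l k * M l' k) • φ (F'.X l' (F'.X l f)) = φ (F'.S f) := by
        rw [Finset.sum_comm, Frame.S_apply, map_sum]
        refine Finset.sum_congr rfl fun l _ => ?_
        rw [Finset.sum_comm]
        simp only [← Finset.sum_smul, hMM', ite_smul, one_smul, zero_smul]
        simp
      have e5 : ∑ k, F.x k ^ 2 * B ^ 2 * φ (F'.V (F'.V f)) = φ (F'.r * F'.V (F'.V f)) := by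
        rw [map_mul, hr, Frame.r, ← Finset.sum_mul, ← Finset.sum_mul]
        ring
      rw [e3, e4, e5, Finset.sum_const, Finset.card_univ, Fintype.card_fin,
        ← Nat.cast_smul_eq_nsmul ℂ]
      simp only [Algebra.smul_def, map_mul, map_neg, map_pow, map_ofNat, map_natCast]
      ring }

end ElemOfChain

/-! ### Light-cone coordinates on domains of ℂⁿ -/

section Geometry

variable {d : ℕ} {O O' : Opens (JC d)}

/-- A coordinate function. -/
def coord (j : Fin (d + 2)) : holRing O := holLin (ContinuousLinearMap.proj j)

@[simp] theorem coord_apply (j : Fin (d + 2)) (z : O) : coord j z = (z : JC d) j := rfl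

theorem dd_coord (a : JC d) (j : Fin (d + 2)) :
    dd a (coord j : holRing O) = algebraMap ℂ _ (a j) := dd_holLin _ _

/-- The basis vector `∂_u`; the parameter `τ = ±1` distinguishes the two null directions. -/
def eu (τ : ℂ) : JC d := Fin.cons (1 / 2) (Fin.cons (τ / 2) 0)

/-- The basis vector in a normal direction. -/
def ex (k : Fin d) : JC d := Pi.single k.succ.succ 1

@[simp] theorem eu_zero (τ : ℂ) : (eu τ : JC d) 0 = 1 / 2 := rfl
@[simp] theorem eu_one (τ : ℂ) : (eu τ : JC d) 1 = τ / 2 := rfl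
@[simp] theorem eu_succ (τ : ℂ) (k : Fin d) : (eu τ : JC d) k.succ.succ = 0 := rfl
@[simp] theorem ex_zero (k : Fin d) : (ex k : JC d) 0 = 0 := by simp [ex]
@[simp] theorem ex_one (k : Fin d) : (ex k : JC d) 1 = 0 := by
  have : (1 : Fin (d + 2)) ≠ k.succ.succ := by
    rw [← Fin.succ_zero_eq_one]
    exact fun h => absurd (Fin.succ_injective _ h) (Fin.succ_ne_zero k).symm
  simp [ex, this]
@[simp] theorem ex_succ (k l : Fin d) : (ex k : JC d) l.succ.succ = if k = l then 1 else 0 := by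
  simp [ex, Pi.single_apply, eq_comm]

theorem vec_ext {a b : JC d} (h0 : a 0 = b 0) (h1 : a 1 = b 1)
    (h : ∀ k : Fin d, a k.succ.succ = b k.succ.succ) : a = b := by
  funext j
  refine Fin.cases h0 (fun j => Fin.cases h1 (fun k => h k) j) j

theorem vec_eq {τ : ℂ} (hτ : τ * τ = 1) (w : JC d) :
    w = (w 0 + τ * w 1) • eu τ + (w 0 - τ * w 1) • eu (-τ) + ∑ k, w k.succ.succ • ex k := by
  refine vec_ext ?_ ?_ fun l => ?_
  · simp; ring
  · simp; linear_combination (-w 1) * hτ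
  · simp

/-- The ideal of functions vanishing on the plane `z₂ = ⋯ = z_{d+1} = 0`. -/
def planeIdeal (O : Opens (JC d)) : Ideal (holRing O) where
  carrier := {f | ∀ z : O, (∀ k : Fin d, (z : JC d) k.succ.succ = 0) → f z = 0}
  add_mem' hf hg z hz := by rw [holRing_add, hf z hz, hg z hz, add_zero]
  zero_mem' _ _ := rfl
  smul_mem' c f hf z hz := by rw [smul_eq_mul, holRing_mul, hf z hz, mul_zero]

/-- The direction a is tangent to the plane, so the complex line through a point of the plane in
that direction stays in the plane, and the function is zero along it near the point. -/
theorem dd_mem_planeIdeal {a : JC d} (ha : ∀ k : Fin d, a k.succ.succ = 0) {f : holRing O}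
    (hf : f ∈ planeIdeal O) : dd a f ∈ planeIdeal O := by
  intro z hz
  have h1 : HasDerivAt (fun t : ℂ => ext f.1 ((z : JC d) + t • a)) (der f.1 z a) 0 :=
    (f.2.hasFDerivAt z).hasLineDerivAt a
  have hc : ContinuousAt (fun t : ℂ => (z : JC d) + t • a) 0 := by fun_prop
  have h2 : ∀ᶠ t : ℂ in 𝓝 0, (z : JC d) + t • a ∈ O := by
    refine hc.eventually_mem (O.isOpen.mem_nhds ?_)
    simp
  have h3 : HasDerivAt (fun _ : ℂ => (0 : ℂ)) (der f.1 z a) 0 := by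
    refine h1.congr_of_eventuallyEq ?_
    filter_upwards [h2] with t ht
    have h4 := ext_apply f.1 ⟨_, ht⟩
    refine (h4.trans (hf ⟨_, ht⟩ fun k => ?_)).symm
    simp [hz, ha]
  exact h3.unique (hasDerivAt_const _ _)

/-- The light-cone frame on a domain in `ℂⁿ`. -/
def frame (O : Opens (JC d)) (τ : ℂ) : Frame (holRing O) d where
  U := dd (eu τ)
  V := dd (eu (-τ))
  X k := dd (ex k)
  x k := coord k.succ.succ
  I := planeIdeal O
  UV _ := dd_comm _ _ _
  VX _ _ := dd_comm _ _ _
  XX _ _ _ := dd_comm _ _ _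
  Vx k := by rw [dd_coord]; simp
  Xx k l := by rw [dd_coord, ex_succ]; split_ifs <;> simp
  memI k z hz := hz k
  UI _ hf := dd_mem_planeIdeal (fun _ => rfl) hf
  VI _ hf := dd_mem_planeIdeal (fun _ => rfl) hf

/-- The function G is arbitrary outside O: iterates of differential operators on an extension by
zero are not controlled there, and only the germ at z matters. -/
theorem pd_eq {f : holRing O} {G : JC d → ℂ} (h : ∀ z : O, f z = G z) (j : Fin (d + 2)) (z : O) :
    dd (Pi.single j 1) f z = pd j G z :=
  congrArg (fun L : JC d →L[ℂ] ℂ => L (Pi.single j 1)) (ext_eventuallyEq h z).fderiv_eq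

theorem lap_eq {τ : ℂ} {f : holRing O} {G : JC d → ℂ} (h : ∀ z : O, f z = G z) (z : O) :
    (frame O τ).S f z = lap G z := by
  rw [Frame.S_apply, holRing_sum]
  exact Finset.sum_congr rfl fun k _ => pd_eq (fun w => pd_eq h _ w) _ z

theorem box_eq {τ : ℂ} (hτ : τ * τ = 1) {f : holRing O} {G : JC d → ℂ} (h : ∀ z : O, f z = G z)
    (z : O) : ((4 : ℂ) • (frame O τ).U ((frame O τ).V f)) z = box G z := by
  have e : ∀ σ : ℂ, (eu σ : JC d) =
      (1 / 2 : ℂ) • Pi.single 0 1 + (σ / 2) • Pi.single 1 1 := fun σ => by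
    have h1 : ∀ k : Fin d, k.succ.succ ≠ (1 : Fin (d + 2)) := fun k hk => by
      rw [← Fin.succ_zero_eq_one] at hk
      exact Fin.succ_ne_zero k (Fin.succ_injective _ hk)
    exact vec_ext (by simp) (by simp) fun k => by simp [h1]
  have h1 : (4 : ℂ) • (frame O τ).U ((frame O τ).V f) =
      dd (Pi.single 0 1) (dd (Pi.single 0 1) f) - dd (Pi.single 1 1) (dd (Pi.single 1 1) f) := by
    change (4 : ℂ) • dd (eu τ) (dd (eu (-τ)) f) = _
    rw [e, e]
    simp only [dd_add, dd_smul, Derivation.add_apply, Derivation.smul_apply, map_add,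
      Derivation.map_smul]
    rw [dd_comm (Pi.single 1 1) (Pi.single 0 1)]
    match_scalars <;> first | linear_combination -hτ | ring
  rw [h1, holRing_sub, pd_eq (fun w => pd_eq h _ w), pd_eq (fun w => pd_eq h _ w)]
  rfl

/-- The right side depends on τ only through the choice of frame, the left side not at all; both
frames thus compute the same operator. -/
theorem D_eq_op {τ : ℂ} (hτ : τ * τ = 1) (m p : ℕ) (f : holRing O) (z : O) :
    (∑ j ∈ Finset.range (p + 1), coeff d m p j * (box^[p - j] (lap^[j] (ext f.1))) z) =
      (frame O τ).op m p f z := by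
  have hl : ∀ j, ∀ w : O, ((frame O τ).s ^ j) f w = (lap^[j] (ext f.1)) w := by
    intro j
    induction j with
    | zero => intro w; exact (ext_apply f.1 w).symm
    | succ j ih =>
      intro w
      rw [pow_succ', Module.End.mul_apply, Function.iterate_succ_apply', ← lap_eq ih w]
      rfl
  have hb : ∀ k (g : holRing O) (G : JC d → ℂ), (∀ w : O, g w = G w) →
      ∀ w : O, (((4 : ℂ) • ((frame O τ).u * (frame O τ).v)) ^ k) g w = (box^[k] G) w := by
    intro k g G h
    induction k with
    | zero => exact h
    | succ k ih =>
      intro w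
      rw [pow_succ', Module.End.mul_apply, Function.iterate_succ_apply', ← box_eq hτ ih w]
      rfl
  rw [Frame.op, LinearMap.sum_apply, holRing_sum]
  refine Finset.sum_congr rfl fun j _ => ?_
  rw [← hb _ _ _ (hl j) z, smul_pow, (Frame.u_v_comm (F := frame O τ)).mul_pow, LinearMap.smul_apply,
    LinearMap.smul_apply, holRing_smul, holRing_smul, mul_assoc]
  rfl

/-- The chain rule in light-cone coordinates. -/
theorem dd_holPull {τ : ℂ} (hτ : τ * τ = 1) (h : O → O') (hh : Hol (fun z => (h z : JC d)))
    (a : JC d) (f : holRing O') :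
    dd a (holPull h hh f) =
      dd a (holPull h hh (coord 0 + τ • coord 1)) * holPull h hh ((frame O' τ).U f) +
      dd a (holPull h hh (coord 0 - τ • coord 1)) * holPull h hh ((frame O' τ).V f) +
      ∑ l, dd a (holPull h hh ((frame O' τ).x l)) * holPull h hh ((frame O' τ).X l f) := by
  ext z
  rw [holRing_add, holRing_add, holRing_sum]
  simp only [holRing_mul, dd_holPull_apply, holPull_apply]
  set w := der (fun z => (h z : JC d)) z a
  have e : ∀ b : JC d, dd b f (h z) = der f.1 (h z) b := fun _ => rfl
  have ec : ∀ b : JC d, ∀ j, dd b (coord j : holRing O') (h z) = b j := fun b j => by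
    rw [dd_coord]; rfl
  have e2 : ∀ l, (frame O' τ).x l = coord l.succ.succ := fun _ => rfl
  conv_lhs => rw [vec_eq hτ w, e]
  simp only [map_add, map_sub, Derivation.map_smul, map_smul, map_sum, holRing_add, holRing_sub,
    holRing_smul, ec, e2, smul_eq_mul]
  rfl

/-- A holomorphic map given in coordinates by an elementary conformal map. -/
def elemOfMap {τ : ℂ} (hτ : τ * τ = 1) (h : O → O') (hh : Hol (fun z => (h z : JC d)))
    (α β γ δ : ℂ) (hdet : α * δ - β * γ = 1) (M : Matrix (Fin d) (Fin d) ℂ)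
    (hM : M.transpose * M = 1) (B : holRing O)
    (hB : ∀ z : O, (γ * ((z : JC d) 0 + τ * (z : JC d) 1) + δ) * B z = 1)
    (hpu : ∀ z : O, (h z : JC d) 0 + τ * (h z : JC d) 1 =
      (α * ((z : JC d) 0 + τ * (z : JC d) 1) + β) * B z)
    (hpv : ∀ z : O, (h z : JC d) 0 - τ * (h z : JC d) 1 =
      (z : JC d) 0 - τ * (z : JC d) 1 - γ * ((∑ k : Fin d, (z : JC d) k.succ.succ ^ 2) * B z))
    (hpx : ∀ (z : O) (l : Fin d), (h z : JC d) l.succ.succ =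
      ∑ k, M l k * ((z : JC d) k.succ.succ * B z)) :
    Elem (frame O τ) (frame O' τ) :=
  have hdd : ∀ (a : JC d) (σ : ℂ), dd a (coord 0 + σ • coord 1 : holRing O) =
      algebraMap ℂ _ (a 0 + σ * a 1) := fun a σ => by
    rw [map_add, Derivation.map_smul, dd_coord, dd_coord]
    ext z
    rfl
  have hneg : (coord 0 - τ • coord 1 : holRing O) = coord 0 + (-τ) • coord 1 := by
    rw [neg_smul, sub_eq_add_neg]
  have hEU : (frame O τ).U = dd (eu τ) := rfl
  have hEV : (frame O τ).V = dd (eu (-τ)) := rfl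
  have hEX : ∀ k, (frame O τ).X k = dd (ex k) := fun _ => rfl
  Elem.ofChain (frame O τ) (frame O' τ) (holPull h hh) (coord 0 + τ • coord 1)
    (coord 0 - τ • coord 1)
    (by rw [hEU, hdd, eu_zero, eu_one,
        show (1 / 2 + τ * (τ / 2) : ℂ) = 1 by linear_combination (1 / 2) * hτ, map_one])
    (by rw [hEV, hdd, eu_zero, eu_one,
        show (1 / 2 + τ * (-τ / 2) : ℂ) = 0 by linear_combination (-1 / 2) * hτ, map_zero])
    (fun k => by rw [hEX, hdd, ex_zero, ex_one, mul_zero, add_zero, map_zero])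
    (by rw [hneg, hEU, hdd, eu_zero, eu_one,
        show (1 / 2 + -τ * (τ / 2) : ℂ) = 0 by linear_combination (-1 / 2) * hτ, map_zero])
    (by rw [hneg, hEV, hdd, eu_zero, eu_one,
        show (1 / 2 + -τ * (-τ / 2) : ℂ) = 1 by linear_combination (1 / 2) * hτ, map_one])
    (fun k => by rw [hneg, hEX, hdd, ex_zero, ex_one, mul_zero, add_zero, map_zero])
    (holPull h hh (coord 0 + τ • coord 1)) (holPull h hh (coord 0 - τ • coord 1))
    (fun f => dd_holPull hτ h hh _ f) (fun f => dd_holPull hτ h hh _ f)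
    (fun k f => dd_holPull hτ h hh _ f)
    (fun f hf z hz => hf (h z) fun l => by rw [hpx]; simp [hz])
    α β γ δ hdet M hM B
    (holRing_ext fun z => by
      simp only [holRing_mul, holRing_add, holRing_smul, coord_apply, holRing_algebraMap,
        holRing_one]
      exact hB z)
    (holRing_ext fun z => by
      simp only [holPull_apply, holRing_mul, holRing_add, holRing_smul, coord_apply,
        holRing_algebraMap]
      exact hpu z)
    (holRing_ext fun z => by
      have hr : (frame O τ).r z = ∑ k : Fin d, (z : JC d) k.succ.succ ^ 2 := by
        rw [Frame.r, holRing_sum]; rfl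
      simp only [holPull_apply, holRing_sub, holRing_mul, holRing_smul, coord_apply, hr]
      exact hpv z)
    (fun l => holRing_ext fun z => by
      rw [holRing_sum]
      simp only [holRing_smul, holRing_mul]
      exact hpx z l)

end Geometry

/-! ### Holomorphic conformal maps: a version of Liouville's theorem -/

section Liouville

variable {d : ℕ}

/-- The polar form of the determinant. -/
def bil {R : Type*} [CommRing R] (x y : Fin (d + 2) → R) : R :=
  x 0 * y 0 - ∑ j : Fin (d + 1), x j.succ * y j.succ

section bil

variable {R : Type*} [CommRing R]

theorem bil_comm (x y : Fin (d + 2) → R) : bil x y = bil y x := by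
  simp only [bil, mul_comm]

theorem bil_add (x y z : Fin (d + 2) → R) : bil (x + y) z = bil x z + bil y z := by
  simp only [bil, Pi.add_apply, add_mul, Finset.sum_add_distrib]
  ring

theorem bil_smul (c : R) (x y : Fin (d + 2) → R) : bil (c • x) y = c * bil x y := by
  simp only [bil, Pi.smul_apply, smul_eq_mul, mul_assoc, ← Finset.mul_sum]
  ring

theorem bil_zero (y : Fin (d + 2) → R) : bil 0 y = 0 := by simp [bil]

theorem bil_eq (x y : Fin (d + 2) → R) : bil x y =
    x 0 * y 0 - x 1 * y 1 - ∑ k : Fin d, x k.succ.succ * y k.succ.succ := by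
  rw [bil, Fin.sum_univ_succ, Fin.succ_zero_eq_one]
  ring

theorem derivation_bil [Algebra ℂ R] (D : Derivation ℂ R R) (x y : Fin (d + 2) → R) :
    D (bil x y) = bil (fun j => D (x j)) y + bil x (fun j => D (y j)) := by
  simp only [bil, map_sub, Derivation.leibniz, map_sum, smul_eq_mul, Finset.sum_add_distrib]
  have : ∑ j : Fin (d + 1), y j.succ * D (x j.succ) = ∑ j : Fin (d + 1), D (x j.succ) * y j.succ :=
    Finset.sum_congr rfl fun _ _ => mul_comm _ _
  rw [this]
  ring

end bil

theorem jdetC_eq_bil (x : JC d) : jdetC x = bil x x := by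
  simp only [jdetC, bil, sq]

theorem bil_of_jdetC {L : JC d →ₗ[ℂ] JC d} {c : ℂ} (h : ∀ x, jdetC (L x) = c * jdetC x)
    (x y : JC d) : bil (L x) (L y) = c * bil x y := by
  have h1 := h (x + y)
  have h2 := h x
  have h3 := h y
  simp only [jdetC_eq_bil, map_add, bil_add] at h1 h2 h3
  rw [bil_comm _ (L x + L y), bil_comm _ (L x + L y), bil_comm _ (x + y), bil_comm _ (x + y)] at h1
  simp only [bil_add] at h1
  rw [bil_comm (L y) (L x), bil_comm y x] at h1
  linear_combination (1 / 2) * (h1 - h2 - h3)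

theorem eq_zero_of_bil {x : JC d} (h : ∀ y, bil x y = 0) : x = 0 := by
  refine vec_ext ?_ ?_ fun k => ?_
  · have := h (eu 1 + eu (-1))
    rw [bil_eq] at this
    simp only [Pi.add_apply, eu_zero, eu_one, eu_succ, add_zero, mul_zero,
      Finset.sum_const_zero] at this
    change x 0 = 0
    linear_combination this
  · have := h (eu 1 - eu (-1))
    rw [bil_eq] at this
    simp only [Pi.sub_apply, eu_zero, eu_one, eu_succ, sub_zero, mul_zero,
      Finset.sum_const_zero] at this
    change x 1 = 0
    linear_combination -this
  · have := h (ex k)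
    rw [bil_eq] at this
    simpa using this

variable {T T' : Opens (JC d)}

/-- A conformal holomorphic map. -/
structure Conf (T T' : Opens (JC d)) where
  h : T → T'
  hol : Hol (fun z => (h z : JC d))
  ψ : holRing T
  ρ : holRing T
  ρψ : ρ * ψ = 1
  sq : ∀ (z : T) (x : JC d), jdetC (der (fun z => (h z : JC d)) z x) = ψ z ^ 2 * jdetC x

/-- The Hessian vanishes on orthogonal pairs which have a common nonnull orthogonal vector. -/
def HessZero (f : holRing T) : Prop :=
  ∀ a b c : JC d, bil a b = 0 → bil b c = 0 → bil a c = 0 → bil c c ≠ 0 → dd a (dd b f) = 0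

theorem HessZero.add {f g : holRing T} (hf : HessZero f) (hg : HessZero g) : HessZero (f + g) :=
  fun a b c h1 h2 h3 h4 => by
    rw [map_add, map_add, hf a b c h1 h2 h3 h4, hg a b c h1 h2 h3 h4, add_zero]

theorem HessZero.smul {f : holRing T} (t : ℂ) (hf : HessZero f) : HessZero (t • f) :=
  fun a b c h1 h2 h3 h4 => by
    rw [Derivation.map_smul, Derivation.map_smul, hf a b c h1 h2 h3 h4, smul_zero]

namespace Conf

variable (C : Conf T T')

/-- The components of the map. -/
def cpt (j : Fin (d + 2)) : holRing T := holPull C.h C.hol (coord j)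

theorem cpt_apply (j : Fin (d + 2)) (z : T) : C.cpt j z = (C.h z : JC d) j := rfl

/-- The directional derivatives of the components. -/
def dH (a : JC d) (j : Fin (d + 2)) : holRing T := dd a (C.cpt j)

theorem dH_apply (a : JC d) (j : Fin (d + 2)) (z : T) :
    C.dH a j z = der (fun z => (C.h z : JC d)) z a j := by
  rw [dH, cpt, dd_holPull_apply, dd_coord]
  rfl

theorem bil_apply (f g : Fin (d + 2) → holRing T) (z : T) :
    (bil f g) z = bil (fun j => f j z) (fun j => g j z) := by
  simp only [bil, holRing_sub, holRing_mul, holRing_sum]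

theorem bil_dH (a b : JC d) : bil (C.dH a) (C.dH b) = bil a b • C.ψ ^ 2 := by
  ext z
  rw [bil_apply, holRing_smul, holRing_pow]
  simp only [dH_apply]
  rw [mul_comm]
  exact bil_of_jdetC (L := (der (fun z => (C.h z : JC d)) z).toLinearMap) (C.sq z) a b

theorem ψ_ne_zero (z : T) : C.ψ z ≠ 0 := fun h => by
  have := congrArg (fun f : holRing T => f z) C.ρψ
  simp [h] at this

/-- Koszul's formula. -/
theorem koszul (a b l : JC d) :
    bil (fun j => dd a (C.dH b j)) (C.dH l) =
      C.ψ * (bil b l • dd a C.ψ + bil a l • dd b C.ψ - bil a b • dd l C.ψ) := by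
  have key : ∀ l a b : JC d, bil (fun j => dd l (C.dH a j)) (C.dH b) +
      bil (fun j => dd l (C.dH b j)) (C.dH a) = (2 : ℂ) • (C.ψ * bil a b • dd l C.ψ) := by
    intro l a b
    have h1 := congrArg (dd l) (C.bil_dH a b)
    rw [derivation_bil, Derivation.map_smul, Derivation.leibniz_pow, bil_comm (C.dH a)] at h1
    rw [h1, smul_eq_mul, pow_one, mul_smul_comm, smul_comm (2 : ℂ)]
    congr 1
    rw [two_smul, two_smul]
  have hs : ∀ a b l : JC d, bil (fun j => dd a (C.dH b j)) (C.dH l) =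
      bil (fun j => dd b (C.dH a j)) (C.dH l) := fun a b l => by
    simp only [dH, dd_comm a b]
  have k1 := key a b l
  have k2 := key b a l
  have k3 := key l a b
  rw [hs a l b] at k1
  rw [hs b a l, hs b l a] at k2
  have h2 : (2 : ℂ) • bil (fun j => dd a (C.dH b j)) (C.dH l) = (2 : ℂ) • (C.ψ *
      (bil b l • dd a C.ψ + bil a l • dd b C.ψ - bil a b • dd l C.ψ)) := by
    rw [mul_sub, mul_add, smul_sub, smul_add, ← k1, ← k2, ← k3, two_smul]
    ring
  exact smul_right_injective _ (two_ne_zero (α := ℂ)) h2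

/-- The differential is conformal with nonzero factor, hence injective by nondegeneracy of the form,
hence surjective by dimension. So the vectors `dH l` span at each point and test any field against
the form. -/
theorem eq_zero_of_bil_dH {W : Fin (d + 2) → holRing T} (hW : ∀ l, bil W (C.dH l) = 0) :
    W = 0 := by
  have key : ∀ z : T, (fun j => W j z) = (0 : JC d) := by
    intro z
    set L : JC d →ₗ[ℂ] JC d := (der (fun z => (C.h z : JC d)) z).toLinearMap
    have hL : ∀ x y, bil (L x) (L y) = C.ψ z ^ 2 * bil x y := bil_of_jdetC (C.sq z)
    have hinj : Function.Injective L := by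
      rw [← LinearMap.ker_eq_bot, LinearMap.ker_eq_bot']
      intro x hx
      refine eq_zero_of_bil fun y => ?_
      have := hL x y
      rw [hx, bil_zero] at this
      simpa [C.ψ_ne_zero z] using this.symm
    refine eq_zero_of_bil fun y => ?_
    obtain ⟨l, rfl⟩ := LinearMap.injective_iff_surjective.1 hinj y
    have := congrArg (fun f : holRing T => f z) (hW l)
    simp only [bil_apply, dH_apply] at this
    exact this
  funext j
  ext z
  exact congrFun (key z) j

theorem dd_ρ (a : JC d) : dd a C.ρ = -(dd a C.ψ * C.ρ ^ 2) :=
  derivation_inv _ (by rw [mul_comm]; exact C.ρψ)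

/-- The mixed second derivatives in orthogonal directions. -/
theorem mixed {a b : JC d} (hab : bil a b = 0) (j : Fin (d + 2)) :
    C.ρ * dd a (dd b (C.cpt j)) + dd a C.ρ * dd b (C.cpt j) + dd b C.ρ * dd a (C.cpt j) = 0 := by
  have h1 : (fun j => dd a (C.dH b j)) + (-(C.ρ * dd a C.ψ)) • C.dH b +
      (-(C.ρ * dd b C.ψ)) • C.dH a = 0 := by
    refine C.eq_zero_of_bil_dH fun l => ?_
    rw [bil_add, bil_add, bil_smul, bil_smul, koszul, bil_dH, bil_dH, hab, zero_smul, sub_zero]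
    simp only [Algebra.smul_def]
    linear_combination (-(algebraMap ℂ (holRing T) (bil b l) * dd a C.ψ +
      algebraMap ℂ (holRing T) (bil a l) * dd b C.ψ) * C.ψ) * C.ρψ
  have h2 := congrFun h1 j
  simp only [Pi.add_apply, Pi.smul_apply, smul_eq_mul, Pi.zero_apply, dH] at h2
  rw [dd_ρ, dd_ρ]
  linear_combination C.ρ * h2

/-- Differentiate `mixed` for (a, b) along c and for (c, b) along a, and subtract. All terms cancel
except Hess ρ(b, c) ∂_a H = Hess ρ(a, b) ∂_c H. The vectors ∂_a H and ∂_c H are orthogonal and the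
second is nonnull, so pairing with ∂_c H leaves Hess ρ(a, b) = 0. -/
theorem hessZero_ρ : HessZero C.ρ := by
  intro a b c hab hbc hac hcc
  have hca : bil c a = 0 := by rw [bil_comm]; exact hac
  have hcb : bil c b = 0 := by rw [bil_comm]; exact hbc
  have h1 : ∀ j, dd b (dd c C.ρ) * dd a (C.cpt j) = dd a (dd b C.ρ) * dd c (C.cpt j) := by
    intro j
    have m1 := congrArg (dd c) (C.mixed hab j)
    have m2 := congrArg (dd a) (C.mixed hcb j)
    simp only [map_add, Derivation.leibniz, smul_eq_mul, map_zero] at m1 m2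
    rw [dd_comm c a (dd b (C.cpt j)), dd_comm c b (C.cpt j), dd_comm c a C.ρ, dd_comm c a (C.cpt j),
      dd_comm c b C.ρ] at m1
    rw [dd_comm c b (C.cpt j)] at m2
    linear_combination m1 - m2
  have h2 : (dd b (dd c C.ρ)) • C.dH a = (dd a (dd b C.ρ)) • C.dH c := funext h1
  have h3 := congrArg (fun W => bil W (C.dH c)) h2
  simp only [bil_smul, bil_dH, hac, zero_smul, mul_zero] at h3
  ext z
  have h4 := congrArg (fun f : holRing T => f z) h3.symm
  simp only [holRing_mul, holRing_smul, holRing_pow, holRing_zero] at h4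
  simpa [hcc, C.ψ_ne_zero z] using h4

/-- By Leibniz, the left side of `mixed` is what remains of Hess(ρH)(a, b) after removing H · Hess
ρ(a, b). -/
theorem hessZero_ρH (j : Fin (d + 2)) : HessZero (C.ρ * C.cpt j) := by
  intro a b c hab hbc hac hcc
  have h1 := C.hessZero_ρ a b c hab hbc hac hcc
  have h2 := C.mixed hab j
  simp only [map_add, Derivation.leibniz, smul_eq_mul]
  linear_combination h2 + C.cpt j * h1

end Conf

theorem dd_eq_zero_of_frame {f : holRing T} (hU : dd (eu 1) f = 0) (hV : dd (eu (-1)) f = 0)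
    (hX : ∀ k, dd (ex k) f = 0) (a : JC d) : dd a f = 0 := by
  ext z
  have e : ∀ b : JC d, dd b f z = der f.1 z b := fun _ => rfl
  have h := vec_eq (τ := 1) (by norm_num) a
  rw [e, h, map_add, map_add, map_smul, map_smul, map_sum]
  simp only [map_smul]
  simp only [← e, hU, hV, hX]
  simp

theorem bil_eu (σ τ : ℂ) : bil (eu σ : JC d) (eu τ) = (1 - σ * τ) / 4 := by
  rw [bil_eq]; simp; ring

theorem bil_eu_ex (σ : ℂ) (k : Fin d) : bil (eu σ : JC d) (ex k) = 0 := by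
  rw [bil_eq]; simp

theorem bil_ex (k l : Fin d) : bil (ex k : JC d) (ex l) = if k = l then -1 else 0 := by
  rw [bil_eq]
  simp only [ex_zero, ex_one, ex_succ]
  split_ifs with h
  · simp [h]
  · simp [h]

/-- Two normal directions are needed: to see that a mixed derivative involving x_k vanishes, or to
compare ∂_{x_k}² with ∂_u ∂_v, a second normal vector serves as the common nonnull orthogonal one.
-/
theorem HessZero.relations (hd : 2 ≤ d) {f : holRing T} (hf : HessZero f) :
    dd (eu 1) (dd (eu 1) f) = 0 ∧ dd (eu (-1)) (dd (eu (-1)) f) = 0 ∧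
    (∀ σ (k : Fin d), dd (ex k) (dd (eu σ) f) = 0 ∨ σ * σ ≠ 1) ∧
    (∀ k l : Fin d, k ≠ l → dd (ex k) (dd (ex l) f) = 0) ∧
    ∀ k : Fin d, dd (ex k) (dd (ex k) f) = (-2 : ℂ) • dd (eu 1) (dd (eu (-1)) f) := by
  have hbx : ∀ k : Fin d, bil (ex k : JC d) (ex k) ≠ 0 := fun k => by simp [bil_ex]
  have hex : ∀ σ (k : Fin d), bil (ex k : JC d) (eu σ) = 0 := fun σ k => by
    rw [bil_comm, bil_eu_ex]
  have hother : ∀ k : Fin d, ∃ l, l ≠ k := fun k => by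
    have : Nontrivial (Fin d) := Fin.nontrivial_iff_two_le.2 hd
    exact exists_ne k
  have k₀ : Fin d := ⟨0, by omega⟩
  have hUU : dd (eu 1) (dd (eu 1) f) = 0 :=
    hf _ _ (ex k₀) (by rw [bil_eu]; norm_num) (bil_eu_ex _ _) (bil_eu_ex _ _) (hbx _)
  have hVV : dd (eu (-1)) (dd (eu (-1)) f) = 0 :=
    hf _ _ (ex k₀) (by rw [bil_eu]; norm_num) (bil_eu_ex _ _) (bil_eu_ex _ _) (hbx _)
  have hXU : ∀ σ, σ * σ = 1 → ∀ k, dd (ex k) (dd (eu σ) f) = 0 := fun σ _ k => by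
    obtain ⟨l, hl⟩ := hother k
    exact hf _ _ (ex l) (hex _ _) (bil_eu_ex _ _) (by simp [bil_ex, hl.symm]) (hbx _)
  have hXX : ∀ k l, k ≠ l → dd (ex k) (dd (ex l) f) = 0 := fun k l hkl => by
    have hc : ∀ x : JC d, bil x (eu 1 + eu (-1)) = bil x (eu 1) + bil x (eu (-1)) := fun x => by
      rw [bil_comm, bil_add, bil_comm _ x, bil_comm _ x]
    refine hf _ _ (eu 1 + eu (-1)) (by simp [bil_ex, hkl]) ?_ ?_ ?_
    · rw [hc, hex, hex, add_zero]
    · rw [hc, hex, hex, add_zero]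
    · rw [hc, bil_add, bil_add, bil_eu, bil_eu, bil_eu, bil_eu]; norm_num
  set lamF : holRing T := dd (eu 1) (dd (eu (-1)) f) with hlamF
  have hdiag : ∀ k, dd (ex k) (dd (ex k) f) = (-2 : ℂ) • lamF := fun k => by
    obtain ⟨l, hl⟩ := hother k
    -- The pair is orthogonal because the form takes the value 1/2 on the two null vectors and −1 on
    -- the normal vector with itself; expanding the Hessian ties the diagonal entries together.
    have h1 := hf (eu 1 + ex k) (eu (-1) + (1 / 2 : ℂ) • ex k) (ex l) ?_ ?_ ?_ (hbx l)
    · simp only [dd_add, dd_smul, Derivation.add_apply, Derivation.smul_apply, map_add,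
        Derivation.map_smul] at h1
      rw [hXU _ (by norm_num), dd_comm (eu 1) (ex k), hXU _ (by norm_num)] at h1
      have h2 : lamF + (1 / 2 : ℂ) • dd (ex k) (dd (ex k) f) = 0 := by
        rw [← h1, hlamF]; module
      have h3 : dd (ex k) (dd (ex k) f) =
          (-2 : ℂ) • lamF + (2 : ℂ) • (lamF + (1 / 2 : ℂ) • dd (ex k) (dd (ex k) f)) := by module
      rw [h3, h2, smul_zero, add_zero]
    · rw [bil_add, bil_comm, bil_comm (ex k), bil_add, bil_add, bil_smul, bil_smul, bil_eu, hex,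
        bil_eu_ex, bil_ex, if_pos rfl]
      norm_num
    · rw [bil_add, bil_smul, bil_eu_ex, bil_ex, if_neg hl.symm]; simp
    · rw [bil_add, bil_eu_ex, bil_ex, if_neg hl.symm]; simp
  exact ⟨hUU, hVV, fun σ k => or_iff_not_imp_right.2 fun h => hXU σ (not_not.1 h) k, hXX, hdiag⟩

set_option maxHeartbeats 1000000 in
/-- On a connected domain, `HessZero` functions are combinations of `1`, the coordinates, and the
determinant. -/
theorem HessZero.exists_eq (hd : 2 ≤ d) (hT : IsPreconnected (T : Set (JC d))) {f : holRing T}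
    (hf : HessZero f) : ∃ (c cu cv lam : ℂ) (l : Fin d → ℂ),
      (∀ z : T, f z = c + cu * ((z : JC d) 0 + (z : JC d) 1) + cv * ((z : JC d) 0 - (z : JC d) 1) +
        lam * (((z : JC d) 0 + (z : JC d) 1) * ((z : JC d) 0 - (z : JC d) 1) -
          ∑ k : Fin d, (z : JC d) k.succ.succ ^ 2) + ∑ k, l k * (z : JC d) k.succ.succ) ∧
      ∀ (k : Fin d) (z : T), dd (ex k) f z = l k - 2 * lam * (z : JC d) k.succ.succ := by
  rcases isEmpty_or_nonempty T with hE | ⟨⟨z₀⟩⟩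
  · exact ⟨0, 0, 0, 0, 0, fun z => isEmptyElim z, fun _ z => isEmptyElim z⟩
  obtain ⟨hUU, hVV, hXU', hXX, hdiag⟩ := hf.relations hd
  have hXU : ∀ σ, σ * σ = 1 → ∀ k, dd (ex k) (dd (eu σ) f) = 0 := fun σ hσ k =>
    (hXU' σ k).resolve_right (not_not.2 hσ)
  set lamF : holRing T := dd (eu 1) (dd (eu (-1)) f) with hlamF
  -- Each third derivative occurring here contains a second derivative already known to vanish.
  have hlc : ∀ a, dd a lamF = 0 := dd_eq_zero_of_frame
    (by rw [hlamF, dd_comm (eu 1) (eu (-1)), dd_comm (eu 1) (eu (-1)), hUU, map_zero])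
    (by rw [hlamF, dd_comm (eu (-1)) (eu 1), hVV, map_zero])
    (fun k => by rw [hlamF, dd_comm (ex k) (eu 1), hXU _ (by norm_num), map_zero])
  have hconst : ∀ g : holRing T, (∀ a, dd a g = 0) → g = algebraMap ℂ _ (g z₀) := fun g hg => by
    ext z
    exact holRing_const_of_dd_eq_zero hT hg z z₀
  obtain ⟨lam, hlam⟩ : ∃ lam, lamF = algebraMap ℂ _ lam := ⟨_, hconst _ hlc⟩
  have hcu : ∀ (a : JC d) (σ : ℂ), dd a (coord 0 + σ • coord 1 : holRing T) =
      algebraMap ℂ _ (a 0 + σ * a 1) := fun a σ => by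
    rw [map_add, Derivation.map_smul, dd_coord, dd_coord]
    ext z
    rfl
  have hcx : ∀ (a : JC d) (k : Fin d), dd a (coord k.succ.succ : holRing T) =
      algebraMap ℂ _ (a k.succ.succ) := fun a k => dd_coord _ _
  obtain ⟨cu, hcu'⟩ : ∃ cu, dd (eu 1) f = lam • (coord 0 + (-1 : ℂ) • coord 1) +
      algebraMap ℂ _ cu := by
    refine ⟨(dd (eu 1) f - lam • (coord 0 + (-1 : ℂ) • coord 1) : holRing T) z₀, ?_⟩
    rw [← hconst (dd (eu 1) f - lam • (coord 0 + (-1 : ℂ) • coord 1)), add_sub_cancel]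
    refine dd_eq_zero_of_frame ?_ ?_ fun k => ?_
    · rw [map_sub, hUU, Derivation.map_smul, hcu]; simp
    · rw [map_sub, dd_comm, ← hlamF, Derivation.map_smul, hcu, hlam]
      ext z
      simp only [holRing_sub, holRing_smul, holRing_algebraMap, holRing_zero, eu_zero, eu_one]
      ring
    · rw [map_sub, hXU _ (by norm_num), Derivation.map_smul, hcu]; simp
  obtain ⟨cv, hcv'⟩ : ∃ cv, dd (eu (-1)) f = lam • (coord 0 + (1 : ℂ) • coord 1) +
      algebraMap ℂ _ cv := by
    refine ⟨(dd (eu (-1)) f - lam • (coord 0 + (1 : ℂ) • coord 1) : holRing T) z₀, ?_⟩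
    rw [← hconst (dd (eu (-1)) f - lam • (coord 0 + (1 : ℂ) • coord 1)), add_sub_cancel]
    refine dd_eq_zero_of_frame ?_ ?_ fun k => ?_
    · rw [map_sub, ← hlamF, Derivation.map_smul, hcu, hlam]
      ext z
      simp only [holRing_sub, holRing_smul, holRing_algebraMap, holRing_zero, eu_zero, eu_one]
      ring
    · rw [map_sub, hVV, Derivation.map_smul, hcu]
      ext z
      simp only [holRing_sub, holRing_smul, holRing_algebraMap, holRing_zero, eu_zero, eu_one]
      ring
    · rw [map_sub, hXU _ (by norm_num), Derivation.map_smul, hcu]; simp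
  have hl : ∀ k, ∃ l, dd (ex k) f = (-2 * lam) • coord k.succ.succ + algebraMap ℂ _ l := fun k => by
    refine ⟨(dd (ex k) f - (-2 * lam) • coord k.succ.succ : holRing T) z₀, ?_⟩
    rw [← hconst (dd (ex k) f - (-2 * lam) • coord k.succ.succ), add_sub_cancel]
    refine dd_eq_zero_of_frame ?_ ?_ fun l => ?_
    · rw [map_sub, dd_comm, hXU _ (by norm_num), Derivation.map_smul, hcx]; simp
    · rw [map_sub, dd_comm, hXU _ (by norm_num), Derivation.map_smul, hcx]; simp
    · rw [map_sub, Derivation.map_smul, hcx, ex_succ]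
      split_ifs with hkl
      · rw [hkl, hdiag, hlam, Algebra.smul_def, Algebra.smul_def, ← map_mul, ← map_mul, ← map_sub]
        simp
      · rw [hXX _ _ hkl]; simp
  choose l hl using hl
  set q : holRing T := cu • (coord 0 + (1 : ℂ) • coord 1) + cv • (coord 0 + (-1 : ℂ) • coord 1) +
    lam • ((coord 0 + (1 : ℂ) • coord 1) * (coord 0 + (-1 : ℂ) • coord 1) -
      ∑ k : Fin d, coord k.succ.succ ^ 2) + ∑ k, l k • coord k.succ.succ with hq
  have hdq : ∀ a, dd a q = algebraMap ℂ _ (cu * (a 0 + 1 * a 1) + cv * (a 0 + -1 * a 1)) +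
      lam • ((coord 0 + (1 : ℂ) • coord 1) * algebraMap ℂ _ (a 0 + -1 * a 1) +
        (coord 0 + (-1 : ℂ) • coord 1) * algebraMap ℂ _ (a 0 + 1 * a 1)
        - ∑ k : Fin d, (2 * a k.succ.succ) • coord k.succ.succ) +
      ∑ k, algebraMap ℂ _ (l k * a k.succ.succ) := by
    intro a
    have h2 : ∀ k : Fin d, dd a ((coord k.succ.succ : holRing T) ^ 2) =
        (2 * a k.succ.succ) • coord k.succ.succ := fun k => by
      rw [Derivation.leibniz_pow, hcx]
      ext z
      simp [two_mul]
      ring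
    simp only [hq, map_add, map_sub, map_sum, Derivation.map_smul, hcu, hcx, Derivation.leibniz, h2]
    ext z
    simp only [holRing_add, holRing_sub, holRing_mul, holRing_smul, holRing_sum, holRing_algebraMap,
      smul_eq_mul]
  have hfq : ∀ a, dd a (f - q) = 0 := by
    refine dd_eq_zero_of_frame ?_ ?_ fun k => ?_
    · rw [map_sub, hcu', hdq]
      ext z
      simp
      ring
    · rw [map_sub, hcv', hdq]
      ext z
      simp
      ring
    · rw [map_sub, hl, hdq]
      ext z
      simp
      ring
  refine ⟨(f - q) z₀, cu, cv, lam, l, fun z => ?_, fun k z => ?_⟩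
  · have h1 := holRing_const_of_dd_eq_zero hT hfq z z₀
    rw [← h1]
    simp [hq]
    ring
  · rw [hl]
    simp
    ring

end Liouville

/-! ### The tube, its projection to the plane and its convexity -/

section Tube

variable {d : ℕ}

theorem emb_zero (w₁ w₂ : ℂ) : emb d w₁ w₂ 0 = (w₁ + w₂) / 2 := rfl
theorem emb_one (w₁ w₂ : ℂ) : emb d w₁ w₂ 1 = (w₁ - w₂) / 2 := rfl
theorem emb_succ (w₁ w₂ : ℂ) (k : Fin d) : emb d w₁ w₂ k.succ.succ = 0 := rfl

theorem embT_coe (w : H × H) : (embT d w : JC d) = emb d w.1 w.2 := rfl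

theorem mem_tube_iff {z : JC d} : z ∈ tube d ↔
    0 < (z 0).im ^ 2 - ∑ j : Fin (d + 1), (z j.succ).im ^ 2 ∧ 0 < (z 0).im := Iff.rfl

theorem abs_im_lt_of_mem_tube {z : JC d} (hz : z ∈ tube d) : |(z 1).im| < (z 0).im := by
  obtain ⟨h1, h2⟩ := mem_tube_iff.1 hz
  refine abs_lt_of_sq_lt_sq ?_ h2.le
  have h3 : (z (Fin.succ 0)).im ^ 2 ≤ ∑ j : Fin (d + 1), (z j.succ).im ^ 2 :=
    Finset.single_le_sum (f := fun j : Fin (d + 1) => (z j.succ).im ^ 2)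
      (fun _ _ => sq_nonneg _) (Finset.mem_univ _)
  rw [Fin.succ_zero_eq_one] at h3
  linarith

theorem add_mem_H {z : JC d} (hz : z ∈ tube d) : z 0 + z 1 ∈ H := by
  have := abs_lt.1 (abs_im_lt_of_mem_tube hz)
  change 0 < (z 0 + z 1).im
  rw [Complex.add_im]
  linarith

theorem sub_mem_H {z : JC d} (hz : z ∈ tube d) : z 0 - z 1 ∈ H := by
  have := abs_lt.1 (abs_im_lt_of_mem_tube hz)
  change 0 < (z 0 - z 1).im
  rw [Complex.sub_im]
  linarith

/-- The projection of `T_Ω` onto `T_{Ω(c)}` in terms of the coordinates `w₁, w₂`. -/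
def proj (z : tube d) : H × H :=
  (⟨(z : JC d) 0 + (z : JC d) 1, add_mem_H z.2⟩, ⟨(z : JC d) 0 - (z : JC d) 1, sub_mem_H z.2⟩)

theorem proj_embT (w : H × H) : proj (embT d w) = w := by
  refine Prod.ext (Subtype.ext ?_) (Subtype.ext ?_)
  · simp only [proj, embT_coe, emb_zero, emb_one]; ring
  · simp only [proj, embT_coe, emb_zero, emb_one]; ring

theorem embT_proj {z : tube d} (hz : ∀ k : Fin d, (z : JC d) k.succ.succ = 0) :
    embT d (proj z) = z := by
  refine Subtype.ext (vec_ext ?_ ?_ fun k => ?_)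
  · simp only [proj, embT_coe, emb_zero]; ring
  · simp only [proj, embT_coe, emb_one]; ring
  · rw [hz, embT_coe, emb_succ]

theorem convex_tube : Convex ℝ (tube d : Set (JC d)) := by
  have h : (tube d : Set (JC d)) = {z : JC d |
      ‖WithLp.toLp 2 (fun j : Fin (d + 1) => (z j.succ).im)‖ < (z 0).im} := by
    ext z
    change _ ↔ ‖WithLp.toLp 2 (fun j : Fin (d + 1) => (z j.succ).im)‖ < (z 0).im
    rw [SetLike.mem_coe, mem_tube_iff, EuclideanSpace.norm_eq]
    simp only [Real.norm_eq_abs, sq_abs]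
    constructor
    · rintro ⟨h1, h2⟩
      rw [Real.sqrt_lt' h2]
      linarith
    · intro h
      have h2 : 0 < (z 0).im := (Real.sqrt_nonneg _).trans_lt h
      rw [Real.sqrt_lt' h2] at h
      exact ⟨by linarith, h2⟩
  rw [h]
  intro x hx y hy a b ha hb hab
  simp only [mem_ofPred_eq] at hx hy ⊢
  have e : WithLp.toLp 2 (fun j : Fin (d + 1) => ((a • x + b • y) j.succ).im) =
      a • WithLp.toLp 2 (fun j : Fin (d + 1) => (x j.succ).im) +
      b • WithLp.toLp 2 (fun j : Fin (d + 1) => (y j.succ).im) := by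
    ext j
    simp
  rw [e]
  have e0 : ((a • x + b • y) 0).im = a * (x 0).im + b * (y 0).im := by simp
  rw [e0]
  refine (norm_add_le _ _).trans_lt ?_
  rw [norm_smul, norm_smul, Real.norm_of_nonneg ha, Real.norm_of_nonneg hb]
  rcases ha.eq_or_lt with rfl | ha'
  · rw [zero_add] at hab
    subst hab
    simpa using hy
  · exact add_lt_add_of_lt_of_le (mul_lt_mul_of_pos_left hx ha')
      (mul_le_mul_of_nonneg_left hy.le hb)

theorem isPreconnected_tube : IsPreconnected (tube d : Set (JC d)) := convex_tube.isPreconnected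

/-- The point `i` of the upper half-plane. -/
def iH : H := ⟨Complex.I, by change 0 < Complex.I.im; simp⟩

/-- Four values suffice: both variables run through i and 2i, and differences isolate the
coefficients. -/
theorem biaffine_eq_zero {c cu cv lam : ℂ}
    (h : ∀ w₁ w₂ : H, c + cu * (w₁ : ℂ) + cv * (w₂ : ℂ) + lam * ((w₁ : ℂ) * w₂) = 0) :
    c = 0 ∧ cu = 0 ∧ cv = 0 ∧ lam = 0 := by
  have hI : Complex.I * Complex.I = -1 := Complex.I_mul_I
  set j : H := ⟨2 * Complex.I, by change 0 < (2 * Complex.I).im; simp⟩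
  have h1 : c + cu * Complex.I + cv * Complex.I + lam * (Complex.I * Complex.I) = 0 := h iH iH
  have h2 : c + cu * (2 * Complex.I) + cv * Complex.I + lam * (2 * Complex.I * Complex.I) = 0 :=
    h j iH
  have h3 : c + cu * Complex.I + cv * (2 * Complex.I) + lam * (Complex.I * (2 * Complex.I)) = 0 :=
    h iH j
  have h4 : c + cu * (2 * Complex.I) + cv * (2 * Complex.I) +
    lam * (2 * Complex.I * (2 * Complex.I)) = 0 := h j j
  have hl : lam = 0 := by linear_combination -(h4 - h3 - h2 + h1) + lam * hI
  subst hl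
  have hu : cu * Complex.I = 0 := by linear_combination h2 - h1
  have hv : cv * Complex.I = 0 := by linear_combination h3 - h1
  refine ⟨by linear_combination h1 - hu - hv, ?_, ?_, rfl⟩
  · simpa using hu
  · simpa using hv

theorem affine_eq_zero {c cu : ℂ} (h : ∀ w : H, c + cu * (w : ℂ) = 0) : c = 0 ∧ cu = 0 := by
  have := biaffine_eq_zero (c := c) (cu := cu) (cv := 0) (lam := 0) fun w₁ w₂ => by
    simpa using h w₁
  exact ⟨this.1, this.2.1⟩

end Tube

/-! ### Explicit form of conformal maps preserving the plane -/

section Explicit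

variable {d : ℕ} {C : Conf (tube d) (tube d)} {h₁ h₂ : H → H} {ψ₁ ψ₂ : H → ℂ}

/-- The conformal map `C` restricts to a product map on `T_{Ω(c)}`. -/
structure Conf.Restricts (C : Conf (tube d) (tube d)) (h₁ h₂ : H → H) (ψ₁ ψ₂ : H → ℂ) : Prop where
  map : ∀ w₁ w₂ : H, C.h (embT d (w₁, w₂)) = embT d (h₁ w₁, h₂ w₂)
  ψ : ∀ w₁ w₂ : H, C.ψ (embT d (w₁, w₂)) = ψ₁ w₁ * ψ₂ w₂

namespace Conf.Restricts

theorem cpt_mem (hC : C.Restricts h₁ h₂ ψ₁ ψ₂) (k : Fin d) : C.cpt k.succ.succ ∈ planeIdeal (tube d) := by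
  intro z hz
  rw [← embT_proj hz, Conf.cpt_apply, ← Prod.mk.eta (p := proj z), hC.map]
  rw [embT_coe, emb_succ]

/-- The normal derivatives of the tangential components vanish on the plane. -/
theorem normal_dH (hC : C.Restricts h₁ h₂ ψ₁ ψ₂) (k : Fin d) {z : tube d}
    (hz : ∀ k : Fin d, (z : JC d) k.succ.succ = 0) : C.dH (ex k) 0 z = 0 ∧ C.dH (ex k) 1 z = 0 := by
  have hp : ∀ σ (l : Fin d), C.dH (eu σ) l.succ.succ z = 0 := fun σ l =>
    dd_mem_planeIdeal (fun _ => rfl) (hC.cpt_mem l) z hz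
  have hb : ∀ a b, bil (fun j => C.dH a j z) (fun j => C.dH b j z) = bil a b * C.ψ z ^ 2 :=
    fun a b => by
      rw [← Conf.bil_apply, Conf.bil_dH]
      rfl
  have h11 := hb (eu 1) (eu 1)
  have h22 := hb (eu (-1)) (eu (-1))
  have h12 := hb (eu 1) (eu (-1))
  have h1k := hb (eu 1) (ex k)
  have h2k := hb (eu (-1)) (ex k)
  rw [bil_eq] at h11 h22 h12 h1k h2k
  simp only [hp, mul_zero, zero_mul, Finset.sum_const_zero, sub_zero, bil_eu, bil_eu_ex]
    at h11 h22 h12 h1k h2k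
  norm_num at h11 h22 h12
  set p0 := C.dH (eu 1) 0 z
  set p1 := C.dH (eu 1) 1 z
  set q0 := C.dH (eu (-1)) 0 z
  set q1 := C.dH (eu (-1)) 1 z
  set y0 := C.dH (ex k) 0 z
  set y1 := C.dH (ex k) 1 z
  have hψ := C.ψ_ne_zero z
  -- The images of the two null directions are tangent to the plane, and their Gram determinant is
  -- minus the square of this determinant. So they span the tangent plane, and the image of a normal
  -- vector, being orthogonal to both, has no tangential part.
  have hdet : p0 * q1 - p1 * q0 ≠ 0 := by
    intro h0
    have h1 : (1 / 2 * C.ψ z ^ 2) ^ 2 = 0 := by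
      rw [← h12]
      linear_combination (p0 * q1 - p1 * q0) * h0 + (q0 * q0 - q1 * q1) * h11
    simp [hψ] at h1
  constructor
  · refine (mul_eq_zero.1 (?_ : (p0 * q1 - p1 * q0) * y0 = 0)).resolve_left hdet
    linear_combination q1 * h1k - p1 * h2k
  · refine (mul_eq_zero.1 (?_ : (p0 * q1 - p1 * q0) * y1 = 0)).resolve_left hdet
    linear_combination q0 * h1k - p0 * h2k

/-- In Koszul's formula for (u, v, x_k) the left side pairs the tangential vector ∂_u ∂_v H with the
normal vector ∂_{x_k} H, so it vanishes; the right side is a nonzero multiple of ψ ∂_{x_k} ψ. -/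
theorem normal_ρ (hC : C.Restricts h₁ h₂ ψ₁ ψ₂) (k : Fin d) {z : tube d}
    (hz : ∀ k : Fin d, (z : JC d) k.succ.succ = 0) : dd (ex k) C.ρ z = 0 := by
  have h1 := congrArg (fun f : holRing (tube d) => f z) (C.koszul (eu 1) (eu (-1)) (ex k))
  simp only [Conf.bil_apply] at h1
  have h2 : ∀ l : Fin d, dd (eu 1) (C.dH (eu (-1)) l.succ.succ) z = 0 := fun l =>
    dd_mem_planeIdeal (fun _ => rfl) (dd_mem_planeIdeal (fun _ => rfl) (hC.cpt_mem l)) z hz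
  rw [bil_eq] at h1
  simp only [h2, (hC.normal_dH k hz).1, (hC.normal_dH k hz).2, bil_eu, bil_eu_ex, zero_smul,
    zero_add, zero_sub, holRing_mul, holRing_neg, holRing_smul, mul_zero, zero_mul,
    Finset.sum_const_zero, sub_zero] at h1
  norm_num [C.ψ_ne_zero z] at h1
  rw [Conf.dd_ρ, holRing_neg, holRing_mul, h1]
  simp

/-- The functions ρ·H_l vanish on the plane, and comparing coefficients there kills everything
except the terms linear in x. Orthogonality is read off at a single point of the plane from
conformality, since there ρ ∂_{x_k} H_l = M l k. -/
theorem exists_matrix (hd : 2 ≤ d) (hC : C.Restricts h₁ h₂ ψ₁ ψ₂) :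
    ∃ M : Matrix (Fin d) (Fin d) ℂ, M.transpose * M = 1 ∧ ∀ (z : tube d) (l : Fin d),
      C.ρ z * (C.h z : JC d) l.succ.succ = ∑ k, M l k * (z : JC d) k.succ.succ := by
  choose c cu cv lam M hM hM' using fun l : Fin d =>
    (C.hessZero_ρH l.succ.succ).exists_eq hd isPreconnected_tube
  have h0 : ∀ l, c l = 0 ∧ cu l = 0 ∧ cv l = 0 ∧ lam l = 0 := fun l => by
    refine biaffine_eq_zero fun w₁ w₂ => ?_
    have h1 := hM l (embT d (w₁, w₂))
    have h2 : C.cpt l.succ.succ (embT d (w₁, w₂)) = 0 := hC.cpt_mem l _ fun _ => rfl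
    simp only [holRing_mul, h2, embT_coe, emb_zero, emb_one, emb_succ] at h1
    simp at h1
    linear_combination -h1
  refine ⟨Matrix.of M, ?_, fun z l => ?_⟩
  · ext i j
    rw [Matrix.mul_apply, Matrix.one_apply]
    set z := embT d (iH, iH)
    have hz : ∀ k : Fin d, (z : JC d) k.succ.succ = 0 := fun _ => rfl
    have h1 : ∀ k l, C.ρ z * C.dH (ex k) l.succ.succ z = M l k := fun k l => by
      have h2 := hM' l k z
      rw [Derivation.leibniz] at h2
      simp only [holRing_add, smul_eq_mul, holRing_mul, hC.normal_ρ k hz, hz, mul_zero, add_zero,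
        sub_zero] at h2
      exact h2
    have h3 := congrArg (fun f : holRing (tube d) => f z) (C.bil_dH (ex i) (ex j))
    simp only [Conf.bil_apply] at h3
    rw [bil_eq] at h3
    simp only [(hC.normal_dH i hz).1, (hC.normal_dH i hz).2, zero_mul, sub_zero, zero_sub, bil_ex,
      holRing_smul, holRing_pow] at h3
    have h4 : C.ρ z * C.ψ z = 1 := congrArg (fun f : holRing (tube d) => f z) C.ρψ
    have h5 : ∑ l, M l i * M l j = C.ρ z ^ 2 *
        ∑ k : Fin d, C.dH (ex i) k.succ.succ z * C.dH (ex j) k.succ.succ z := by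
      rw [Finset.mul_sum]
      refine Finset.sum_congr rfl fun l _ => ?_
      rw [← h1 i l, ← h1 j l]
      ring
    simp only [Matrix.transpose_apply, Matrix.of_apply]
    rw [h5]
    split_ifs at h3 ⊢ with hij
    · linear_combination -C.ρ z ^ 2 * h3 + (C.ρ z * C.ψ z + 1) * h4
    · linear_combination -C.ρ z ^ 2 * h3
  · have h1 := hM l z
    rw [(h0 l).1, (h0 l).2.1, (h0 l).2.2.1, (h0 l).2.2.2] at h1
    rw [holRing_mul, Conf.cpt_apply] at h1
    rw [h1]
    simp only [Matrix.of_apply]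
    ring

/-- A `HessZero` function whose normal derivatives vanish on the plane is determined by its
restriction to the plane. -/
theorem eq_of_plane (hd : 2 ≤ d) {f : holRing (tube d)} (hf : HessZero f)
    (hX : ∀ k : Fin d, dd (ex k) f (embT d (iH, iH)) = 0) :
    ∃ (c cu cv lam : ℂ), ∀ z : tube d, f z = c + cu * ((z : JC d) 0 + (z : JC d) 1) +
        cv * ((z : JC d) 0 - (z : JC d) 1) +
        lam * (((z : JC d) 0 + (z : JC d) 1) * ((z : JC d) 0 - (z : JC d) 1) -
          ∑ k : Fin d, (z : JC d) k.succ.succ ^ 2) := by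
  obtain ⟨c, cu, cv, lam, l, h1, h2⟩ := hf.exists_eq hd isPreconnected_tube
  have hl : ∀ k, l k = 0 := fun k => by
    have := h2 k (embT d (iH, iH))
    rw [hX, embT_coe, emb_succ] at this
    linear_combination -this
  refine ⟨c, cu, cv, lam, fun z => ?_⟩
  rw [h1]
  simp [hl]

theorem plane_apply {f : holRing (tube d)} {c cu cv lam : ℂ}
    (h : ∀ z : tube d, f z = c + cu * ((z : JC d) 0 + (z : JC d) 1) +
        cv * ((z : JC d) 0 - (z : JC d) 1) +
        lam * (((z : JC d) 0 + (z : JC d) 1) * ((z : JC d) 0 - (z : JC d) 1) -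
          ∑ k : Fin d, (z : JC d) k.succ.succ ^ 2)) (w₁ w₂ : H) :
    f (embT d (w₁, w₂)) = c + cu * w₁ + cv * w₂ + lam * (w₁ * w₂) := by
  rw [h]
  simp only [embT_coe, emb_zero, emb_one, emb_succ]
  simp
  ring

theorem hX (hC : C.Restricts h₁ h₂ ψ₁ ψ₂) (σ : ℂ) (k : Fin d) :
    dd (ex k) (C.ρ * (C.cpt 0 + σ • C.cpt 1)) (embT d (iH, iH)) = 0 := by
  have hz : ∀ k : Fin d, ((embT d (iH, iH) : tube d) : JC d) k.succ.succ = 0 := fun _ => rfl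
  have h1 : dd (ex k) (C.cpt 0) (embT d (iH, iH)) = 0 := (hC.normal_dH k hz).1
  have h2 : dd (ex k) (C.cpt 1) (embT d (iH, iH)) = 0 := (hC.normal_dH k hz).2
  rw [Derivation.leibniz, map_add, Derivation.map_smul]
  simp only [holRing_add, smul_eq_mul, holRing_mul, holRing_smul, hC.normal_ρ k hz, h1, h2]
  ring

/-- On the plane 1/ρ = ψ₁ψ₂, so the biaffine function ρ factors into affine functions, namely the
reciprocals of ψ₁ and ψ₂; the numerators factor likewise. Off the plane the only change is uv ↦ uv −
r in the bilinear term, because normal derivatives vanish on the plane. -/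
theorem explicit (hd : 2 ≤ d) (hC : C.Restricts h₁ h₂ ψ₁ ψ₂) :
    ∃ α₁ β₁ γ₁ δ₁ α₂ β₂ γ₂ δ₂ : ℂ, (∀ w : H, (γ₁ * w + δ₁) * ψ₁ w = 1) ∧
      (∀ w : H, (γ₂ * w + δ₂) * ψ₂ w = 1) ∧
      (∀ w : H, (h₁ w : ℂ) * (γ₁ * w + δ₁) = α₁ * w + β₁) ∧
      (∀ w : H, (h₂ w : ℂ) * (γ₂ * w + δ₂) = α₂ * w + β₂) ∧
      ∀ z : tube d, ∀ u v r : ℂ, u = (z : JC d) 0 + (z : JC d) 1 → v = (z : JC d) 0 - (z : JC d) 1 →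
        r = ∑ k : Fin d, (z : JC d) k.succ.succ ^ 2 →
        C.ρ z = (γ₁ * u + δ₁) * (γ₂ * v + δ₂) - γ₁ * γ₂ * r ∧
        C.ρ z * ((C.h z : JC d) 0 + (C.h z : JC d) 1) =
          (α₁ * u + β₁) * (γ₂ * v + δ₂) - α₁ * γ₂ * r ∧
        C.ρ z * ((C.h z : JC d) 0 - (C.h z : JC d) 1) =
          (γ₁ * u + δ₁) * (α₂ * v + β₂) - γ₁ * α₂ * r := by
  obtain ⟨c, cu, cv, lam, hρ⟩ := eq_of_plane hd C.hessZero_ρ fun k => hC.normal_ρ k fun _ => rfl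
  obtain ⟨c', cu', cv', lam', hu⟩ := eq_of_plane hd (f := C.ρ * (C.cpt 0 + (1 : ℂ) • C.cpt 1))
    (by rw [mul_add, mul_smul_comm]
        exact (C.hessZero_ρH 0).add ((C.hessZero_ρH 1).smul 1)) (hC.hX 1)
  obtain ⟨c'', cu'', cv'', lam'', hv⟩ := eq_of_plane hd (f := C.ρ * (C.cpt 0 + (-1 : ℂ) • C.cpt 1))
    (by rw [mul_add, mul_smul_comm]
        exact (C.hessZero_ρH 0).add ((C.hessZero_ρH 1).smul (-1))) (hC.hX (-1))
  have pρ := plane_apply hρ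
  have pu := plane_apply hu
  have pv := plane_apply hv
  have hρψ : ∀ w₁ w₂ : H, (c + cu * (w₁ : ℂ) + cv * w₂ + lam * (w₁ * w₂)) * (ψ₁ w₁ * ψ₂ w₂) = 1 :=
    fun w₁ w₂ => by
      rw [← pρ, ← hC.ψ]
      exact congrArg (fun f : holRing (tube d) => f (embT d (w₁, w₂))) C.ρψ
  have hne : ∀ w₁ w₂ : H, ψ₁ w₁ * ψ₂ w₂ ≠ 0 := fun w₁ w₂ h => by
    have := hρψ w₁ w₂
    rw [h] at this
    simp at this
  have hHu : ∀ w₁ w₂ : H, (C.cpt 0 + (1 : ℂ) • C.cpt 1) (embT d (w₁, w₂)) = (h₁ w₁ : ℂ) := by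
    intro w₁ w₂
    rw [holRing_add, holRing_smul, C.cpt_apply, C.cpt_apply, hC.map, embT_coe, emb_zero, emb_one]
    ring
  have hHv : ∀ w₁ w₂ : H, (C.cpt 0 + (-1 : ℂ) • C.cpt 1) (embT d (w₁, w₂)) = (h₂ w₂ : ℂ) := by
    intro w₁ w₂
    rw [holRing_add, holRing_smul, C.cpt_apply, C.cpt_apply, hC.map, embT_coe, emb_zero, emb_one]
    ring
  set i : ℂ := Complex.I
  set s₁ := ψ₁ iH
  set s₂ := ψ₂ iH
  -- The first affine factor is obtained by freezing the second variable at i and absorbing the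
  -- constant ψ₂(i); symmetrically for the second.
  have e1 : ∀ w : H, ((cu + lam * i) * s₂ * w + (c + cv * i) * s₂) * ψ₁ w = 1 := fun w => by
    have := hρψ w iH
    change (c + cu * (w : ℂ) + cv * i + lam * (w * i)) * (ψ₁ w * s₂) = 1 at this
    linear_combination this
  have e2 : ∀ w : H, ((cv + lam * i) * s₁ * w + (c + cu * i) * s₁) * ψ₂ w = 1 := fun w => by
    have := hρψ iH w
    change (c + cu * i + cv * (w : ℂ) + lam * (i * w)) * (s₁ * ψ₂ w) = 1 at this
    linear_combination this
  set γ₁ := (cu + lam * i) * s₂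
  set δ₁ := (c + cv * i) * s₂
  set γ₂ := (cv + lam * i) * s₁
  set δ₂ := (c + cu * i) * s₁
  have eρ : ∀ w₁ w₂ : H, C.ρ (embT d (w₁, w₂)) = (γ₁ * w₁ + δ₁) * (γ₂ * w₂ + δ₂) := fun w₁ w₂ => by
    refine mul_right_cancel₀ (hne w₁ w₂) ?_
    rw [pρ, hρψ]
    linear_combination -(e1 w₁) - (γ₁ * w₁ + δ₁) * ψ₁ w₁ * e2 w₂
  have e3 : ∀ w : H, (h₁ w : ℂ) * (γ₁ * w + δ₁) =
      (cu' + lam' * i) * s₂ * w + (c' + cv' * i) * s₂ := fun w => by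
    have h3 := pu w iH
    have h4 := e2 iH
    rw [holRing_mul, hHu, eρ] at h3
    change _ = c' + cu' * (w : ℂ) + cv' * i + lam' * (w * i) at h3
    change _ * s₂ = 1 at h4
    linear_combination s₂ * h3 - (h₁ w : ℂ) * (γ₁ * w + δ₁) * h4
  have e4 : ∀ w : H, (h₂ w : ℂ) * (γ₂ * w + δ₂) =
      (cv'' + lam'' * i) * s₁ * w + (c'' + cu'' * i) * s₁ := fun w => by
    have h3 := pv iH w
    have h4 := e1 iH
    rw [holRing_mul, hHv, eρ] at h3
    change _ = c'' + cu'' * i + cv'' * (w : ℂ) + lam'' * (i * w) at h3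
    change _ * s₁ = 1 at h4
    linear_combination s₁ * h3 - (h₂ w : ℂ) * (γ₂ * w + δ₂) * h4
  set α₁ := (cu' + lam' * i) * s₂
  set β₁ := (c' + cv' * i) * s₂
  set α₂ := (cv'' + lam'' * i) * s₁
  set β₂ := (c'' + cu'' * i) * s₁
  refine ⟨α₁, β₁, γ₁, δ₁, α₂, β₂, γ₂, δ₂, e1, e2, e3, e4, ?_⟩
  rintro z u v r hu' hv' hr'
  have b1 := biaffine_eq_zero (c := c - δ₁ * δ₂) (cu := cu - γ₁ * δ₂) (cv := cv - δ₁ * γ₂)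
    (lam := lam - γ₁ * γ₂) fun w₁ w₂ => by linear_combination eρ w₁ w₂ - pρ w₁ w₂
  have b2 := biaffine_eq_zero (c := c' - β₁ * δ₂) (cu := cu' - α₁ * δ₂) (cv := cv' - β₁ * γ₂)
    (lam := lam' - α₁ * γ₂) fun w₁ w₂ => by
      have h3 := pu w₁ w₂
      rw [holRing_mul, hHu, eρ] at h3
      linear_combination (γ₂ * w₂ + δ₂) * e3 w₁ - h3
  have b3 := biaffine_eq_zero (c := c'' - δ₁ * β₂) (cu := cu'' - γ₁ * β₂) (cv := cv'' - δ₁ * α₂)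
    (lam := lam'' - γ₁ * α₂) fun w₁ w₂ => by
      have h3 := pv w₁ w₂
      rw [holRing_mul, hHv, eρ] at h3
      linear_combination (γ₁ * w₁ + δ₁) * e4 w₂ - h3
  have h5 := hρ z
  have h6 := hu z
  have h7 := hv z
  rw [holRing_mul, holRing_add, holRing_smul, C.cpt_apply, C.cpt_apply] at h6 h7
  rw [← hu', ← hv', ← hr'] at h5 h6 h7
  refine ⟨?_, ?_, ?_⟩
  · linear_combination h5 + b1.1 + u * b1.2.1 + v * b1.2.2.1 + (u * v - r) * b1.2.2.2
  · linear_combination h6 + b2.1 + u * b2.2.1 + v * b2.2.2.1 + (u * v - r) * b2.2.2.2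
  · linear_combination h7 + b3.1 + u * b3.2.1 + v * b3.2.2.1 + (u * v - r) * b3.2.2.2

end Conf.Restricts
end Explicit

/-! ### The elementary maps on domains -/

section Model

variable {d : ℕ} {O O' : Opens (JC d)}

/-- The vector with light-cone coordinates `a, b` and normal part `x`. -/
def lightCone (τ a b : ℂ) (x : Fin d → ℂ) : JC d :=
  Fin.cons ((a + b) / 2) (Fin.cons (τ * (a - b) / 2) x)

theorem lightCone_zero (τ a b : ℂ) (x : Fin d → ℂ) : lightCone τ a b x 0 = (a + b) / 2 := rfl
theorem lightCone_one (τ a b : ℂ) (x : Fin d → ℂ) : lightCone τ a b x 1 = τ * (a - b) / 2 := rfl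
theorem lightCone_succ (τ a b : ℂ) (x : Fin d → ℂ) (k : Fin d) :
    lightCone τ a b x k.succ.succ = x k := rfl

/-- An elementary conformal map in coordinates; `b` stands for `1 / (γ u + δ)`. -/
def model (τ α β γ : ℂ) (M : Matrix (Fin d) (Fin d) ℂ) (z : JC d) (b : ℂ) : JC d :=
  lightCone τ ((α * (z 0 + τ * z 1) + β) * b)
    (z 0 - τ * z 1 - γ * ((∑ k : Fin d, z k.succ.succ ^ 2) * b))
    (fun l => ∑ k, M l k * (z k.succ.succ * b))

theorem hol_of_components {h : O → JC d} (f : Fin (d + 2) → holRing O)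
    (hf : ∀ z j, h z j = f j z) : Hol h := by
  refine (differentiableOn_pi.2 fun j => (f j).2 : DifferentiableOn ℂ (fun z j => ext (f j).1 z)
    O).congr fun z hz => ?_
  rw [show ext h z = h ⟨z, hz⟩ from ext_apply h ⟨z, hz⟩]
  funext j
  rw [hf]
  exact (ext_apply (f j).1 ⟨z, hz⟩).symm

theorem hol_model (τ α β γ : ℂ) (M : Matrix (Fin d) (Fin d) ℂ) (B : holRing O) :
    Hol (fun z : O => model τ α β γ M z (B z)) := by
  set p : holRing O := (α • (coord 0 + τ • coord 1) + algebraMap ℂ _ β) * B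
  set q : holRing O := coord 0 - τ • coord 1 - γ • ((∑ k : Fin d, coord k.succ.succ ^ 2) * B)
  refine hol_of_components (Fin.cons ((2⁻¹ : ℂ) • (p + q)) (Fin.cons ((τ / 2) • (p - q))
    fun l => ∑ k : Fin d, M l k • (coord k.succ.succ * B))) fun z j => ?_
  refine Fin.cases ?_ (fun j => Fin.cases ?_ (fun l => ?_) j) j
  · simp [p, q, model, lightCone]
    ring
  · simp [p, q, model, lightCone]
    ring
  · simp [model, lightCone]

theorem op_model (hd : 0 < d) {τ : ℂ} (hτ : τ * τ = 1) {α β γ δ : ℂ} (hdet : α * δ - β * γ = 1)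
    {M : Matrix (Fin d) (Fin d) ℂ} (hM : M.transpose * M = 1) {B : holRing O}
    (hB : ∀ z : O, (γ * ((z : JC d) 0 + τ * (z : JC d) 1) + δ) * B z = 1) (h : O → O')
    (hh : ∀ z, (h z : JC d) = model τ α β γ M z (B z)) (m p : ℕ) (f : holRing O') (g : holRing O)
    (hg : ∀ z, g z = B z ^ m * f (h z)) {z : O} (hz : ∀ k : Fin d, (z : JC d) k.succ.succ = 0) :
    (frame O τ).op m p g z = B z ^ (m + 2 * p) * (frame O' τ).op m p f (h z) := by
  have hol : Hol (fun z => (h z : JC d)) := by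
    simp only [hh]
    exact hol_model τ α β γ M B
  set e : Elem (frame O τ) (frame O' τ) := elemOfMap hτ h hol α β γ δ hdet M hM B hB
    (fun z => by
      rw [hh, model, lightCone_zero, lightCone_one]
      linear_combination ((α * ((z : JC d) 0 + τ * (z : JC d) 1) + β) * B z -
        ((z : JC d) 0 - τ * (z : JC d) 1 - γ * ((∑ k : Fin d, (z : JC d) k.succ.succ ^ 2) * B z)))
        / 2 * hτ)
    (fun z => by
      rw [hh, model, lightCone_zero, lightCone_one]
      linear_combination -((α * ((z : JC d) 0 + τ * (z : JC d) 1) + β) * B z -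
        ((z : JC d) 0 - τ * (z : JC d) 1 - γ * ((∑ k : Fin d, (z : JC d) k.succ.succ ^ 2) * B z)))
        / 2 * hτ)
    (fun z l => by rw [hh, model, lightCone_succ]) with he
  have h1 := e.op_φ hd m p f z hz
  have h2 : e.B ^ m * e.φ f = g := holRing_ext fun w => (hg w).symm
  rw [h2, holRing_sub, sub_eq_zero] at h1
  exact h1

/-- Exchanging u and v does not change the operator, so a Möbius map in v is handled by the same
elementary case with τ = −1. -/
theorem op_eq_op {τ σ : ℂ} (hτ : τ * τ = 1) (hσ : σ * σ = 1) (m p : ℕ) (f : holRing O) (z : O) :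
    (frame O τ).op m p f z = (frame O σ).op m p f z := by
  rw [← D_eq_op hτ, ← D_eq_op hσ]

theorem sum_sq_of_orthogonal {M : Matrix (Fin d) (Fin d) ℂ} (hM : M.transpose * M = 1)
    (x : Fin d → ℂ) : ∑ l, (∑ k, M l k * x k) ^ 2 = ∑ k, x k ^ 2 := by
  have h1 : ∀ y : Fin d → ℂ, ∑ k, y k ^ 2 = y ⬝ᵥ y := fun y => by simp only [dotProduct, sq]
  have h2 : ∀ l, ∑ k, M l k * x k = (M.mulVec x) l := fun l => rfl
  simp only [h2]
  rw [h1, h1, Matrix.dotProduct_mulVec, Matrix.vecMul_mulVec, hM, Matrix.vecMul_one]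

/-- Differentiate h(w)(γw + δ) = αw + β and multiply by γw + δ; as h′ = ψ² and ψ = 1/(γw + δ), the
first term becomes 1. -/
theorem det_eq_one {h : H → H} {ψ : H → ℂ} {α β γ δ : ℂ} (hol : Hol (val h))
    (hsq : der (val h) iH 1 = ψ iH ^ 2) (h1 : ∀ w : H, (γ * w + δ) * ψ w = 1)
    (h2 : ∀ w : H, (h w : ℂ) * (γ * w + δ) = α * w + β) : α * δ - β * γ = 1 := by
  have d1 : HasDerivAt (ext (val h)) (ψ iH ^ 2) (iH : ℂ) := hsq ▸ (hol.hasFDerivAt iH).hasDerivAt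
  have d2 : HasDerivAt (fun w : ℂ => γ * w + δ) γ (iH : ℂ) := by
    simpa using ((hasDerivAt_id (iH : ℂ)).const_mul γ).add_const δ
  have d3 : HasDerivAt (fun w : ℂ => α * w + β) α (iH : ℂ) := by
    simpa using ((hasDerivAt_id (iH : ℂ)).const_mul α).add_const β
  have d4 := d1.mul d2
  have e : (ext (val h) * fun w : ℂ => γ * w + δ) =ᶠ[𝓝 (iH : ℂ)] fun w => α * w + β := by
    filter_upwards [H.isOpen.mem_nhds iH.2] with w hw
    rw [Pi.mul_apply, show ext (val h) w = h ⟨w, hw⟩ from ext_apply (val h) ⟨w, hw⟩]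
    exact h2 ⟨w, hw⟩
  have h3 := d4.unique (d3.congr_of_eventuallyEq e)
  rw [show ext (val h) iH = h iH from ext_apply (val h) iH] at h3
  have h4 := h1 iH
  have h5 := h2 iH
  linear_combination (-(γ * (iH : ℂ) + δ)) * h3 + γ * h5 +
    ((γ * (iH : ℂ) + δ) * ψ iH + 1) * h4

end Model

/-! ### Factorization into two elementary maps and covariance -/

section Covariance

variable {d : ℕ} {C : Conf (tube d) (tube d)} {h₁ h₂ : H → H} {ψ₁ ψ₂ : H → ℂ}

/-- The map is k₁ ∘ k₂, where k₂ performs the Möbius map in v together with the rotation M, and k₁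
the Möbius map in u. The weights multiply to ψ since (γ₁u + δ₁) evaluated after k₂ equals ρ / (γ₂v +
δ₂). -/
theorem Conf.Restricts.op_eq (hd : 2 ≤ d) (hC : C.Restricts h₁ h₂ ψ₁ ψ₂) (hol₁ : Hol (val h₁))
    (hol₂ : Hol (val h₂)) (hs₁ : der (val h₁) iH 1 = ψ₁ iH ^ 2)
    (hs₂ : der (val h₂) iH 1 = ψ₂ iH ^ 2) (m p : ℕ) (f g : holRing (tube d))
    (hg : ∀ z, g z = C.ψ z ^ m * f (C.h z)) (w : H × H) :
    (frame (tube d) 1).op m p g (embT d w) = (ψ₁ w.1 * ψ₂ w.2) ^ (m + 2 * p) *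
      (frame (tube d) 1).op m p f (embT d (h₁ w.1, h₂ w.2)) := by
  obtain ⟨α₁, β₁, γ₁, δ₁, α₂, β₂, γ₂, δ₂, a1, a2, b1, b2, hz⟩ := hC.explicit hd
  obtain ⟨M, hM, hMx⟩ := hC.exists_matrix hd
  have det1 := det_eq_one hol₁ hs₁ a1 b1
  have det2 := det_eq_one hol₂ hs₂ a2 b2
  have hρψ : ∀ z, C.ρ z * C.ψ z = 1 := fun z =>
    congrArg (fun f : holRing (tube d) => f z) C.ρψ
  have hA2 : ∀ z : tube d, γ₂ * ((z : JC d) 0 - (z : JC d) 1) + δ₂ ≠ 0 := fun z h => by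
    have := a2 (proj z).2
    change (γ₂ * ((z : JC d) 0 - (z : JC d) 1) + δ₂) * _ = 1 at this
    rw [h] at this
    simp at this
  set A₂ : holRing (tube d) := γ₂ • (coord 0 - coord 1) + algebraMap ℂ _ δ₂ with hA₂
  have hA₂' : ∀ z : tube d, A₂ z = γ₂ * ((z : JC d) 0 - (z : JC d) 1) + δ₂ := fun z => rfl
  set B₂ : holRing (tube d) := ⟨fun z => (A₂ z)⁻¹, by
    refine hol_congr (A₂.2.inv fun z hz => ?_) fun z => ?_
    · rw [show ext A₂.1 z = A₂ ⟨z, hz⟩ from ext_apply A₂.1 ⟨z, hz⟩]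
      exact hA2 ⟨z, hz⟩
    · rw [Pi.inv_apply, ext_apply]⟩
  have hAB₂ : ∀ z, A₂ z * B₂ z = 1 := fun z => mul_inv_cancel₀ (hA2 z)
  clear_value B₂ A₂
  set a : JC d → ℂ := fun y => γ₁ * (y 0 + 1 * y 1) + δ₁
  set N : Set (JC d) := {y | a y ≠ 0}
  have hN : IsOpen N := isOpen_ne_fun (by fun_prop) continuous_const
  have hmod : ContinuousOn (fun y => model 1 α₁ β₁ γ₁ 1 y (a y)⁻¹) N := by
    have ha : ContinuousOn (fun y => (a y)⁻¹) N :=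
      ContinuousOn.inv₀ (by fun_prop) fun y hy => hy
    refine continuousOn_pi.2 fun j => ?_
    refine Fin.cases ?_ (fun j => Fin.cases ?_ (fun l => ?_) j) j
    · change ContinuousOn (fun y : JC d => ((α₁ * (y 0 + 1 * y 1) + β₁) * (a y)⁻¹ +
        (y 0 - 1 * y 1 - γ₁ * ((∑ k : Fin d, y k.succ.succ ^ 2) * (a y)⁻¹))) / 2) N
      fun_prop
    · change ContinuousOn (fun y : JC d => 1 * ((α₁ * (y 0 + 1 * y 1) + β₁) * (a y)⁻¹ -
        (y 0 - 1 * y 1 - γ₁ * ((∑ k : Fin d, y k.succ.succ ^ 2) * (a y)⁻¹))) / 2) N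
      fun_prop
    · change ContinuousOn (fun y : JC d => ∑ k : Fin d, (1 : Matrix (Fin d) (Fin d) ℂ) l k *
        (y k.succ.succ * (a y)⁻¹)) N
      fun_prop
  -- The matrix M is only known to be complex orthogonal, so k₂ need not visibly preserve the tube.
  -- The intermediate domain is therefore taken to be everything that k₁ maps into the tube; that k₂
  -- lands there follows from the composite being C.
  set O : Opens (JC d) := ⟨N ∩ (fun y => model 1 α₁ β₁ γ₁ 1 y (a y)⁻¹) ⁻¹' (tube d : Set (JC d)),
    hmod.isOpen_inter_preimage hN (tube d).isOpen⟩
  set B₁ : holRing O := ⟨fun y => (a y)⁻¹, by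
    refine hol_congr (F := fun y => (a y)⁻¹) ?_ fun z => rfl
    exact DifferentiableOn.inv (by fun_prop) fun y hy => hy.1⟩
  have hAB₁ : ∀ y : O, a y * B₁ y = 1 := fun y => mul_inv_cancel₀ y.2.1
  set k₁ : O → tube d := fun y => ⟨_, y.2.2⟩
  set y : tube d → JC d := fun z => model (-1) α₂ β₂ γ₂ M z (B₂ z) with hy
  have hya : ∀ z : tube d, a (y z) = C.ρ z * B₂ z := fun z => by
    rw [(hz z _ _ _ rfl rfl rfl).1]
    have := hAB₂ z
    rw [hA₂'] at this
    simp only [a, hy, model, lightCone_zero, lightCone_one]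
    linear_combination (-(γ₁ * ((z : JC d) 0 + (z : JC d) 1)) - δ₁) * this
  have hya0 : ∀ z : tube d, a (y z) ≠ 0 := fun z h => by
    have h3 : a (y z) * (C.ψ z * A₂ z) = 1 := by
      rw [hya]
      linear_combination hρψ z * (B₂ z * A₂ z) + hAB₂ z
    rw [h] at h3
    simp at h3
  have hyinv : ∀ z : tube d, (a (y z))⁻¹ = C.ψ z * A₂ z := fun z => by
    refine inv_eq_of_mul_eq_one_right ?_
    rw [hya]
    linear_combination hρψ z * (B₂ z * A₂ z) + hAB₂ z
  have hcomp : ∀ z : tube d, model 1 α₁ β₁ γ₁ 1 (y z) (a (y z))⁻¹ = C.h z := fun z => by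
    obtain ⟨c1, c2, c3⟩ := hz z _ _ _ rfl rfl rfl
    have c4 := hMx z
    have c5 := hρψ z
    have c6 := hAB₂ z
    have c7 := hA₂' z
    set u := (z : JC d) 0 + (z : JC d) 1
    set v := (z : JC d) 0 - (z : JC d) 1
    set r := ∑ k : Fin d, (z : JC d) k.succ.succ ^ 2 with hr
    have y1 : y z 0 + 1 * y z 1 = u - γ₂ * (r * B₂ z) := by
      simp only [hy, model, lightCone_zero, lightCone_one, u]
      ring
    have y2 : y z 0 - 1 * y z 1 = (α₂ * v + β₂) * B₂ z := by
      simp only [hy, model, lightCone_zero, lightCone_one, v]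
      ring
    have y3 : ∀ l : Fin d, y z l.succ.succ = (∑ k, M l k * (z : JC d) k.succ.succ) * B₂ z :=
      fun l => by
        simp only [hy, model, lightCone_succ, Finset.sum_mul, mul_assoc]
    have y4 : ∑ l : Fin d, y z l.succ.succ ^ 2 = r * B₂ z ^ 2 := by
      simp only [y3, mul_pow]
      rw [← Finset.sum_mul, sum_sq_of_orthogonal hM fun k => (z : JC d) k.succ.succ]
    have g1 : (α₁ * (y z 0 + 1 * y z 1) + β₁) * (a (y z))⁻¹ =
        (C.h z : JC d) 0 + (C.h z : JC d) 1 := by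
      rw [y1, hyinv]
      linear_combination (-C.ψ z) * c2 + ((C.h z : JC d) 0 + (C.h z : JC d) 1) * c5 -
        α₁ * γ₂ * r * C.ψ z * c6 + (C.ψ z * (α₁ * u + β₁)) * c7
    have g2 : y z 0 - 1 * y z 1 - γ₁ * ((∑ k : Fin d, y z k.succ.succ ^ 2) * (a (y z))⁻¹) =
        (C.h z : JC d) 0 - (C.h z : JC d) 1 := by
      rw [y2, y4, hyinv]
      -- After clearing ρ and A₂, the r-terms differ by γ₁ r (α₂δ₂ − β₂γ₂ − 1), which is where the
      -- determinant of the second Möbius map enters.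
      refine mul_left_cancel₀ (mul_ne_zero (left_ne_zero_of_mul_eq_one c5)
        (left_ne_zero_of_mul_eq_one c6)) ?_
      linear_combination (C.ρ z * (α₂ * v + β₂)) * c6 - γ₁ * r * ((A₂ z * B₂ z) ^ 2 * c5 +
        (A₂ z * B₂ z + 1) * c6) + (α₂ * v + β₂) * c1 - A₂ z * c3 -
        ((γ₁ * u + δ₁) * (α₂ * v + β₂) - γ₁ * α₂ * r) * c7 + γ₁ * r * det2
    refine vec_ext ?_ ?_ fun l => ?_
    · rw [model, lightCone_zero, g1, g2]
      ring
    · rw [model, lightCone_one, g1, g2]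
      ring
    · rw [model, lightCone_succ]
      simp only [Matrix.one_apply, ite_mul, one_mul, zero_mul, Finset.sum_ite_eq, Finset.mem_univ,
        if_true]
      rw [y3, hyinv]
      linear_combination (-C.ψ z) * c4 l + (C.h z : JC d) l.succ.succ * c5 +
        (∑ k, M l k * (z : JC d) k.succ.succ) * C.ψ z * c6
  set k₂ : tube d → O := fun z => ⟨y z, hya0 z, by
    change model 1 α₁ β₁ γ₁ 1 (y z) (a (y z))⁻¹ ∈ tube d
    rw [hcomp]
    exact (C.h z).2⟩
  have hk : ∀ z, k₁ (k₂ z) = C.h z := fun z => Subtype.ext (hcomp z)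
  have hBψ : ∀ z, B₂ z * B₁ (k₂ z) = C.ψ z := fun z => by
    change B₂ z * (a (y z))⁻¹ = _
    rw [hyinv]
    linear_combination C.ψ z * hAB₂ z
  have hk₁ : Hol (fun z => (k₁ z : JC d)) := hol_model 1 α₁ β₁ γ₁ 1 B₁
  set f₁ : holRing O := B₁ ^ m * holPull k₁ hk₁ f
  have hd' : 0 < d := by omega
  have n1 : (-1 : ℂ) * -1 = 1 := by norm_num
  have s2 := op_model hd' n1 det2 hM (B := B₂) (fun z => by
      have := hAB₂ z
      rw [hA₂'] at this
      linear_combination this) k₂ (fun z => rfl) m p f₁ g (fun z => by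
      rw [hg, holRing_mul, holRing_pow, holPull_apply, hk, ← hBψ]
      ring) (z := embT d w) fun k => rfl
  have s1 := op_model hd' (one_mul 1) det1 (M := 1) (by simp) (B := B₁) hAB₁ k₁ (fun z => rfl)
    m p f f₁ (fun z => rfl) (z := k₂ (embT d w)) fun k => by
      change ∑ l, M k l * (emb d w.1 w.2 l.succ.succ * B₂ (embT d w)) = 0
      simp only [emb_succ]
      simp
  rw [op_eq_op (one_mul 1) n1, s2, op_eq_op n1 (one_mul 1), s1, hk, ← mul_assoc, ← mul_pow, hBψ]
  have e1 := hC.ψ w.1 w.2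
  have e2 := hC.map w.1 w.2
  rw [Prod.mk.eta] at e1 e2
  rw [e1, e2]

theorem ne_zero_hol_inv {T : Opens (JC d)} {ψ : T → ℂ} (h : Hol ψ) (h0 : ∀ z, ψ z ≠ 0) :
    Hol (fun z => (ψ z)⁻¹) := by
  refine hol_congr (h.inv fun z hz => ?_) fun z => ?_
  · rw [show ext ψ z = ψ ⟨z, hz⟩ from ext_apply ψ ⟨z, hz⟩]
    exact h0 _
  · rw [Pi.inv_apply, ext_apply]

/-- The conformal map underlying an element of the double covering. -/
def Cover.conf (g : Cover (tube d) jdetC) : Conf (tube d) (tube d) where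
  h := g.toAut.1
  hol := g.toAut.2.1
  ψ := ⟨g.ψ, g.hol⟩
  ρ := ⟨fun z => (g.ψ z)⁻¹, ne_zero_hol_inv g.hol g.ne_zero⟩
  ρψ := holRing_ext fun z => inv_mul_cancel₀ (g.ne_zero z)
  sq := g.sq

/-- Needed because the representations act through g⁻¹. -/
theorem IsRestriction.inv {g : Cover (tube d) jdetC} {g₁ g₂ : Cover H (id : ℂ → ℂ)}
    (h : IsRestriction g g₁ g₂) : IsRestriction g⁻¹ g₁⁻¹ g₂⁻¹ := by
  intro w₁ w₂
  obtain ⟨h1, h2⟩ := h (g₁.toAut.1.symm w₁) (g₂.toAut.1.symm w₂)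
  rw [Homeomorph.apply_symm_apply, Homeomorph.apply_symm_apply] at h1
  have h3 : g.toAut.1.symm (embT d (w₁, w₂)) =
      embT d (g₁.toAut.1.symm w₁, g₂.toAut.1.symm w₂) := by
    rw [← h1, Homeomorph.symm_apply_apply]
  refine ⟨h3, ?_⟩
  change (g.ψ (g.toAut.1.symm (embT d (w₁, w₂))))⁻¹ = _
  rw [h3, h2, mul_inv]
  rfl

theorem Cover.sq_one (g : Cover H (id : ℂ → ℂ)) (w : H) : der (val g.toAut.1) w 1 = g.ψ w ^ 2 := by
  have := g.sq w 1
  simpa using this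

theorem covariance (hd : 2 ≤ d) (m p : ℕ) {g : Cover (tube d) jdetC} {g₁ g₂ : Cover H (id : ℂ → ℂ)}
    (h : IsRestriction g g₁ g₂) {F : tube d → ℂ} (hF : Hol F) :
    res (D d m p (rep m g F)) = repTensor (m + 2 * p) (m + 2 * p) g₁ g₂ (res (D d m p F)) := by
  funext w
  have hr := h.inv
  set C := (g⁻¹).conf
  have hC : C.Restricts (g₁⁻¹).toAut.1 (g₂⁻¹).toAut.1 (g₁⁻¹).ψ (g₂⁻¹).ψ :=
    ⟨fun w₁ w₂ => (hr w₁ w₂).1, fun w₁ w₂ => (hr w₁ w₂).2⟩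
  set f : holRing (tube d) := ⟨F, hF⟩
  set G : holRing (tube d) := C.ψ ^ m * holPull C.h C.hol f
  have key := hC.op_eq hd (g₁⁻¹).toAut.2.1 (g₂⁻¹).toAut.2.1 ((g₁⁻¹).sq_one _) ((g₂⁻¹).sq_one _)
    m p f G (fun _ => rfl) w
  rw [← D_eq_op (one_mul 1), ← D_eq_op (one_mul 1), mul_pow] at key
  exact key

end Covariance

/-! ### Schwarz–Pick for the half-plane -/

section Pick

/-- The Schwarz–Pick inequality at the centre of a disc. -/
theorem norm_deriv_le_two_mul_im {f : ℂ → ℂ} (hf : DifferentiableOn ℂ f (ball 0 1))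
    (him : ∀ t ∈ ball (0 : ℂ) 1, 0 < (f t).im) : ‖deriv f 0‖ ≤ 2 * (f 0).im := by
  have h0 : (0 : ℂ) ∈ ball (0 : ℂ) 1 := mem_ball_self one_pos
  have hne : ∀ t ∈ ball (0 : ℂ) 1, f t - conj (f 0) ≠ 0 := fun t ht h => by
    have h1 := congrArg Complex.im h
    rw [Complex.sub_im, Complex.conj_im, Complex.zero_im] at h1
    linarith [him t ht, him 0 h0]
  have h1 : ‖deriv (fun t => (f t - f 0) / (f t - conj (f 0))) 0‖ ≤ 1 := by
    refine Complex.norm_deriv_le_one_of_mapsTo_ball (R := 1)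
      ((hf.sub_const _).div (hf.sub_const _) hne) (fun t ht => ?_) one_pos
    rw [sub_self, zero_div, mem_closedBall_zero_iff, norm_div]
    refine div_le_one_of_le₀ ?_ (norm_nonneg _)
    rw [← sq_le_sq₀ (norm_nonneg _) (norm_nonneg _), ← Complex.normSq_eq_norm_sq,
      ← Complex.normSq_eq_norm_sq, Complex.normSq_apply, Complex.normSq_apply]
    simp only [Complex.sub_re, Complex.sub_im, Complex.conj_re, Complex.conj_im]
    nlinarith [mul_pos (him t ht) (him 0 h0)]
  have h2 : HasDerivAt f (deriv f 0) 0 :=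
    ((hf 0 h0).differentiableAt (isOpen_ball.mem_nhds h0)).hasDerivAt
  have h3 := (h2.sub_const (f 0)).fun_div (h2.sub_const (conj (f 0))) (hne 0 h0)
  have h4 : (deriv f 0 * (f 0 - conj (f 0)) - (f 0 - f 0) * deriv f 0) / (f 0 - conj (f 0)) ^ 2 =
      deriv f 0 / (f 0 - conj (f 0)) := by
    have := hne 0 h0
    field_simp
    ring
  rw [h3.deriv, h4, norm_div, div_le_one (norm_pos_iff.2 (hne 0 h0)), Complex.sub_conj] at h1
  refine h1.trans_eq ?_
  rw [norm_mul, Complex.norm_I, mul_one, Complex.norm_real, Real.norm_of_nonneg]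
  linarith [him 0 h0]

/-- A biholomorphic map of the unit disc onto the upper half-plane which sends `0` to `w`. -/
def cayley (w t : ℂ) : ℂ := w + (w - conj w) * (t / (1 - t))

theorem cayley_zero (w : ℂ) : cayley w 0 = w := by simp [cayley]

theorem one_sub_ne_zero_of_norm_lt {t : ℂ} (ht : ‖t‖ < 1) : 1 - t ≠ 0 := fun h => by
  rw [sub_eq_zero] at h
  rw [← h] at ht
  simp at ht

theorem hasDerivAt_cayley (w : ℂ) {t : ℂ} (ht : ‖t‖ < 1) :
    HasDerivAt (cayley w) ((w - conj w) / (1 - t) ^ 2) t := by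
  have h1 := (hasDerivAt_id t).fun_div ((hasDerivAt_id t).const_sub 1) (one_sub_ne_zero_of_norm_lt ht)
  have h2 := (h1.const_mul (w - conj w)).const_add w
  simp only [id] at h2
  refine h2.congr_deriv ?_
  ring

theorem cayley_mem {w : ℂ} (hw : w ∈ H) {t : ℂ} (ht : ‖t‖ < 1) : cayley w t ∈ H := by
  have hw' : 0 < w.im := hw
  change 0 < (cayley w t).im
  have h1 : 0 < Complex.normSq (1 - t) := Complex.normSq_pos.2 (one_sub_ne_zero_of_norm_lt ht)
  have h2 : t.re * t.re + t.im * t.im < 1 := by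
    rw [← Complex.normSq_apply, Complex.normSq_eq_norm_sq]
    nlinarith [norm_nonneg t]
  have h3 : (cayley w t).im =
      w.im * (1 - (t.re * t.re + t.im * t.im)) / Complex.normSq (1 - t) := by
    rw [cayley, Complex.sub_conj, Complex.add_im, mul_assoc, Complex.im_ofReal_mul,
      Complex.I_mul_im, Complex.div_re]
    rw [eq_div_iff h1.ne']
    field_simp
    rw [Complex.normSq_apply]
    simp only [Complex.sub_re, Complex.sub_im, Complex.one_re, Complex.one_im]
    ring
  rw [h3]
  have : 0 < 1 - (t.re * t.re + t.im * t.im) := by linarith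
  positivity

theorem exists_phase (X : ℂ) : ∃ a : ℂ, ‖a‖ ≤ 1 ∧ X * a = ‖X‖ := by
  refine ⟨conj X / ‖X‖, ?_, ?_⟩
  · rw [norm_div, Complex.norm_conj, Complex.norm_real, norm_norm]
    exact div_self_le_one _
  · by_cases h : X = 0
    · simp [h]
    · have : (‖X‖ : ℂ) ≠ 0 := by simpa using h
      rw [← mul_div_assoc, Complex.mul_conj, Complex.normSq_eq_norm_sq]
      push_cast
      field_simp

end Pick

/-! ### Coordinates of the plane and a Schwarz–Pick inequality in two variables -/

section Plane

variable {d : ℕ}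

/-- The sign in the light-cone coordinate `z₀ ± z₁`. -/
def sgn (σ : Bool) : ℂ := if σ then 1 else -1

theorem sgn_not (σ : Bool) : sgn (!σ) = -sgn σ := by cases σ <;> simp [sgn]

theorem sgn_mul_self (σ : Bool) : sgn σ * sgn σ = 1 := by cases σ <;> simp [sgn]

/-- The point of the plane with prescribed light-cone coordinates. -/
def ins (σ : Bool) (w c : H) : tube d := if σ then embT d (w, c) else embT d (c, w)

/-- The light-cone coordinates of a point. -/
def out (σ : Bool) (z : tube d) : H := if σ then (proj z).1 else (proj z).2

theorem ins_not (σ : Bool) (w c : H) : (ins (!σ) w c : tube d) = ins σ c w := by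
  cases σ <;> rfl

theorem emb_eq (w c : ℂ) : emb d w c = w • eu 1 + c • eu (-1) :=
  vec_ext (by simp [emb_zero]; ring) (by simp [emb_one]; ring) fun k => by simp [emb_succ]

theorem ins_coe (σ : Bool) (w c : H) :
    ((ins σ w c : tube d) : JC d) = (w : ℂ) • eu (sgn σ) + (c : ℂ) • eu (-sgn σ) := by
  cases σ
  · change emb d c w = _
    rw [emb_eq]
    simp only [sgn, Bool.false_eq_true, if_false, neg_neg]
    rw [add_comm]
  · exact emb_eq _ _

theorem out_coe (σ : Bool) (z : tube d) : (out σ z : ℂ) = (z : JC d) 0 + sgn σ * (z : JC d) 1 := by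
  cases σ
  · change (z : JC d) 0 - (z : JC d) 1 = _
    simp only [sgn, Bool.false_eq_true, if_false]
    ring
  · change (z : JC d) 0 + (z : JC d) 1 = _
    simp [sgn]

theorem ins_succ (σ : Bool) (w c : H) (k : Fin d) : ((ins σ w c : tube d) : JC d) k.succ.succ = 0 := by
  cases σ <;> rfl

theorem out_ins (σ : Bool) (w c : H) : out σ (ins σ w c : tube d) = w := by
  cases σ
  · exact congrArg Prod.snd (proj_embT (c, w))
  · exact congrArg Prod.fst (proj_embT (w, c))

theorem out_not_ins (σ : Bool) (w c : H) : out (!σ) (ins σ w c : tube d) = c := by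
  rw [← ins_not, out_ins]

theorem ins_out (σ : Bool) {z : tube d} (hz : ∀ k : Fin d, (z : JC d) k.succ.succ = 0) :
    ins σ (out σ z) (out (!σ) z) = z := by
  cases σ <;> exact embT_proj hz

theorem mem_range_embT {z : tube d} :
    z ∈ range (embT d) ↔ ∀ k : Fin d, (z : JC d) k.succ.succ = 0 :=
  ⟨fun ⟨_, hw⟩ k => by rw [← hw]; rfl, fun h => ⟨proj z, embT_proj h⟩⟩

/-- The light-cone coordinates as holomorphic functions. -/
def outF (σ : Bool) : holRing (tube d) := coord 0 + sgn σ • coord 1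

theorem outF_apply (σ : Bool) (z : tube d) : outF σ z = out σ z := (out_coe σ z).symm

theorem continuous_holRing {T : Opens (JC d)} (f : holRing T) : Continuous fun z => f z :=
  (f.2.continuousOn.domRestrict).congr fun z => ext_apply f.1 z

theorem continuous_out (σ : Bool) : Continuous (out σ : tube d → H) := by
  refine Continuous.subtype_mk (f := fun z : tube d => (out σ z : ℂ)) ?_ _
  simp only [← outF_apply]
  exact continuous_holRing _

theorem continuous_ins (σ : Bool) : Continuous fun w : H × H => (ins σ w.1 w.2 : tube d) := by
  refine Continuous.subtype_mk (f := fun w : H × H => ((ins σ w.1 w.2 : tube d) : JC d)) ?_ _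
  simp only [ins_coe]
  fun_prop

theorem hasDerivAt_holRing {F : holRing (tube d)} {γ : ℂ → JC d} {v : JC d} {t : ℂ} {z : tube d}
    (hγ : HasDerivAt γ v t) (hz : γ t = z) :
    HasDerivAt (fun s => ext F.1 (γ s)) (dd v F z) t := by
  have := F.2.hasFDerivAt z
  rw [← hz] at this
  exact this.comp_hasDerivAt t hγ

/-- Map the disc into the plane by Cayley maps centred at w and c, rotated by unimodular (or zero)
phases that align the two partial derivatives. The one-variable inequality at the centre then bounds
the sum of their moduli, as each Cayley map has derivative 2i times the imaginary part there. -/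
theorem pick_bound (F : holRing (tube d)) (hF : ∀ z, 0 < (F z).im) (σ : Bool) (w c : H) :
    ‖dd (eu (sgn σ)) F (ins σ w c)‖ * (w : ℂ).im + ‖dd (eu (-sgn σ)) F (ins σ w c)‖ * (c : ℂ).im ≤
      (F (ins σ w c)).im := by
  have hw : 0 < (w : ℂ).im := w.2
  have hc : 0 < (c : ℂ).im := c.2
  obtain ⟨a, ha, hXa⟩ := exists_phase (dd (eu (sgn σ)) F (ins σ w c))
  obtain ⟨b, hb, hYb⟩ := exists_phase (dd (eu (-sgn σ)) F (ins σ w c))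
  have hab : ∀ a : ℂ, ‖a‖ ≤ 1 → ∀ t ∈ ball (0 : ℂ) 1, ‖a * t‖ < 1 := fun a ha t ht => by
    rw [norm_mul]
    rw [mem_ball_zero_iff] at ht
    nlinarith [norm_nonneg t, norm_nonneg a]
  set γ : ℂ → JC d := fun t => cayley w (a * t) • eu (sgn σ) + cayley c (b * t) • eu (-sgn σ)
  have hγz : ∀ t ∈ ball (0 : ℂ) 1, ∃ z : tube d, γ t = z := fun t ht =>
    ⟨ins σ ⟨_, cayley_mem w.2 (hab a ha t ht)⟩ ⟨_, cayley_mem c.2 (hab b hb t ht)⟩,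
      by rw [ins_coe]⟩
  have hγ' : ∀ t ∈ ball (0 : ℂ) 1, HasDerivAt γ
      (((w - conj (w : ℂ)) / (1 - a * t) ^ 2 * a) • eu (sgn σ) +
        ((c - conj (c : ℂ)) / (1 - b * t) ^ 2 * b) • eu (-sgn σ)) t := fun t ht => by
    have h1 := (hasDerivAt_cayley w (hab a ha t ht)).comp t ((hasDerivAt_id t).const_mul a)
    have h2 := (hasDerivAt_cayley c (hab b hb t ht)).comp t ((hasDerivAt_id t).const_mul b)
    simp only [mul_one] at h1 h2
    exact (h1.smul_const _).add (h2.smul_const _)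
  have h0 : (0 : ℂ) ∈ ball (0 : ℂ) 1 := mem_ball_self one_pos
  have hz0 : γ 0 = (ins σ w c : tube d) := by
    simp only [γ, mul_zero, cayley_zero, ins_coe]
  have key := norm_deriv_le_two_mul_im (f := fun t => ext F.1 (γ t)) (fun t ht => by
      obtain ⟨z, hz⟩ := hγz t ht
      exact (hasDerivAt_holRing (hγ' t ht) hz).differentiableAt.differentiableWithinAt)
    (fun t ht => by
      obtain ⟨z, hz⟩ := hγz t ht
      simp only [hz, ext_apply]
      exact hF z)
  rw [(hasDerivAt_holRing (hγ' 0 h0) hz0).deriv] at key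
  simp only [hz0, ext_apply, dd_add, dd_smul, Derivation.add_apply, Derivation.smul_apply,
    holRing_add, holRing_smul, mul_zero, sub_zero, one_pow, div_one, Complex.sub_conj] at key
  have e : ((2 * (w : ℂ).im : ℝ) : ℂ) * Complex.I * a * dd (eu (sgn σ)) F (ins σ w c) +
      ((2 * (c : ℂ).im : ℝ) : ℂ) * Complex.I * b * dd (eu (-sgn σ)) F (ins σ w c) =
      ((2 * (‖dd (eu (sgn σ)) F (ins σ w c)‖ * (w : ℂ).im +
        ‖dd (eu (-sgn σ)) F (ins σ w c)‖ * (c : ℂ).im) : ℝ) : ℂ) * Complex.I := by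
    push_cast
    linear_combination (2 * ((w : ℂ).im : ℂ) * Complex.I) * hXa +
      (2 * ((c : ℂ).im : ℂ) * Complex.I) * hYb
  rw [e, norm_mul, Complex.norm_I, mul_one, Complex.norm_real, Real.norm_of_nonneg (by positivity)]
    at key
  exact le_of_mul_le_mul_left key two_pos

/-- A weighted sum with total weight at most 1 can reach 1 only if some entry is at least 1. Thus
each column has an entry at least 1, the bound on row sums puts these entries in different rows, and
forces the remaining entries to vanish. -/
theorem monomial_of_bounds {a b c e α β γ δ : ℝ} (ha : 0 ≤ a) (hb : 0 ≤ b) (hc : 0 ≤ c)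
    (he : 0 ≤ e) (hα : 0 ≤ α) (hβ : 0 ≤ β) (hγ : 0 ≤ γ) (hδ : 0 ≤ δ) (h1 : a + b ≤ 1)
    (h2 : c + e ≤ 1) (h3 : α + β ≤ 1) (h4 : γ + δ ≤ 1) (h5 : 1 ≤ α * a + β * c)
    (h6 : 1 ≤ γ * b + δ * e) : (b = 0 ∧ c = 0) ∨ (a = 0 ∧ e = 0) := by
  have key : ∀ {x y μ ν : ℝ}, 0 ≤ x → 0 ≤ y → 0 ≤ μ → 0 ≤ ν → μ + ν ≤ 1 → 1 ≤ μ * x + ν * y →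
      1 ≤ x ∨ 1 ≤ y := fun {x y μ ν} hx hy hμ hν h h' => by
    by_contra! hh
    obtain ⟨h7, h8⟩ := hh
    rcases hμ.eq_or_lt with rfl | hμ'
    · nlinarith
    · nlinarith
  rcases key ha hc hα hβ h3 h5 with h | h
  · rcases key hb he hγ hδ h4 h6 with h' | h'
    · linarith
    · exact Or.inl ⟨by linarith, by linarith⟩
  · rcases key hb he hγ hδ h4 h6 with h' | h'
    · exact Or.inr ⟨by linarith, by linarith⟩
    · linarith

end Plane

theorem _root_.IsPreconnected.subset_or_subset_of_isClosed {α : Type*} [TopologicalSpace α]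
    {S X Y : Set α} (hS : IsPreconnected S) (hX : IsClosed X) (hY : IsClosed Y)
    (hXY : ∀ s ∈ S, s ∈ X ∨ s ∈ Y) (hd : ∀ s ∈ S, s ∈ X → s ∉ Y) : S ⊆ X ∨ S ⊆ Y :=
  isPreconnected_iff_subset_of_disjoint_closed.1 hS X Y hX hY hXY
    (eq_empty_iff_forall_notMem.2 fun s hs => hd s hs.1 hs.2.1 hs.2.2)

instance : PreconnectedSpace H :=
  Subtype.preconnectedSpace (convex_halfSpace_im_gt 0).isPreconnected

/-! ### The Jacobian along the plane is monomial -/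

section Jacobian

variable {d : ℕ} {g g' : tube d → tube d}

/-- Pullback of holomorphic functions along a holomorphic self-map. -/
def pull (hg : Hol (val g)) : holRing (tube d) →ₐ[ℂ] holRing (tube d) :=
  holPull g (show Hol (fun z => (g z : JC d)) from hg)

theorem pull_apply (hg : Hol (val g)) (f : holRing (tube d)) (z : tube d) :
    pull hg f z = f (g z) := rfl

theorem dd_pull_apply (hg : Hol (val g)) (f : holRing (tube d)) (a : JC d) (z : tube d) :
    dd a (pull hg f) z = dd (der (val g) z a) f (g z) := dd_holPull_apply g _ f a z

theorem hol_aut {T : Opens (JC d)} (g : Aut T) : Hol (val g.1) := g.2.1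

theorem hol_aut_symm {T : Opens (JC d)} (g : Aut T) : Hol (val g.1.symm) := g.2.2

/-- The entries of the Jacobian matrix in light-cone coordinates along the plane. -/
def jac (hg : Hol (val g)) (σ σ' : Bool) : holRing (tube d) :=
  dd (eu (sgn σ')) (pull hg (outF σ))

theorem jac_eq (hg : Hol (val g)) (σ σ' : Bool) (z : tube d) :
    jac hg σ σ' z = der (val g) z (eu (sgn σ')) 0 + sgn σ * der (val g) z (eu (sgn σ')) 1 := by
  rw [jac, dd_pull_apply, outF, map_add, Derivation.map_smul, dd_coord, dd_coord]
  rfl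

theorem der_eu (hg : Hol (val g)) (hm : MapsTo g (range (embT d)) (range (embT d))) {z : tube d}
    (hz : z ∈ range (embT d)) (σ σ' : Bool) : der (val g) z (eu (sgn σ')) =
      jac hg σ σ' z • eu (sgn σ) + jac hg (!σ) σ' z • eu (sgn (!σ)) := by
  have h1 : ∀ k : Fin d, der (val g) z (eu (sgn σ')) k.succ.succ = 0 := fun k => by
    have h2 : pull hg (coord k.succ.succ) ∈ planeIdeal (tube d) := fun z hz =>
      mem_range_embT.1 (hm (mem_range_embT.2 hz)) k
    have h3 := dd_mem_planeIdeal (a := eu (sgn σ')) (fun _ => rfl) h2 z (mem_range_embT.1 hz)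
    rwa [dd_pull_apply, dd_coord] at h3
  rw [jac_eq, jac_eq, sgn_not]
  conv_lhs => rw [vec_eq (sgn_mul_self σ) (der (val g) z (eu (sgn σ')))]
  simp only [h1, zero_smul, Finset.sum_const_zero, add_zero]
  module

/-- The chain rule for g′ ∘ g = id; the right side is the Kronecker delta of the two signs. Only g
has to preserve the plane. -/
theorem jac_mul (hg : Hol (val g)) (hg' : Hol (val g')) (hgg : ∀ z, g' (g z) = z)
    (hm : MapsTo g (range (embT d)) (range (embT d))) {z : tube d} (hz : z ∈ range (embT d))
    (σ τ : Bool) : jac hg' σ σ (g z) * jac hg σ τ z + jac hg' σ (!σ) (g z) * jac hg (!σ) τ z =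
      (1 + sgn σ * sgn τ) / 2 := by
  have h1 : pull hg (pull hg' (outF σ)) = outF σ := holRing_ext fun z => by
    rw [pull_apply, pull_apply, hgg]
  have h2 := congrArg (fun f : holRing (tube d) => dd (eu (sgn τ)) f z) h1
  rw [dd_pull_apply] at h2
  have h3 : dd (eu (sgn τ)) (outF σ) z = (1 + sgn σ * sgn τ) / 2 := by
    rw [outF, map_add, Derivation.map_smul, dd_coord, dd_coord]
    simp
    ring
  rw [h3, der_eu hg hm hz σ τ, dd_add,
    dd_smul, dd_smul] at h2
  simp only [Derivation.add_apply, Derivation.smul_apply, holRing_add, holRing_smul] at h2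
  rw [← h2]
  simp only [jac]
  ring

/-- Each light-cone coordinate maps the whole tube to the half-plane, so the inequality applies even
if g does not preserve the plane. This matters for g⁻¹, of which no invariance is known yet. -/
theorem jac_bound (hg : Hol (val g)) {z : tube d} (hz : z ∈ range (embT d)) (σ τ : Bool) :
    ‖jac hg σ τ z‖ * (out τ z : ℂ).im + ‖jac hg σ (!τ) z‖ * (out (!τ) z : ℂ).im ≤
      (out σ (g z) : ℂ).im := by
  have h := pick_bound (pull hg (outF σ))
    (fun z => by rw [pull_apply, outF_apply]; exact (out σ (g z)).2) τ (out τ z) (out (!τ) z)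
  rw [ins_out τ (mem_range_embT.1 hz), pull_apply, outF_apply, ← sgn_not] at h
  exact h

/-- The Jacobian matrix is monomial. -/
theorem jac_monomial (hg : Hol (val g)) (hg' : Hol (val g')) (hgg : ∀ z, g' (g z) = z)
    (hm : MapsTo g (range (embT d)) (range (embT d))) {z : tube d} (hz : z ∈ range (embT d)) :
    (jac hg true false z = 0 ∧ jac hg false true z = 0) ∨
      (jac hg true true z = 0 ∧ jac hg false false z = 0) := by
  have y1 : 0 < (out true z : ℂ).im := (out true z).2
  have y2 : 0 < (out false z : ℂ).im := (out false z).2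
  have y1' : 0 < (out true (g z) : ℂ).im := (out true (g z)).2
  have y2' : 0 < (out false (g z) : ℂ).im := (out false (g z)).2
  have b1 := jac_bound hg hz true true
  have b2 := jac_bound hg hz false true
  have b3 := jac_bound hg' (hm hz) true true
  have b4 := jac_bound hg' (hm hz) false true
  have m1 := congrArg norm (jac_mul hg hg' hgg hm hz true true)
  have m2 := congrArg norm (jac_mul hg hg' hgg hm hz false false)
  simp only [Bool.not_true, Bool.not_false, hgg, sgn, if_true, Bool.false_eq_true, if_false]
    at b1 b2 b3 b4 m1 m2
  have n1 := (norm_add_le _ _).trans' m1.ge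
  have n2 := (norm_add_le _ _).trans' m2.ge
  simp only [norm_mul] at n1 n2
  norm_num at n1 n2
  set u1 := (out true z : ℂ).im
  set u2 := (out false z : ℂ).im
  set v1 := (out true (g z) : ℂ).im
  set v2 := (out false (g z) : ℂ).im
  have key := monomial_of_bounds (a := ‖jac hg true true z‖ * u1 / v1)
    (b := ‖jac hg true false z‖ * u2 / v1) (c := ‖jac hg false true z‖ * u1 / v2)
    (e := ‖jac hg false false z‖ * u2 / v2) (α := ‖jac hg' true true (g z)‖ * v1 / u1)
    (β := ‖jac hg' true false (g z)‖ * v2 / u1) (γ := ‖jac hg' false true (g z)‖ * v1 / u2)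
    (δ := ‖jac hg' false false (g z)‖ * v2 / u2) (by positivity) (by positivity) (by positivity)
    (by positivity) (by positivity) (by positivity) (by positivity) (by positivity)
    (by rw [← add_div, div_le_one y1']; exact b1) (by rw [← add_div, div_le_one y2']; exact b2)
    (by rw [← add_div, div_le_one y1]; exact b3) (by rw [← add_div, div_le_one y2]; exact b4)
    (by refine n1.trans_eq ?_; field_simp) (by refine n2.trans_eq ?_; field_simp; ring)
  simpa [y1.ne', y2.ne', y1'.ne', y2'.ne'] using key

theorem jac_ne_zero (hg : Hol (val g)) (hg' : Hol (val g')) (hgg : ∀ z, g' (g z) = z)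
    (hm : MapsTo g (range (embT d)) (range (embT d))) {z : tube d} (hz : z ∈ range (embT d))
    (σ τ : Bool) (h : jac hg (!σ) τ z = 0) : jac hg σ τ z ≠ 0 := fun h0 => by
  have h1 := jac_mul hg hg' hgg hm hz τ τ
  rw [sgn_mul_self] at h1
  cases σ <;> cases τ <;> simp_all

end Jacobian

/-! ### Holomorphic functions along coordinate lines of the plane -/

section Lines

variable {d : ℕ}

theorem hasDerivAt_ins (F : holRing (tube d)) (σ : Bool) (w c : H) :
    HasDerivAt (ext fun w : H => F (ins σ w c)) (dd (eu (sgn σ)) F (ins σ w c)) (w : ℂ) := by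
  have h1 : HasDerivAt (fun t : ℂ => t • eu (sgn σ) + (c : ℂ) • (eu (-sgn σ) : JC d))
      (eu (sgn σ)) (w : ℂ) := by
    simpa using ((hasDerivAt_id (w : ℂ)).smul_const (eu (sgn σ) : JC d)).add_const
      ((c : ℂ) • (eu (-sgn σ) : JC d))
  refine (hasDerivAt_holRing (F := F) h1 (ins_coe σ w c).symm).congr_of_eventuallyEq ?_
  filter_upwards [H.isOpen.mem_nhds w.2] with t ht
  rw [show ext (fun w : H => F (ins σ w c)) t = _ from ext_apply _ (⟨t, ht⟩ : H),
    ← ext_apply F.1, ins_coe]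

theorem eq_of_dd_eq_zero {F : holRing (tube d)} {σ : Bool} {c : H}
    (h : ∀ w, dd (eu (sgn σ)) F (ins σ w c) = 0) (w w' : H) : F (ins σ w c) = F (ins σ w' c) := by
  have h1 := H.isOpen.is_const_of_deriv_eq_zero (𝕜 := ℂ) (f := ext fun w : H => F (ins σ w c))
    (convex_halfSpace_im_gt 0).isPreconnected
    (fun t ht => (hasDerivAt_ins F σ ⟨t, ht⟩ c).differentiableAt.differentiableWithinAt)
    (fun t ht => (hasDerivAt_ins F σ ⟨t, ht⟩ c).deriv.trans (h _)) w.2 w'.2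
  rwa [ext_apply, ext_apply] at h1

theorem dd_eq_zero_of_eq {F : holRing (tube d)} {σ : Bool} {c : H}
    (h : ∀ w w', F (ins σ w c) = F (ins σ w' c)) (w : H) : dd (eu (sgn σ)) F (ins σ w c) = 0 := by
  refine (hasDerivAt_ins F σ w c).unique ?_
  refine (hasDerivAt_const (w : ℂ) (F (ins σ w c))).congr_of_eventuallyEq ?_
  filter_upwards [H.isOpen.mem_nhds w.2] with t ht
  rw [show ext (fun w : H => F (ins σ w c)) t = _ from ext_apply _ (⟨t, ht⟩ : H), h _ w]

theorem ins_mem_range (σ : Bool) (w c : H) : ins σ w c ∈ range (embT d) :=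
  mem_range_embT.2 (ins_succ σ w c)

theorem isClosed_range_embT : IsClosed (range (embT d)) := by
  have : range (embT d) = ⋂ k : Fin d, {z : tube d | (z : JC d) k.succ.succ = 0} := by
    ext z
    rw [mem_range_embT, mem_iInter]
    rfl
  rw [this]
  exact isClosed_iInter fun k => isClosed_eq (continuous_holRing (coord k.succ.succ)) continuous_const

end Lines

/-! ### Elements of G(c) act as products -/

section Product

variable {d : ℕ}

/-- The elements of `G` which preserve `T_{Ω(c)}`. -/
def planeStab (d : ℕ) : Set (Aut (tube d)) :=
  {g | g ∈ autNeutral (tube d) ∧ MapsTo g.1 (range (embT d)) (range (embT d))}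

theorem one_mem_planeStab : 1 ∈ planeStab d := ⟨mem_connectedComponent, fun _ h => h⟩

theorem continuous_coe_aut (T : Opens (JC d)) :
    Continuous fun g : Aut T => (⟨g.1, g.1.continuous⟩ : C(T, T)) :=
  continuous_induced_dom

theorem continuous_eval_aut {T : Opens (JC d)} (z : T) : Continuous fun g : Aut T => g.1 z :=
  (continuous_eval_const (F := C(T, T)) z).comp (continuous_coe_aut T)

/-- The automorphisms for which a coordinate on the plane does not depend on the first variable. -/
def indep (σ : Bool) : Set (Aut (tube d)) :=
  {g | ∀ w w' c, out σ (g.1 (ins true w c)) = out σ (g.1 (ins true w' c))}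

theorem isClosed_indep (σ : Bool) : IsClosed (indep σ : Set (Aut (tube d))) := by
  simp only [indep, ofPred_forall]
  refine isClosed_iInter fun w => isClosed_iInter fun w' => isClosed_iInter fun c => ?_
  exact isClosed_eq ((continuous_out σ).comp (continuous_eval_aut _))
    ((continuous_out σ).comp (continuous_eval_aut _))

theorem jac_eq_zero_of_indep {g : Aut (tube d)} {σ : Bool} (h : g ∈ indep σ) (w : H × H) :
    jac (hol_aut g) σ true (embT d w) = 0 :=
  dd_eq_zero_of_eq (F := pull (hol_aut g) (outF σ)) (σ := true) (c := w.2) (fun w₁ w₂ => by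
    rw [pull_apply, pull_apply, outF_apply, outF_apply, h]) w.1

theorem indep_of_jac {g : Aut (tube d)} {σ : Bool}
    (h : ∀ w, jac (hol_aut g) σ true (embT d w) = 0) : g ∈ indep σ := fun w w' c => by
  have := eq_of_dd_eq_zero (F := pull (hol_aut g) (outF σ)) (σ := true) (c := c)
    (fun w => h (w, c)) w w'
  rw [pull_apply, pull_apply, outF_apply, outF_apply] at this
  exact Subtype.ext this

/-- At each point of the plane exactly one entry of the first Jacobian column vanishes. Both
conditions are closed, so on the connected set H × H the same entry vanishes everywhere. -/
theorem planeStab_subset {g : Aut (tube d)} (hg : g ∈ planeStab d) :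
    g ∈ indep false ∨ g ∈ indep true := by
  have hcl : ∀ σ, IsClosed {w : H × H | jac (hol_aut g) σ true (embT d w) = 0} := fun σ =>
    isClosed_eq ((continuous_holRing _).comp (continuous_ins true)) continuous_const
  have := (isPreconnected_univ (α := H × H)).subset_or_subset_of_isClosed (hcl false) (hcl true)
    (fun w _ => (jac_monomial (hol_aut g) (hol_aut_symm g) g.1.symm_apply_apply hg.2 (mem_range_self w)).imp
      (fun h => h.2) fun h => h.1)
    (fun w _ h1 h2 => jac_ne_zero (hol_aut g) (hol_aut_symm g) g.1.symm_apply_apply hg.2 (mem_range_self w) true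
      true h1 h2)
  exact this.imp (fun h => indep_of_jac fun w => h (mem_univ w))
    fun h => indep_of_jac fun w => h (mem_univ w)

/-- The alternative of `planeStab_subset` is between two disjoint closed conditions on the connected
set `Gc d`, and the identity satisfies only the first. -/
theorem Gc_subset_indep : Gc d ⊆ indep false := by
  have h1 : Gc d ⊆ planeStab d := connectedComponentIn_subset _ _
  refine ((isPreconnected_connectedComponentIn : IsPreconnected (Gc d)).subset_or_subset_of_isClosed
    (isClosed_indep false) (isClosed_indep true) (fun g hg => planeStab_subset (h1 hg))
    fun g hg h2 h3 => jac_ne_zero (hol_aut g) (hol_aut_symm g) g.1.symm_apply_apply (h1 hg).2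
      (mem_range_self (iH, iH)) true true (jac_eq_zero_of_indep h2 _)
      (jac_eq_zero_of_indep h3 _)).resolve_right fun h => ?_
  have h2 : (1 : Aut (tube d)) ∈ indep true := h (mem_connectedComponentIn one_mem_planeStab)
  set j : H := ⟨2 * Complex.I, by change 0 < (2 * Complex.I).im; simp⟩
  have h3 : out true (ins true iH iH : tube d) = out true (ins true j iH) := h2 iH j iH
  rw [out_ins, out_ins] at h3
  have h4 := congrArg (fun w : H => (w : ℂ).im) h3
  simp [iH, j] at h4

theorem jac_diagonal {g : Aut (tube d)} (hg : g ∈ Gc d) (w : H × H) (σ : Bool) :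
    jac (hol_aut g) σ (!σ) (embT d w) = 0 ∧ jac (hol_aut g) σ σ (embT d w) ≠ 0 := by
  have hm : MapsTo g.1 (range (embT d)) (range (embT d)) := (connectedComponentIn_subset _ _ hg).2
  have h1 := jac_eq_zero_of_indep (Gc_subset_indep hg) w
  have h2 := jac_ne_zero (hol_aut g) (hol_aut_symm g) g.1.symm_apply_apply hm (mem_range_self w)
  have h3 : jac (hol_aut g) true false (embT d w) = 0 :=
    ((jac_monomial (hol_aut g) (hol_aut_symm g) g.1.symm_apply_apply hm (mem_range_self w)).resolve_right
      fun h => h2 true true h1 h.1).1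
  cases σ
  · exact ⟨h1, h2 false false h3⟩
  · exact ⟨h3, h2 true true h1⟩

/-- The factors of the restriction of an automorphism to `T_{Ω(c)}`. -/
def factor (g : Aut (tube d)) (σ : Bool) (w : H) : H := out σ (g.1 (ins σ w iH))

theorem jac_ins {g : Aut (tube d)} (hg : g ∈ Gc d) (σ : Bool) (w c : H) :
    jac (hol_aut g) σ (!σ) (ins σ w c) = 0 ∧ jac (hol_aut g) σ σ (ins σ w c) ≠ 0 := by
  obtain ⟨v, hv⟩ := ins_mem_range (d := d) σ w c
  rw [← hv]
  exact jac_diagonal hg v σ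

theorem out_eq_factor {g : Aut (tube d)} (hg : g ∈ Gc d) (σ : Bool) (w c : H) :
    out σ (g.1 (ins σ w c)) = factor g σ w := by
  have := eq_of_dd_eq_zero (F := pull (hol_aut g) (outF σ)) (σ := !σ) (c := w)
    (fun c => by rw [ins_not]; exact (jac_ins hg σ w c).1) c iH
  rw [ins_not, ins_not, pull_apply, pull_apply, outF_apply, outF_apply] at this
  exact Subtype.ext this

theorem apply_ins {g : Aut (tube d)} (hg : g ∈ Gc d) (σ : Bool) (w c : H) :
    g.1 (ins σ w c) = ins σ (factor g σ w) (factor g (!σ) c) := by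
  have hm : MapsTo g.1 (range (embT d)) (range (embT d)) := (connectedComponentIn_subset _ _ hg).2
  rw [← ins_out σ (mem_range_embT.1 (hm (ins_mem_range σ w c))), out_eq_factor hg]
  congr 1
  rw [← ins_not, out_eq_factor hg]

theorem hasDerivAt_out {h : tube d → tube d} (hh : Hol (val h)) (σ : Bool) (w c : H) :
    HasDerivAt (ext (val fun w : H => out σ (h (ins σ w c)))) (jac hh σ σ (ins σ w c)) (w : ℂ) := by
  have h1 := hasDerivAt_ins (pull hh (outF σ)) σ w c
  simp only [pull_apply, outF_apply] at h1
  exact h1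

theorem hol_out {h : tube d → tube d} (hh : Hol (val h)) (σ : Bool) (c : H) :
    Hol (val fun w : H => out σ (h (ins σ w c))) := fun t ht =>
  (hasDerivAt_out hh σ ⟨t, ht⟩ c).differentiableAt.differentiableWithinAt

theorem continuous_out_ins {h : tube d → tube d} (hh : Continuous h) (σ : Bool) (c : H) :
    Continuous fun w : H => out σ (h (ins σ w c)) :=
  (continuous_out σ).comp (hh.comp ((continuous_ins σ).comp (by fun_prop : Continuous fun w : H =>
    (w, c))))

/-- Invariance of the plane is assumed as an inclusion only, so surjectivity needs an argument. The
range is open since the derivative does not vanish, and closed as the set of c for which g⁻¹ sends a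
point of the plane with coordinate c back into the closed plane; H is connected. -/
theorem range_factor {g : Aut (tube d)} (hg : g ∈ Gc d) (σ : Bool) : range (factor g σ) = univ := by
  have hcl : IsClosed (range (factor g σ)) := by
    have : range (factor g σ) =
        {c | g.1.symm (ins σ c (factor g (!σ) iH)) ∈ range (embT d)} := by
      ext c
      constructor
      · rintro ⟨w, rfl⟩
        rw [mem_ofPred_eq]
        rw [← apply_ins hg, Homeomorph.symm_apply_apply]
        exact ins_mem_range _ _ _
      · intro hc
        have h1 := ins_out σ (mem_range_embT.1 hc)
        rw [Homeomorph.eq_symm_apply, apply_ins hg] at h1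
        have h2 := congrArg (out σ) h1
        rw [out_ins, out_ins] at h2
        exact ⟨_, h2⟩
    rw [this]
    exact isClosed_range_embT.preimage (g.1.symm.continuous.comp ((continuous_ins σ).comp
      (by fun_prop : Continuous fun w : H => (w, factor g (!σ) iH))))
  have hop : IsOpen (range (factor g σ)) := by
    set f := ext (val (factor g σ))
    have hd : DifferentiableOn ℂ f H := hol_out (hol_aut g) σ iH
    have h1 : range (factor g σ) = Subtype.val ⁻¹' (f '' (H : Set ℂ)) := by
      ext c
      constructor
      · rintro ⟨w, rfl⟩
        exact ⟨w, w.2, ext_apply _ _⟩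
      · rintro ⟨w, hw, h⟩
        exact ⟨⟨w, hw⟩, Subtype.ext (by
          rw [← h]
          exact (ext_apply (val (factor g σ)) (⟨w, hw⟩ : H)).symm)⟩
    rw [h1]
    refine IsOpen.preimage continuous_subtype_val (isOpen_iff_mem_nhds.2 ?_)
    rintro _ ⟨w, hw, rfl⟩
    have h2 := hasDerivAt_out (hol_aut g) σ ⟨w, hw⟩ iH
    have h3 : HasStrictDerivAt f (jac (hol_aut g) σ σ (ins σ ⟨w, hw⟩ iH)) w := by
      have h4 := (hd.analyticAt (H.isOpen.mem_nhds hw)).hasStrictDerivAt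
      rwa [show deriv f w = _ from h2.deriv] at h4
    rw [← h3.map_nhds_eq (jac_ins hg σ _ _).2]
    exact image_mem_map (H.isOpen.mem_nhds hw)
  exact IsClopen.eq_univ ⟨hcl, hop⟩ ⟨_, mem_range_self iH⟩

/-- The factors as automorphisms of the upper half-plane. -/
def factorAut {g : Aut (tube d)} (hg : g ∈ Gc d) (σ : Bool) : Aut H :=
  have hl : ∀ w, out σ (g.1.symm (ins σ (factor g σ w) (factor g (!σ) iH))) = w := fun w => by
    rw [← apply_ins hg, Homeomorph.symm_apply_apply, out_ins]
  ⟨{ toFun := factor g σ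
     invFun := fun c => out σ (g.1.symm (ins σ c (factor g (!σ) iH)))
     left_inv := hl
     right_inv := fun c => by
       obtain ⟨w, rfl⟩ : c ∈ range (factor g σ) := range_factor hg σ ▸ mem_univ c
       exact congrArg _ (hl w)
     continuous_toFun := continuous_out_ins g.1.continuous σ iH
     continuous_invFun := continuous_out_ins g.1.symm.continuous σ _ },
    hol_out (hol_aut g) σ iH, hol_out (hol_aut_symm g) σ _⟩

/-- The factor is obtained from g by composing with fixed continuous maps on both sides, which is
continuous for the compact-open topology. So the factors of elements of `Gc d` form a connected set
containing the identity. -/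
theorem factorAut_mem {g : Aut (tube d)} (hg : g ∈ Gc d) (σ : Bool) :
    factorAut hg σ ∈ autNeutral H := by
  have h1 : (1 : Aut (tube d)) ∈ Gc d := mem_connectedComponentIn one_mem_planeStab
  set K : Gc d → Aut H := fun g => factorAut g.2 σ
  have hK : Continuous K := by
    refine continuous_induced_rng.2 ?_
    set s : C(H, tube d) := ⟨fun w => ins σ w iH, ((continuous_ins σ).comp (by fun_prop : Continuous fun w : H =>
      (w, iH)))⟩
    exact ((ContinuousMap.continuous_postcomp ⟨out σ, continuous_out σ⟩).comp
      (ContinuousMap.continuous_precomp s)).comp ((continuous_coe_aut _).comp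
        continuous_subtype_val)
  have h2 : K ⟨1, h1⟩ = 1 := Subtype.ext (Homeomorph.ext fun w => out_ins σ w iH)
  have : PreconnectedSpace (Gc d) :=
    Subtype.preconnectedSpace isPreconnected_connectedComponentIn
  exact (isPreconnected_range hK).subset_connectedComponent ⟨_, h2⟩ ⟨⟨g, hg⟩, rfl⟩

end Product

/-! ### Restriction on the level of the double coverings -/

section Lift

variable {d : ℕ}

theorem jdetC_plane (a b : ℂ) : jdetC (a • eu (sgn true) + b • eu (sgn false) : JC d) = a * b := by
  rw [jdetC_eq_bil, bil_eq]
  simp [sgn]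
  ring

theorem der_factorAut {g : Aut (tube d)} (hg : g ∈ Gc d) (σ : Bool) (w c : H) :
    der (val (factorAut hg σ).1) w 1 = jac (hol_aut g) σ σ (ins σ w c) := by
  have h1 := ((factorAut hg σ).2.1.hasFDerivAt w).hasDerivAt
  have h2 := hasDerivAt_out (hol_aut g) σ w c
  simp only [out_eq_factor hg] at h2
  exact h1.unique h2

/-- The determinant of the plane is the product of the two light-cone coordinates and the Jacobian
is diagonal, so evaluating the cocycle at c₁ + c₂ gives the product of the derivatives. -/
theorem Cover.ψ_sq {g : Cover (tube d) jdetC} (hg : g.toAut ∈ Gc d) (w₁ w₂ : H) :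
    g.ψ (embT d (w₁, w₂)) ^ 2 = der (val (factorAut hg true).1) w₁ 1 *
      der (val (factorAut hg false).1) w₂ 1 := by
  have hm : MapsTo g.toAut.1 (range (embT d)) (range (embT d)) :=
    (connectedComponentIn_subset _ _ hg).2
  have h1 := g.sq (embT d (w₁, w₂)) ((1 : ℂ) • eu (sgn true) + (1 : ℂ) • eu (sgn false))
  have hz : embT d (w₁, w₂) ∈ range (embT d) := mem_range_self _
  have h2 := (jac_diagonal hg (w₁, w₂) true).1
  have h3 := (jac_diagonal hg (w₁, w₂) false).1
  rw [Bool.not_true] at h2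
  rw [Bool.not_false] at h3
  rw [one_smul, one_smul, map_add, der_eu (hol_aut g.toAut) hm hz true true,
    der_eu (hol_aut g.toAut) hm hz true false, Bool.not_true, h2, h3, zero_smul, zero_smul, add_zero,
    zero_add, jdetC_plane, ← one_smul ℂ (eu (sgn true) : JC d),
    ← one_smul ℂ (eu (sgn false) : JC d), jdetC_plane, mul_one, mul_one] at h1
  rw [der_factorAut hg true w₁ w₂, der_factorAut hg false w₂ w₁]
  exact h1.symm

/-- An automorphism of the upper half-plane with a square root of its derivative. -/
def Cover.ofAut (a : Aut H) (ψ : H → ℂ) (hψ : Hol ψ) (h : ∀ w, der (val a.1) w 1 = ψ w ^ 2)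
    (h0 : ∀ w, ψ w ≠ 0) : Cover H (id : ℂ → ℂ) where
  toAut := a
  ψ := ψ
  hol := hψ
  sq w x := by
    rw [id, id, ← h, mul_comm, ← smul_eq_mul, ← map_smul, smul_eq_mul, mul_one]
  ne_zero := h0

theorem hol_slice (F : holRing (tube d)) (σ : Bool) (c : H) : Hol fun w : H => F (ins σ w c) :=
  fun t ht => (hasDerivAt_ins F σ ⟨t, ht⟩ c).differentiableAt.differentiableWithinAt

/-- The square roots of the two derivatives are slices of ψ_g through the point (i, i), normalized
by a square root c of the second derivative at i. -/
theorem exists_restriction {g : Cover (tube d) jdetC} (hg : g ∈ GcCover d) :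
    ∃ g₁ ∈ GH, ∃ g₂ ∈ GH, IsRestriction g g₁ g₂ := by
  have hg' : g.toAut ∈ Gc d := hg
  set F : holRing (tube d) := ⟨g.ψ, g.hol⟩
  have hF : ∀ z, F z ≠ 0 := g.ne_zero
  set D₁ : H → ℂ := fun w => der (val (factorAut hg' true).1) w 1
  set D₂ : H → ℂ := fun w => der (val (factorAut hg' false).1) w 1
  have hsq : ∀ w₁ w₂, F (embT d (w₁, w₂)) ^ 2 = D₁ w₁ * D₂ w₂ := Cover.ψ_sq hg'
  have hD : ∀ w₁ w₂, D₁ w₁ * D₂ w₂ ≠ 0 := fun w₁ w₂ => hsq w₁ w₂ ▸ pow_ne_zero 2 (hF _)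
  obtain ⟨c, hc⟩ := IsAlgClosed.exists_pow_nat_eq (D₂ iH) two_pos
  have hc0 : c ≠ 0 := fun h => by
    refine right_ne_zero_of_mul (hD iH iH) ?_
    rw [← hc, h]
    simp
  set ψ₁ : H → ℂ := fun w => (c⁻¹ • F) (ins true w iH) with hψ₁
  have e₁ : ∀ w, ψ₁ w = c⁻¹ * F (embT d (w, iH)) := fun _ => rfl
  have n₁ : ∀ w, ψ₁ w ≠ 0 := fun w => mul_ne_zero (inv_ne_zero hc0) (hF _)
  have s₁ : ∀ w, D₁ w = ψ₁ w ^ 2 := fun w => by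
    rw [e₁, mul_pow, hsq, ← hc]
    field_simp
  set ψ₂ : H → ℂ := fun w => ((ψ₁ iH)⁻¹ • F) (ins false w iH)
  have e₂ : ∀ w, ψ₂ w = (ψ₁ iH)⁻¹ * F (embT d (iH, w)) := fun _ => rfl
  have n₂ : ∀ w, ψ₂ w ≠ 0 := fun w => mul_ne_zero (inv_ne_zero (n₁ _)) (hF _)
  have s₂ : ∀ w, D₂ w = ψ₂ w ^ 2 := fun w => by
    have := n₁ iH
    rw [e₂, mul_pow, hsq, s₁]
    field_simp
  have h₁ : Hol ψ₁ := hol_slice _ _ _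
  have h₂ : Hol ψ₂ := hol_slice _ _ _
  have hcont : ∀ {ψ : H → ℂ}, Hol ψ → Continuous ψ := fun {ψ} h =>
    h.continuousOn.domRestrict.congr fun z => ext_apply ψ z
  -- The two sides have equal squares, do not vanish and agree at (i, i); on a connected set they
  -- coincide.
  have key : EqOn (fun w : H × H => F (embT d w)) (fun w => ψ₁ w.1 * ψ₂ w.2) univ := by
    refine isPreconnected_univ.eq_of_sq_eq
      ((continuous_holRing F).comp (continuous_ins true)).continuousOn
      (((hcont h₁).comp continuous_fst).mul ((hcont h₂).comp continuous_snd)).continuousOn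
      (fun w _ => ?_) (fun {w} _ => mul_ne_zero (n₁ _) (n₂ _)) (mem_univ (iH, iH)) ?_
    · simp only [Pi.pow_apply]
      rw [mul_pow, ← s₁, ← s₂, ← hsq]
    · change F (embT d (iH, iH)) = ψ₁ iH * ψ₂ iH
      rw [e₂, mul_inv_cancel_left₀ (n₁ iH)]
  refine ⟨Cover.ofAut (factorAut hg' true) ψ₁ h₁ s₁ n₁, factorAut_mem hg' true,
    Cover.ofAut (factorAut hg' false) ψ₂ h₂ s₂ n₂, factorAut_mem hg' false, fun w₁ w₂ => ?_⟩
  exact ⟨apply_ins hg' true w₁ w₂, key (mem_univ (w₁, w₂))⟩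

end Lift

end SBDO

end

theorem theorem6p1 (d : ℕ) (hd : 2 ≤ d) (m p : ℕ) (E : Type*) [AddCommGroup E] [Module ℝ E]
    [Module.Finite ℝ E] [Module (CliffordAlgebra (SBDO.quad d)) E]
    [IsScalarTower ℝ (CliffordAlgebra (SBDO.quad d)) E]
    (hreg : SBDO.IsRegular d E) (hdim : Module.finrank ℝ E = 4 * m)
    (g : SBDO.Cover (SBDO.tube d) SBDO.jdetC) (hg : g ∈ SBDO.GcCover d) :
    (∃ g₁ ∈ SBDO.GH, ∃ g₂ ∈ SBDO.GH, SBDO.IsRestriction g g₁ g₂) ∧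
      ∀ g₁ ∈ SBDO.GH, ∀ g₂ ∈ SBDO.GH, SBDO.IsRestriction g g₁ g₂ →
        ∀ F : SBDO.tube d → ℂ, SBDO.Hol F →
          SBDO.res (SBDO.D d m p (SBDO.rep m g F)) =
            SBDO.repTensor (m + 2 * p) (m + 2 * p) g₁ g₂ (SBDO.res (SBDO.D d m p F)) :=
  ⟨SBDO.exists_restriction hg, fun _ _ _ _ h _ hF => SBDO.covariance hd m p h hF⟩
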